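/- All vector spaces are over $\mathbb C$. Let $\dot{\mathfrak g}=\dot{\mathfrak g}_{\bar 0}\oplus\dot{\mathfrak g}_{\bar 1}$ be a finite-dimensional Lie superalgebra (possibly a Lie algebra), let $d$ be an even derivation of $\dot{\mathfrak g}$ that does not have $1$ as an eigenvalue, and let $\sigma$ be an automorphism of $\dot{\mathfrak g}$ of order $n\ge 1$ that commutes with $d$. **Notation.** Put $\omega=e^{2\pi i/n}$ and $\dot{\mathfrak g}_{[k]}=\{x\in\dot{\mathfrak g}:\sigma(x)=\omega^kx\}$ for $k\in\mathbb Z$. The Lie superalgebra $\mathfrak L=\mathfrak L(\dot{\mathfrak g},d,\sigma)$ is the semidirect product $W\ltimes\mathfrak g$, where the Witt algebra $W$ is even with basis $\mathfrak l_i$ ($i\in\mathbb Z$) and $\mathfrak g$ is spanned by the elements $x\otimes t^{k/n}$ with $k\in\mathbb Z$, $x\in\dot{\mathfrak g}_{[k]}$, with brackets $$[\mathfrak l_i,\mathfrak l_j]=(j-i)\mathfrak l_{i+j},\qquad [\mathfrak l_i,x\otimes t^a]=(ax+i\,d(x))\otimes t^{a+i},\qquad [x\otimes t^a,y\otimes t^b]=[x,y]\otimes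 t^{a+b}.$$ For a Lie superalgebra $L$, $H^2(L,\mathbb C^{1|1})_{\bar 0}$ is the space of even super skew-symmetric bilinear maps $\alpha:L\times L\to\mathbb C^{1|1}$ with $$\alpha(x,[y,z])=\alpha([x,y],z)+(-1)^{|x||y|}\alpha(y,[x,z]),$$ modulo the maps $(x,y)\mapsto f([x,y])$ with $f:L\to\mathbb C^{1|1}$ even and linear. The space $Z^2(L)$ consists of the bilinear forms $\alpha:L\times L\to\mathbb C$, not necessarily homogeneous, that satisfy the same two conditions (super skew-symmetry and the displayed identity). The operators $d$ and $\sigma$ act on (classes of) bilinear maps on $\dot{\mathfrak g}$ by $$(d\alpha)(x,y)=\alpha(dx,y)+\alpha(x,dy),\qquad (\sigma\alpha)(x,y)=\alpha(\sigma x,\sigma y),$$ and the superscript $d,\sigma$ denotes the elements $\alpha$ with $d\alpha=\alpha$ and $\sigma\alpha=\alpha$. Let $\ddot{\mathfrak g}=\mathbb C\partial\ltimes\dot{\mathfrak g}$ with $\partial$ even, $[\partial,x]=d(x)$ and $\sigma(\partial)=\partial$. Let $\operatorname{Inv}(\ddot{\mathfrak g})^\sigma$ be the space of bilinear forms $B:\ddot{\mathfrak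 g}\times\ddot{\mathfrak g}\to\mathbb C$, not necessarily homogeneous, with $B(x,y)=(-1)^{|x||y|}B(y,x)$, $B([x,y],z)=B(x,[y,z])$ and $B(\sigma x,\sigma y)=B(x,y)$. Finally let $$Q=\dot{\mathfrak g}\big/\big((d+1)\dot{\mathfrak g}+[(d+\tfrac12)\dot{\mathfrak g},\dot{\mathfrak g}]+[\dot{\mathfrak g},[\dot{\mathfrak g},\dot{\mathfrak g}]]\big),$$ and let $Q^\sigma$ be the subspace of $\sigma$-invariants. **Theorem.** (1) There is an isomorphism of vector spaces $$H^2(\mathfrak L,\mathbb C^{1|1})_{\bar 0}\;\cong\; H^2(\dot{\mathfrak g},\mathbb C^{1|1})_{\bar 0}^{\,d,\sigma}\;\oplus\;\operatorname{Inv}(\ddot{\mathfrak g})^{\sigma}\;\oplus\;Q^{\sigma}.$$ (2) Let $Z=Q^\sigma\oplus(\operatorname{Inv}(\ddot{\mathfrak g})^\sigma)^*\oplus(Z^2(\dot{\mathfrak g})^{d,\sigma})^*$, with the $\mathbb Z/2$-gradation induced by that of $\dot{\mathfrak g}$. There is an even $2$-cocycle $\Omega:\mathfrak L\times\mathfrak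 L\to Z$ given by $$\Omega(\mathfrak l_i,\mathfrak l_j)=\delta_{i+j,0}\Big(0,\;B\mapsto\tfrac{i^3-i}{12}B(\partial,\partial),\;0\Big),$$ $$\Omega(\mathfrak l_i,x\otimes t^a)=\delta_{i+a,0}\Big(\tfrac{i^3-i}{12}\,\bar x,\;B\mapsto(i^2-i)B(\partial,x),\;0\Big),$$ $$\Omega(x\otimes t^a,y\otimes t^b)=\delta_{a+b,0}\Big(\tfrac{1-4a^2}{24}\,\overline{[x,y]},\;B\mapsto aB(x,y)+B(\partial,[x,y]),\;\alpha\mapsto\alpha(x,y)\Big),$$ where $\bar x$ is the class of $x$ in $Q$, and the central extension $\hat{\mathfrak L}=\mathfrak L\oplus Z\to\mathfrak L$ with bracket $[(u,z),(v,z')]=([u,v],\Omega(u,v))$ is the universal central extension of $\mathfrak L$. -/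

import Mathlib

set_option maxSynthPendingDepth 3

universe u v w

noncomputable section

/-! ### Superspaces and Lie superalgebras over `ℂ` -/

/-- The sign `(-1)^{ij}` for parities `i, j`. -/
def koszul (i j : ZMod 2) : ℂ := if i = 1 ∧ j = 1 then -1 else 1

/-- A complex vector space with a `ℤ/2`-gradation `V = V₀ ⊕ V₁`. -/
class SuperSpace (V : Type*) [AddCommGroup V] [Module ℂ V] where
  /-- the homogeneous components -/
  part : ZMod 2 → Submodule ℂ V
  isCompl : IsCompl (part 0) (part 1)

open SuperSpace

/-- A complex Lie superalgebra, with bracket `br`. -/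
class LieSuperalgebra (L : Type*) [AddCommGroup L] [Module ℂ L] extends SuperSpace L where
  /-- the bracket -/
  br : L →ₗ[ℂ] L →ₗ[ℂ] L
  br_mem : ∀ i j : ZMod 2, ∀ x ∈ part i, ∀ y ∈ part j, br x y ∈ part (i + j)
  br_skew : ∀ i j : ZMod 2, ∀ x ∈ part i, ∀ y ∈ part j, br x y = -(koszul i j • br y x)
  br_jacobi : ∀ i j : ZMod 2, ∀ x ∈ part i, ∀ y ∈ part j, ∀ z,
    br x (br y z) = br (br x y) z + koszul i j • br y (br x z)

open LieSuperalgebra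

theorem zmod2_cases (i : ZMod 2) : i = 0 ∨ i = 1 := by
  revert i; decide

theorem isCompl_of_decomp {V : Type*} [AddCommGroup V] [Module ℂ V] {P Q : Submodule ℂ V}
    (hd : ∀ v, v ∈ P → v ∈ Q → v = 0) (hc : ∀ v, ∃ a ∈ P, ∃ b ∈ Q, a + b = v) :
    IsCompl P Q := by
  constructor
  · rw [Submodule.disjoint_def]; exact hd
  · rw [codisjoint_iff, eq_top_iff]
    intro v _
    obtain ⟨a, ha, b, hb, rfl⟩ := hc v
    exact Submodule.add_mem_sup ha hb

section Parity

variable {V : Type*} [AddCommGroup V] [Module ℂ V] [SuperSpace V]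

theorem exists_decomp (v : V) : ∃ a ∈ part (V := V) 0, ∃ b ∈ part (V := V) 1, a + b = v :=
  Submodule.mem_sup.1 ((isCompl (V := V)).sup_eq_top ▸ Submodule.mem_top)

theorem eq_zero_of_even_odd {v : V} (h0 : v ∈ part (V := V) 0) (h1 : v ∈ part (V := V) 1) :
    v = 0 :=
  Submodule.disjoint_def.1 (isCompl (V := V)).disjoint v h0 h1

/-- The parity involution: `1` on the even part and `-1` on the odd part. -/
def parityMap (V : Type*) [AddCommGroup V] [Module ℂ V] [SuperSpace V] : V →ₗ[ℂ] V :=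
  (2 : ℂ) • ((part (V := V) 0).subtype ∘ₗ
    Submodule.projectionOnto _ _ (isCompl (V := V))) - LinearMap.id

theorem parityMap_even {v : V} (h : v ∈ part (V := V) 0) : parityMap V v = v := by
  have := Submodule.projectionOnto_apply_left (isCompl (V := V)) ⟨v, h⟩
  simp only at this
  simp [parityMap, this, two_smul]

theorem parityMap_odd {v : V} (h : v ∈ part (V := V) 1) : parityMap V v = -v := by
  have := (Submodule.projectionOnto_apply_eq_zero_iff (isCompl (V := V))).2 h
  simp [parityMap, this]

theorem parityMap_mem (i : ZMod 2) {v : V} (h : v ∈ part (V := V) i) :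
    parityMap V v ∈ part (V := V) i := by
  fin_cases i
  · have h' : v ∈ part (V := V) 0 := h
    exact (parityMap_even h').symm ▸ h
  · have h' : v ∈ part (V := V) 1 := h
    rw [parityMap_odd h']; exact Submodule.neg_mem _ h

theorem parityMap_comm (f : V →ₗ[ℂ] V) (hf : ∀ i, ∀ x ∈ part (V := V) i, f x ∈ part (V := V) i)
    (v : V) : parityMap V (f v) = f (parityMap V v) := by
  obtain ⟨a, ha, b, hb, rfl⟩ := exists_decomp v
  simp only [map_add, parityMap_even ha, parityMap_odd hb, parityMap_even (hf 0 a ha),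
    parityMap_odd (hf 1 b hb), map_neg]

theorem half_add_parityMap_mem (v : V) :
    (2⁻¹ : ℂ) • (v + parityMap V v) ∈ part (V := V) 0 := by
  obtain ⟨a, ha, b, hb, rfl⟩ := exists_decomp v
  have : (2⁻¹ : ℂ) • ((a + b) + parityMap V (a + b)) = a := by
    simp only [map_add, parityMap_even ha, parityMap_odd hb]; module
  rwa [this]

theorem half_sub_parityMap_mem (v : V) :
    (2⁻¹ : ℂ) • (v - parityMap V v) ∈ part (V := V) 1 := by
  obtain ⟨a, ha, b, hb, rfl⟩ := exists_decomp v
  have : (2⁻¹ : ℂ) • ((a + b) - parityMap V (a + b)) = b := by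
    simp only [map_add, parityMap_even ha, parityMap_odd hb]; module
  rwa [this]

end Parity

theorem parityMap_br {L : Type*} [AddCommGroup L] [Module ℂ L] [LieSuperalgebra L] (x y : L) :
    parityMap L (br x y) = br (parityMap L x) (parityMap L y) := by
  obtain ⟨a, ha, b, hb, rfl⟩ := exists_decomp x
  obtain ⟨a', ha', b', hb', rfl⟩ := exists_decomp y
  have h00 : br a a' ∈ part (V := L) 0 := br_mem 0 0 a ha a' ha'
  have h01 : br a b' ∈ part (V := L) 1 := br_mem 0 1 a ha b' hb'
  have h10 : br b a' ∈ part (V := L) 1 := br_mem 1 0 b hb a' ha'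
  have h11 : br b b' ∈ part (V := L) 0 := br_mem 1 1 b hb b' hb'
  simp only [map_add, LinearMap.add_apply, parityMap_even ha, parityMap_even ha',
    parityMap_odd hb, parityMap_odd hb', parityMap_even h00, parityMap_even h11,
    parityMap_odd h01, parityMap_odd h10, map_neg, LinearMap.neg_apply]
  abel

/-- The superspace `ℂ^{1|1}`: the first coordinate is even, the second one is odd. -/
instance superSpaceC11 : SuperSpace (ℂ × ℂ) where
  part i := if i = 0 then LinearMap.ker (LinearMap.snd ℂ ℂ ℂ)
    else LinearMap.ker (LinearMap.fst ℂ ℂ ℂ)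
  isCompl := by
    apply isCompl_of_decomp
    · rintro ⟨a, b⟩ h1 h2
      simp_all
    · rintro ⟨a, b⟩
      exact ⟨(a, 0), by simp, (0, b), by simp, by simp⟩

/-! ### Even second cohomology with trivial coefficients -/

section Cohomology

variable (L : Type*) [AddCommGroup L] [Module ℂ L] [LieSuperalgebra L]
variable (M : Type*) [AddCommGroup M] [Module ℂ M] [SuperSpace M]

/-- Even `2`-cocycles of `L` with values in the trivial module `M`. -/
def evenCocycles : Submodule ℂ (L →ₗ[ℂ] L →ₗ[ℂ] M) where
  carrier := {α |
    (∀ i j : ZMod 2, ∀ x ∈ part (V := L) i, ∀ y ∈ part (V := L) j,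
      α x y ∈ part (V := M) (i + j)) ∧
    (∀ i j : ZMod 2, ∀ x ∈ part (V := L) i, ∀ y ∈ part (V := L) j,
      α x y = -(koszul i j • α y x)) ∧
    (∀ i j : ZMod 2, ∀ x ∈ part (V := L) i, ∀ y ∈ part (V := L) j, ∀ z,
      α x (br y z) = α (br x y) z + koszul i j • α y (br x z))}
  zero_mem' := by
    refine ⟨?_, ?_, ?_⟩ <;> intros <;> simp
  add_mem' := by
    rintro α β ⟨h1, h2, h3⟩ ⟨k1, k2, k3⟩
    refine ⟨fun i j x hx y hy => Submodule.add_mem _ (h1 i j x hx y hy) (k1 i j x hx y hy),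
      fun i j x hx y hy => ?_, fun i j x hx y hy z => ?_⟩
    · simp only [LinearMap.add_apply]
      rw [h2 i j x hx y hy, k2 i j x hx y hy]; module
    · simp only [LinearMap.add_apply]
      rw [h3 i j x hx y hy, k3 i j x hx y hy]; module
  smul_mem' := by
    rintro c α ⟨h1, h2, h3⟩
    refine ⟨fun i j x hx y hy => Submodule.smul_mem _ c (h1 i j x hx y hy),
      fun i j x hx y hy => ?_, fun i j x hx y hy z => ?_⟩
    · simp only [LinearMap.smul_apply]
      rw [h2 i j x hx y hy]; module
    · simp only [LinearMap.smul_apply]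
      rw [h3 i j x hx y hy]; module

/-- Even `2`-coboundaries: the cocycles `(x, y) ↦ f [x, y]` with `f : L → M` linear and even. -/
def evenCoboundaries : Submodule ℂ (evenCocycles L M) where
  carrier := {α | ∃ f : L →ₗ[ℂ] M,
    (∀ i : ZMod 2, ∀ x ∈ part (V := L) i, f x ∈ part (V := M) i) ∧
    ∀ x y, α.1 x y = f (br x y)}
  zero_mem' := ⟨0, by simp, by simp⟩
  add_mem' := by
    rintro α β ⟨f, hf, hα⟩ ⟨g, hg, hβ⟩
    exact ⟨f + g, fun i x hx => Submodule.add_mem _ (hf i x hx) (hg i x hx),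
      fun x y => by simp [hα, hβ]⟩
  smul_mem' := by
    rintro c α ⟨f, hf, hα⟩
    exact ⟨c • f, fun i x hx => Submodule.smul_mem _ c (hf i x hx), fun x y => by simp [hα]⟩

/-- The even second cohomology `H²(L, M)₀` with coefficients in the trivial module `M`. -/
abbrev EvenH2 : Type _ := evenCocycles L M ⧸ evenCoboundaries L M

end Cohomology

/-! ### Scalar-valued bilinear forms -/

section Forms

variable (L : Type*) [AddCommGroup L] [Module ℂ L] [LieSuperalgebra L]

/-- Scalar-valued `2`-cocycles of `L` (of arbitrary parity). -/
def scalarCocycles : Submodule ℂ (L →ₗ[ℂ] L →ₗ[ℂ] ℂ) where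
  carrier := {α |
    (∀ i j : ZMod 2, ∀ x ∈ part (V := L) i, ∀ y ∈ part (V := L) j,
      α x y = -(koszul i j * α y x)) ∧
    (∀ i j : ZMod 2, ∀ x ∈ part (V := L) i, ∀ y ∈ part (V := L) j, ∀ z,
      α x (br y z) = α (br x y) z + koszul i j * α y (br x z))}
  zero_mem' := by
    refine ⟨?_, ?_⟩ <;> intros <;> simp
  add_mem' := by
    rintro α β ⟨h2, h3⟩ ⟨k2, k3⟩
    refine ⟨fun i j x hx y hy => ?_, fun i j x hx y hy z => ?_⟩
    · simp only [LinearMap.add_apply]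
      rw [h2 i j x hx y hy, k2 i j x hx y hy]; ring
    · simp only [LinearMap.add_apply]
      rw [h3 i j x hx y hy, k3 i j x hx y hy]; ring
  smul_mem' := by
    rintro c α ⟨h2, h3⟩
    refine ⟨fun i j x hx y hy => ?_, fun i j x hx y hy z => ?_⟩
    · simp only [LinearMap.smul_apply, smul_eq_mul]
      rw [h2 i j x hx y hy]; ring
    · simp only [LinearMap.smul_apply, smul_eq_mul]
      rw [h3 i j x hx y hy]; ring

/-- Supersymmetric invariant bilinear forms on `L` (of arbitrary parity). -/
def invForms : Submodule ℂ (L →ₗ[ℂ] L →ₗ[ℂ] ℂ) where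
  carrier := {B |
    (∀ i j : ZMod 2, ∀ x ∈ part (V := L) i, ∀ y ∈ part (V := L) j,
      B x y = koszul i j * B y x) ∧
    (∀ x y z, B (br x y) z = B x (br y z))}
  zero_mem' := by
    refine ⟨?_, ?_⟩ <;> intros <;> simp
  add_mem' := by
    rintro α β ⟨h2, h3⟩ ⟨k2, k3⟩
    refine ⟨fun i j x hx y hy => ?_, fun x y z => ?_⟩
    · simp only [LinearMap.add_apply]
      rw [h2 i j x hx y hy, k2 i j x hx y hy]; ring
    · simp only [LinearMap.add_apply, h3, k3]
  smul_mem' := by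
    rintro c α ⟨h2, h3⟩
    refine ⟨fun i j x hx y hy => ?_, fun x y z => ?_⟩
    · simp only [LinearMap.smul_apply, smul_eq_mul]
      rw [h2 i j x hx y hy]; ring
    · simp only [LinearMap.smul_apply, h3]

/-- A bilinear form has parity `i` when it vanishes on `L_j × L_k` for `j + k ≠ i`. -/
def HasParity {V : Type*} [AddCommGroup V] [Module ℂ V] [SuperSpace V]
    (B : V →ₗ[ℂ] V →ₗ[ℂ] ℂ) (i : ZMod 2) : Prop :=
  ∀ j k : ZMod 2, j + k ≠ i → ∀ x ∈ part (V := V) j, ∀ y ∈ part (V := V) k, B x y = 0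

/-- The pull-back `(x, y) ↦ B (f x, f y)` of a bilinear form. -/
def pullForm {V M : Type*} [AddCommGroup V] [Module ℂ V] [AddCommGroup M] [Module ℂ M]
    (f : V →ₗ[ℂ] V) : (V →ₗ[ℂ] V →ₗ[ℂ] M) →ₗ[ℂ] (V →ₗ[ℂ] V →ₗ[ℂ] M) where
  toFun B := B.compl₁₂ f f
  map_add' _ _ := rfl
  map_smul' _ _ := rfl

/-- The form `(x, y) ↦ B (f x, y) + B (x, f y)`. -/
def derForm {V M : Type*} [AddCommGroup V] [Module ℂ V] [AddCommGroup M] [Module ℂ M]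
    (f : V →ₗ[ℂ] V) : (V →ₗ[ℂ] V →ₗ[ℂ] M) →ₗ[ℂ] (V →ₗ[ℂ] V →ₗ[ℂ] M) where
  toFun B := B.compl₁₂ f LinearMap.id + B.compl₁₂ LinearMap.id f
  map_add' _ _ := by ext; simp; abel
  map_smul' _ _ := by ext; simp

@[simp] theorem pullForm_apply {V M : Type*} [AddCommGroup V] [Module ℂ V] [AddCommGroup M]
    [Module ℂ M] (f : V →ₗ[ℂ] V) (B : V →ₗ[ℂ] V →ₗ[ℂ] M) (x y : V) :
    pullForm f B x y = B (f x) (f y) := rfl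

@[simp] theorem derForm_apply {V M : Type*} [AddCommGroup V] [Module ℂ V] [AddCommGroup M]
    [Module ℂ M] (f : V →ₗ[ℂ] V) (B : V →ₗ[ℂ] V →ₗ[ℂ] M) (x y : V) :
    derForm f B x y = B (f x) y + B x (f y) := rfl

/-- The gradation on the dual of a space `S` of bilinear forms that is stable under the parity
involution: `φ` has parity `i` when it vanishes on the forms in `S` of parity `i + 1`. -/
def dualPart {V : Type*} [AddCommGroup V] [Module ℂ V] [SuperSpace V]
    (S : Submodule ℂ (V →ₗ[ℂ] V →ₗ[ℂ] ℂ)) (i : ZMod 2) : Submodule ℂ (Module.Dual ℂ S) where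
  carrier := {φ | ∀ B : S, HasParity B.1 (i + 1) → φ B = 0}
  zero_mem' := fun _ _ => rfl
  add_mem' := fun h k B hB => by simp [h B hB, k B hB]
  smul_mem' := fun c φ h B hB => by simp [h B hB]

theorem dualPart_isCompl {V : Type*} [AddCommGroup V] [Module ℂ V] [SuperSpace V]
    (S : Submodule ℂ (V →ₗ[ℂ] V →ₗ[ℂ] ℂ)) (hS : ∀ B ∈ S, pullForm (parityMap V) B ∈ S) :
    IsCompl (dualPart S 0) (dualPart S 1) := by
  let P : S →ₗ[ℂ] S := (pullForm (parityMap V)).restrict hS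
  have hP0 : ∀ B : S, HasParity B.1 0 → P B = B := by
    intro B hB
    apply Subtype.ext
    apply LinearMap.ext; intro x; apply LinearMap.ext; intro y
    obtain ⟨a, ha, b, hb, rfl⟩ := exists_decomp x
    obtain ⟨a', ha', b', hb', rfl⟩ := exists_decomp y
    have h1 := hB 0 1 (by decide) a ha b' hb'
    have h2 := hB 1 0 (by decide) b hb a' ha'
    simp [P, parityMap_even ha, parityMap_odd hb, parityMap_even ha', parityMap_odd hb', h1, h2]
  have hP1 : ∀ B : S, HasParity B.1 1 → P B = -B := by
    intro B hB
    apply Subtype.ext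
    apply LinearMap.ext; intro x; apply LinearMap.ext; intro y
    obtain ⟨a, ha, b, hb, rfl⟩ := exists_decomp x
    obtain ⟨a', ha', b', hb', rfl⟩ := exists_decomp y
    have h1 := hB 0 0 (by decide) a ha a' ha'
    have h2 := hB 1 1 (by decide) b hb b' hb'
    simp [P, parityMap_even ha, parityMap_odd hb, parityMap_even ha', parityMap_odd hb', h1, h2]
    abel
  have key : ∀ (B : S) (j k : ZMod 2), ∀ x ∈ part (V := V) j, ∀ y ∈ part (V := V) k,
      (P B).1 x y = (if j = k then 1 else -1) * B.1 x y := by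
    intro B j k x hx y hy
    change B.1 (parityMap V x) (parityMap V y) = _
    rcases zmod2_cases j with rfl | rfl <;> rcases zmod2_cases k with rfl | rfl
    · rw [parityMap_even hx, parityMap_even hy, if_pos rfl, one_mul]
    · rw [parityMap_even hx, parityMap_odd hy, if_neg (by decide), map_neg, neg_one_mul]
    · rw [parityMap_odd hx, parityMap_even hy, if_neg (by decide), map_neg, LinearMap.neg_apply,
        neg_one_mul]
    · rw [parityMap_odd hx, parityMap_odd hy, if_pos rfl, one_mul, map_neg, map_neg,
        LinearMap.neg_apply, neg_neg]
  have hE : ∀ B : S, HasParity (B + P B).1 0 := by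
    intro B j k hjk x hx y hy
    have h := key B j k x hx y hy
    have hne : j ≠ k := by
      rintro rfl; exact hjk (CharTwo.add_self_eq_zero j)
    simp only [Submodule.coe_add, LinearMap.add_apply, h, if_neg hne]; ring
  have hO : ∀ B : S, HasParity (B - P B).1 1 := by
    intro B j k hjk x hx y hy
    have h := key B j k x hx y hy
    have hne : j = k := by
      rcases zmod2_cases j with rfl | rfl <;> rcases zmod2_cases k with rfl | rfl
      · rfl
      · exact absurd (by decide) hjk
      · exact absurd (by decide) hjk
      · rfl
    simp only [Submodule.coe_sub, LinearMap.sub_apply, h, if_pos hne]; ring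
  apply isCompl_of_decomp
  · intro φ h0 h1
    refine LinearMap.ext fun B => ?_
    have e0 := h1 _ (hE B)
    have e1 := h0 _ (hO B)
    rw [map_add] at e0
    have e1 : φ B - φ (P B) = 0 := (φ.map_sub B (P B)).symm.trans e1
    have : (2 : ℂ) * φ B = 0 := by linear_combination e0 + e1
    simpa using this
  · intro φ
    refine ⟨(2⁻¹ : ℂ) • (φ + φ ∘ₗ P), ?_, (2⁻¹ : ℂ) • (φ - φ ∘ₗ P), ?_, by module⟩
    · intro B hB
      have h : φ (P B) = -φ B := by rw [hP1 B hB]; exact φ.map_neg B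
      change (2⁻¹ : ℂ) • (φ B + φ (P B)) = 0
      rw [h, add_neg_cancel, smul_zero]
    · intro B hB
      have h : φ (P B) = φ B := by rw [hP0 B hB]
      change (2⁻¹ : ℂ) • (φ B - φ (P B)) = 0
      rw [h, sub_self, smul_zero]

end Forms

/-! ### Homomorphisms and central extensions -/

/-- (Even) homomorphisms of Lie superalgebras. -/
structure SuperHom (L L' : Type*) [AddCommGroup L] [Module ℂ L] [LieSuperalgebra L]
    [AddCommGroup L'] [Module ℂ L'] [LieSuperalgebra L'] extends L →ₗ[ℂ] L' where
  map_part : ∀ i : ZMod 2, ∀ x ∈ part (V := L) i, toFun x ∈ part (V := L') i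
  map_br : ∀ x y, toFun (br x y) = br (toFun x) (toFun y)

/-- `p : E → L` is a central extension of `L`. -/
def IsCentralExtension {E L : Type*} [AddCommGroup E] [Module ℂ E] [LieSuperalgebra E]
    [AddCommGroup L] [Module ℂ L] [LieSuperalgebra L] (p : SuperHom E L) : Prop :=
  Function.Surjective p.toLinearMap ∧ ∀ e, p.toLinearMap e = 0 → ∀ e', br e e' = 0

/-- `p : E → L` is a universal central extension of `L` (tested against all central extensions
of `L` that live in the universe `w`). -/
def IsUniversalCentralExtension {E : Type u} {L : Type v} [AddCommGroup E] [Module ℂ E]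
    [LieSuperalgebra E] [AddCommGroup L] [Module ℂ L] [LieSuperalgebra L]
    (p : SuperHom E L) : Prop :=
  IsCentralExtension p ∧
  ∀ (E' : Type w) [AddCommGroup E'] [Module ℂ E'] [LieSuperalgebra E'] (q : SuperHom E' L),
    IsCentralExtension q →
      ∃! φ : SuperHom E E', ∀ e, q.toLinearMap (φ.toLinearMap e) = p.toLinearMap e

section CentralExt

variable {L : Type u} [AddCommGroup L] [Module ℂ L] [LieSuperalgebra L]
variable {M : Type v} [AddCommGroup M] [Module ℂ M] [SuperSpace M]

/-- The underlying space `L ⊕ M` of the central extension defined by an even cocycle. -/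
def CentralExt (_α : evenCocycles L M) : Type _ := L × M

variable (α : evenCocycles L M)

/-- The bracket `[(x, m), (y, m')] = ([x, y], α (x, y))`. -/
def centralBr : (L × M) →ₗ[ℂ] (L × M) →ₗ[ℂ] (L × M) :=
  LinearMap.mk₂ ℂ (fun u v => (br u.1 v.1, α.1 u.1 v.1))
    (fun _ _ _ => by simp) (fun _ _ _ => by simp) (fun _ _ _ => by simp)
    (fun _ _ _ => by simp)

instance : AddCommGroup (CentralExt α) := inferInstanceAs (AddCommGroup (L × M))
instance : Module ℂ (CentralExt α) := inferInstanceAs (Module ℂ (L × M))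

instance : LieSuperalgebra (CentralExt α) where
  part i := (part (V := L) i).prod (part (V := M) i)
  isCompl := by
    apply isCompl_of_decomp
    · rintro ⟨x, m⟩ h0 h1
      exact Prod.ext (eq_zero_of_even_odd h0.1 h1.1) (eq_zero_of_even_odd h0.2 h1.2)
    · rintro ⟨x, m⟩
      obtain ⟨a, ha, b, hb, rfl⟩ := exists_decomp x
      obtain ⟨a', ha', b', hb', rfl⟩ := exists_decomp m
      exact ⟨(a, a'), ⟨ha, ha'⟩, (b, b'), ⟨hb, hb'⟩, rfl⟩
  br := centralBr α
  br_mem i j x hx y hy := ⟨br_mem i j x.1 hx.1 y.1 hy.1, α.2.1 i j x.1 hx.1 y.1 hy.1⟩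
  br_skew i j x hx y hy :=
    Prod.ext (br_skew i j x.1 hx.1 y.1 hy.1) (α.2.2.1 i j x.1 hx.1 y.1 hy.1)
  br_jacobi i j x hx y hy z :=
    Prod.ext (br_jacobi i j x.1 hx.1 y.1 hy.1 z.1) (α.2.2.2 i j x.1 hx.1 y.1 hy.1 z.1)

/-- The projection `L ⊕ M → L`. -/
def CentralExt.proj : SuperHom (CentralExt α) L where
  toLinearMap := LinearMap.fst ℂ L M
  map_part _ _ hx := hx.1
  map_br _ _ := rfl

end CentralExt

/-! ### The data `(d, σ)` -/

/-- An even derivation `d` and an automorphism `σ` of order `n` of the Lie superalgebra `g` that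
commute with each other. -/
structure TwistDatum (g : Type u) [AddCommGroup g] [Module ℂ g] [LieSuperalgebra g] where
  /-- the even derivation -/
  d : g →ₗ[ℂ] g
  d_mem : ∀ i : ZMod 2, ∀ x ∈ part (V := g) i, d x ∈ part (V := g) i
  d_br : ∀ x y, d (br x y) = br (d x) y + br x (d y)
  /-- the automorphism -/
  σ : g ≃ₗ[ℂ] g
  σ_mem : ∀ i : ZMod 2, ∀ x ∈ part (V := g) i, σ x ∈ part (V := g) i
  σ_br : ∀ x y, σ (br x y) = br (σ x) (σ y)
  σ_d : ∀ x, σ (d x) = d (σ x)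
  /-- the order of `σ` -/
  n : ℕ
  n_pos : 0 < n
  order_σ : orderOf σ = n

namespace TwistDatum

variable {g : Type u} [AddCommGroup g] [Module ℂ g] [LieSuperalgebra g] (D : TwistDatum g)

theorem n_ne : (D.n : ℂ) ≠ 0 := Nat.cast_ne_zero.2 D.n_pos.ne'

/-- `ω = exp (2πi / n)`. -/
def ω : ℂ := Complex.exp (2 * Real.pi * Complex.I / D.n)

theorem ω_ne : D.ω ≠ 0 := Complex.exp_ne_zero _

theorem ω_pow : D.ω ^ D.n = 1 := by
  rw [ω, ← Complex.exp_nat_mul, mul_div_cancel₀ _ D.n_ne, Complex.exp_two_pi_mul_I]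

/-! #### The twisted loop algebra

The loop space `g ⊗ ℂ[t^{1/n}, t^{-1/n}]` is realised as `ℤ →₀ g`, where `single k x` stands for
`x ⊗ t^{k/n}`; the Witt algebra is realised as `ℤ →₀ ℂ`, where `single i 1` stands for
`𝔩_i = t^{i+1} d/dt`. -/

/-- The Witt bracket `[𝔩_i, 𝔩_j] = (j - i) 𝔩_{i+j}`. -/
def witt : (ℤ →₀ ℂ) →ₗ[ℂ] (ℤ →₀ ℂ) →ₗ[ℂ] (ℤ →₀ ℂ) :=
  Finsupp.linearCombination ℂ fun i : ℤ =>
    Finsupp.linearCombination ℂ fun j : ℤ => Finsupp.single (i + j) ((j : ℂ) - i)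

/-- The bracket `[x t^{k/n}, y t^{l/n}] = [x, y] t^{(k+l)/n}`. -/
def loopBr (g : Type u) [AddCommGroup g] [Module ℂ g] [LieSuperalgebra g] :
    (ℤ →₀ g) →ₗ[ℂ] (ℤ →₀ g) →ₗ[ℂ] (ℤ →₀ g) :=
  Finsupp.lsum ℂ fun k : ℤ => LinearMap.flip (Finsupp.lsum ℂ fun l : ℤ =>
    LinearMap.flip ((br (L := g)).compr₂ (Finsupp.lsingle (k + l))))

/-- The action `𝔩_i · x t^a = (a x + i d(x)) t^{i+a}`, where `a = k/n`. -/
def act : (ℤ →₀ ℂ) →ₗ[ℂ] (ℤ →₀ g) →ₗ[ℂ] (ℤ →₀ g) :=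
  Finsupp.linearCombination ℂ fun i : ℤ => Finsupp.lsum ℂ fun k : ℤ =>
    Finsupp.lsingle (k + D.n * i) ∘ₗ (((k : ℂ) / D.n) • LinearMap.id + (i : ℂ) • D.d)

/-- The automorphism `σ̃ (x t^{k/n}) = ω^{-k} σ(x) t^{k/n}` of the loop algebra. -/
def loopσ : (ℤ →₀ g) →ₗ[ℂ] (ℤ →₀ g) :=
  Finsupp.lsum ℂ fun k : ℤ => Finsupp.lsingle k ∘ₗ ((D.ω ^ (-k)) • D.σ.toLinearMap)

@[simp] theorem witt_single (i j : ℤ) (a b : ℂ) :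
    witt (Finsupp.single i a) (Finsupp.single j b) =
      Finsupp.single (i + j) (a * b * ((j : ℂ) - i)) := by
  simp only [witt, Finsupp.linearCombination_single, LinearMap.smul_apply, Finsupp.smul_single,
    smul_eq_mul, mul_assoc]

@[simp] theorem loopBr_single (k l : ℤ) (x y : g) :
    loopBr g (Finsupp.single k x) (Finsupp.single l y) = Finsupp.single (k + l) (br x y) := by
  simp [loopBr]

@[simp] theorem act_single (i k : ℤ) (c : ℂ) (x : g) :
    D.act (Finsupp.single i c) (Finsupp.single k x) =
      Finsupp.single (k + D.n * i) (c • (((k : ℂ) / D.n) • x + (i : ℂ) • D.d x)) := by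
  simp [act]

@[simp] theorem loopσ_single (k : ℤ) (x : g) :
    D.loopσ (Finsupp.single k x) = Finsupp.single k ((D.ω ^ (-k)) • D.σ x) := by
  simp [loopσ]

theorem loopσ_apply (f : ℤ →₀ g) (k : ℤ) : D.loopσ f k = (D.ω ^ (-k)) • D.σ (f k) := by
  induction f using Finsupp.induction_linear with
  | zero => simp
  | add f f' h h' => simp [h, h']
  | single l x =>
    by_cases h : l = k
    · subst h; simp
    · simp [Finsupp.single_eq_of_ne' h]

theorem loopσ_loopBr (f f' : ℤ →₀ g) :
    D.loopσ (loopBr g f f') = loopBr g (D.loopσ f) (D.loopσ f') := by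
  induction f using Finsupp.induction_linear with
  | zero => simp
  | add f f' h h' => simp [h, h']
  | single k x =>
    induction f' using Finsupp.induction_linear with
    | zero => simp
    | add f f' h h' => simp [h, h']
    | single l y =>
      simp only [loopBr_single, loopσ_single, D.σ_br, map_smul, LinearMap.smul_apply, smul_smul]
      rw [neg_add, zpow_add₀ D.ω_ne, mul_comm]

theorem loopσ_act (w : ℤ →₀ ℂ) (f : ℤ →₀ g) :
    D.loopσ (D.act w f) = D.act w (D.loopσ f) := by
  induction w using Finsupp.induction_linear with
  | zero => simp
  | add f f' h h' => simp [h, h']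
  | single i c =>
    induction f using Finsupp.induction_linear with
    | zero => simp
    | add f f' h h' => simp [h, h']
    | single k x =>
      have h : D.ω ^ (-(k + D.n * i)) = D.ω ^ (-k) := by
        rw [neg_add, zpow_add₀ D.ω_ne, ← mul_neg, zpow_mul, zpow_natCast, D.ω_pow, one_zpow,
          mul_one]
      simp only [act_single, loopσ_single, map_smul, map_add, D.σ_d, h]
      congr 1
      module

/-- The twisted loop algebra, i.e. the fixed points of `σ̃`. -/
def loop : Submodule ℂ (ℤ →₀ g) := LinearMap.eqLocus D.loopσ LinearMap.id

theorem mem_loop {f : ℤ →₀ g} : f ∈ D.loop ↔ D.loopσ f = f := Iff.rfl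

/-- The elements of the loop algebra with coefficients of parity `i`. -/
def loopPart (g : Type u) [AddCommGroup g] [Module ℂ g] [LieSuperalgebra g] (i : ZMod 2) :
    Submodule ℂ (ℤ →₀ g) where
  carrier := {f | ∀ k, f k ∈ part (V := g) i}
  zero_mem' _ := Submodule.zero_mem _
  add_mem' h h' k := Submodule.add_mem _ (h k) (h' k)
  smul_mem' c _ h k := Submodule.smul_mem _ c (h k)

theorem single_mem_loopPart {i : ZMod 2} {x : g} (hx : x ∈ part (V := g) i) (k : ℤ) :
    Finsupp.single k x ∈ loopPart g i := by
  intro l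
  by_cases h : k = l
  · subst h; simpa
  · rw [Finsupp.single_eq_of_ne' h]; exact Submodule.zero_mem _

theorem loopPart_induction {i : ZMod 2} {p : (ℤ →₀ g) → Prop} {f : ℤ →₀ g}
    (hf : f ∈ loopPart g i) (h0 : p 0) (hadd : ∀ a b, p a → p b → p (a + b))
    (hs : ∀ k : ℤ, ∀ x ∈ part (V := g) i, p (Finsupp.single k x)) : p f := by
  rw [← Finsupp.sum_single f, Finsupp.sum]
  exact Finset.sum_induction _ p hadd h0 fun k _ => hs k _ (hf k)

theorem loopBr_mem {i j : ZMod 2} {f f' : ℤ →₀ g} (hf : f ∈ loopPart g i)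
    (hf' : f' ∈ loopPart g j) : loopBr g f f' ∈ loopPart g (i + j) := by
  refine loopPart_induction (p := fun f => loopBr g f f' ∈ loopPart g (i + j)) hf (by simp) (fun a b ha hb => ?_) fun k x hx => ?_
  · simpa using Submodule.add_mem _ ha hb
  refine loopPart_induction (p := fun f' => loopBr g (Finsupp.single k x) f' ∈ loopPart g (i + j)) hf' (by simp) (fun a b ha hb => ?_) fun l y hy => ?_
  · simpa using Submodule.add_mem _ ha hb
  simpa using single_mem_loopPart (br_mem i j x hx y hy) _

theorem act_mem {i : ZMod 2} (w : ℤ →₀ ℂ) {f : ℤ →₀ g} (hf : f ∈ loopPart g i) :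
    D.act w f ∈ loopPart g i := by
  induction w using Finsupp.induction_linear with
  | zero => simp
  | add f f' h h' => simpa using Submodule.add_mem _ h h'
  | single m c =>
    refine loopPart_induction (p := fun f => D.act (Finsupp.single m c) f ∈ loopPart g i) hf (by simp) (fun a b ha hb => ?_) fun k x hx => ?_
    · simpa using Submodule.add_mem _ ha hb
    rw [act_single]
    exact single_mem_loopPart (Submodule.smul_mem _ _ (Submodule.add_mem _
      (Submodule.smul_mem _ _ hx) (Submodule.smul_mem _ _ (D.d_mem i x hx)))) _

theorem loopBr_skew {i j : ZMod 2} {f f' : ℤ →₀ g} (hf : f ∈ loopPart g i)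
    (hf' : f' ∈ loopPart g j) : loopBr g f f' = -(koszul i j • loopBr g f' f) := by
  refine loopPart_induction (p := fun f => loopBr g f f' = -(koszul i j • loopBr g f' f)) hf (by simp) (fun a b ha hb => ?_) fun k x hx => ?_
  · simp only [map_add, LinearMap.add_apply, ha, hb]; module
  refine loopPart_induction (p := fun f' => loopBr g (Finsupp.single k x) f' =
    -(koszul i j • loopBr g f' (Finsupp.single k x))) hf' (by simp) (fun a b ha hb => ?_) fun l y hy => ?_
  · simp only [map_add, LinearMap.add_apply, ha, hb]; module
  simp only [loopBr_single]
  rw [br_skew i j x hx y hy, Finsupp.single_neg, Finsupp.smul_single, add_comm]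

theorem loopBr_jacobi {i j : ZMod 2} {f f' : ℤ →₀ g} (hf : f ∈ loopPart g i)
    (hf' : f' ∈ loopPart g j) (h : ℤ →₀ g) :
    loopBr g f (loopBr g f' h) =
      loopBr g (loopBr g f f') h + koszul i j • loopBr g f' (loopBr g f h) := by
  refine loopPart_induction (p := fun f => loopBr g f (loopBr g f' h) =
    loopBr g (loopBr g f f') h + koszul i j • loopBr g f' (loopBr g f h)) hf (by simp) (fun a b ha hb => ?_) fun k x hx => ?_
  · simp only [map_add, LinearMap.add_apply, ha, hb]; module
  refine loopPart_induction (p := fun f' => loopBr g (Finsupp.single k x) (loopBr g f' h) =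
    loopBr g (loopBr g (Finsupp.single k x) f') h +
      koszul i j • loopBr g f' (loopBr g (Finsupp.single k x) h)) hf' (by simp) (fun a b ha hb => ?_) fun l y hy => ?_
  · simp only [map_add, LinearMap.add_apply, ha, hb]; module
  induction h using Finsupp.induction_linear with
  | zero => simp
  | add f f' h h' => simp only [map_add, h, h']; module
  | single m z =>
    simp only [loopBr_single, Finsupp.smul_single]
    rw [br_jacobi i j x hx y hy, Finsupp.single_add, add_assoc k l m, add_left_comm l k m]

theorem witt_skew (a b : ℤ →₀ ℂ) : witt a b = -witt b a := by
  induction a using Finsupp.induction_linear with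
  | zero => simp
  | add f f' h h' => simp only [map_add, LinearMap.add_apply, h, h']; abel
  | single i c =>
    induction b using Finsupp.induction_linear with
    | zero => simp
    | add f f' h h' => simp only [map_add, LinearMap.add_apply, h, h']; abel
    | single j c' =>
      rw [witt_single, witt_single, ← Finsupp.single_neg, add_comm]; congr 1; ring

theorem witt_jacobi (a b c : ℤ →₀ ℂ) :
    witt a (witt b c) = witt (witt a b) c + witt b (witt a c) := by
  induction a using Finsupp.induction_linear with
  | zero => simp
  | add f f' h h' => simp only [map_add, LinearMap.add_apply, h, h']; abel
  | single i r =>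
    induction b using Finsupp.induction_linear with
    | zero => simp
    | add f f' h h' => simp only [map_add, LinearMap.add_apply, h, h']; abel
    | single j s =>
      induction c using Finsupp.induction_linear with
      | zero => simp
      | add f f' h h' => simp only [map_add, h, h']; abel
      | single k t =>
        simp only [witt_single]
        rw [add_assoc i j k, add_left_comm j i k, ← Finsupp.single_add]
        congr 1; push_cast; ring

theorem act_witt (a b : ℤ →₀ ℂ) (f : ℤ →₀ g) :
    D.act (witt a b) f = D.act a (D.act b f) - D.act b (D.act a f) := by
  induction a using Finsupp.induction_linear with
  | zero => simp
  | add f f' h h' => simp only [map_add, LinearMap.add_apply, h, h']; abel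
  | single i r =>
    induction b using Finsupp.induction_linear with
    | zero => simp
    | add f f' h h' => simp only [map_add, LinearMap.add_apply, h, h']; abel
    | single j s =>
      induction f using Finsupp.induction_linear with
      | zero => simp
      | add f f' h h' => simp only [map_add, h, h']; abel
      | single k x =>
        have hn := D.n_ne
        simp only [witt_single, act_single]
        rw [show k + (D.n : ℤ) * j + D.n * i = k + D.n * (i + j) by ring,
          show k + (D.n : ℤ) * i + D.n * j = k + D.n * (i + j) by ring, ← Finsupp.single_sub]
        congr 1
        push_cast
        simp only [map_smul, map_add]
        match_scalars <;> field_simp <;> ring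

theorem act_loopBr (a : ℤ →₀ ℂ) (f f' : ℤ →₀ g) :
    D.act a (loopBr g f f') = loopBr g (D.act a f) f' + loopBr g f (D.act a f') := by
  induction a using Finsupp.induction_linear with
  | zero => simp
  | add f f' h h' => simp only [map_add, LinearMap.add_apply, h, h']; abel
  | single i r =>
    induction f using Finsupp.induction_linear with
    | zero => simp
    | add f f' h h' => simp only [map_add, LinearMap.add_apply, h, h']; abel
    | single k x =>
      induction f' using Finsupp.induction_linear with
      | zero => simp
      | add f f' h h' => simp only [map_add, h, h']; abel
      | single l y =>
        have hn := D.n_ne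
        simp only [loopBr_single, act_single]
        rw [show k + (D.n : ℤ) * i + l = k + l + D.n * i by ring,
          show k + (l + (D.n : ℤ) * i) = k + l + D.n * i by ring, ← Finsupp.single_add]
        congr 1
        push_cast
        simp only [map_smul, map_add, LinearMap.smul_apply, LinearMap.add_apply, D.d_br]
        match_scalars <;> field_simp

theorem act_mem_loop (w : ℤ →₀ ℂ) {f : ℤ →₀ g} (hf : f ∈ D.loop) : D.act w f ∈ D.loop := by
  rw [mem_loop, loopσ_act, D.mem_loop.1 hf]

theorem loopBr_mem_loop {f f' : ℤ →₀ g} (hf : f ∈ D.loop) (hf' : f' ∈ D.loop) :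
    loopBr g f f' ∈ D.loop := by
  rw [mem_loop, loopσ_loopBr, D.mem_loop.1 hf, D.mem_loop.1 hf']

theorem exists_loop_decomp (f : D.loop) :
    ∃ a b : D.loop, a.1 ∈ loopPart g 0 ∧ b.1 ∈ loopPart g 1 ∧ a + b = f := by
  let P : (ℤ →₀ g) →ₗ[ℂ] (ℤ →₀ g) := Finsupp.mapRange.linearMap (parityMap g)
  have hP : P f.1 ∈ D.loop := by
    rw [mem_loop]
    ext k
    have h := DFunLike.congr_fun (D.mem_loop.1 f.2) k
    rw [loopσ_apply] at h ⊢
    simp only [P, Finsupp.mapRange.linearMap_apply, Finsupp.mapRange_apply]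
    have hc := parityMap_comm D.σ.toLinearMap D.σ_mem (f.1 k)
    simp only [LinearEquiv.coe_coe] at hc
    rw [← hc, ← map_smul, h]
  refine ⟨⟨(2⁻¹ : ℂ) • (f.1 + P f.1), ?_⟩, ⟨(2⁻¹ : ℂ) • (f.1 - P f.1), ?_⟩, ?_, ?_, ?_⟩
  · exact Submodule.smul_mem _ _ (Submodule.add_mem _ f.2 hP)
  · exact Submodule.smul_mem _ _ (Submodule.sub_mem _ f.2 hP)
  · intro k; exact half_add_parityMap_mem (f.1 k)
  · intro k; exact half_sub_parityMap_mem (f.1 k)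
  · apply Subtype.ext
    simp only [Submodule.coe_add]
    module

/-! #### The twisted affine-Virasoro superalgebra -/

/-- The underlying space of `𝔏(g, d, σ) = W ⋉ 𝔤`, where `𝔤` is the twisted loop algebra. -/
def L : Type u := (ℤ →₀ ℂ) × D.loop

/-- The bracket of the semidirect product:
`[(w, f), (w', f')] = ([w, w'], w · f' - w' · f + [f, f'])`. -/
def brL : ((ℤ →₀ ℂ) × D.loop) →ₗ[ℂ] ((ℤ →₀ ℂ) × D.loop) →ₗ[ℂ] ((ℤ →₀ ℂ) × D.loop) :=
  LinearMap.mk₂ ℂ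
    (fun u v =>
      (witt u.1 v.1,
        ⟨D.act u.1 v.2.1 - D.act v.1 u.2.1 + loopBr g u.2.1 v.2.1,
          Submodule.add_mem _ (Submodule.sub_mem _ (D.act_mem_loop _ v.2.2)
            (D.act_mem_loop _ u.2.2)) (D.loopBr_mem_loop u.2.2 v.2.2)⟩))
    (fun a b c => Prod.ext (by simp) (Subtype.ext (by simp; abel)))
    (fun c a b => Prod.ext (by simp) (Subtype.ext (by simp; module)))
    (fun a b c => Prod.ext (by simp) (Subtype.ext (by simp; abel)))
    (fun c a b => Prod.ext (by simp) (Subtype.ext (by simp; module)))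

instance : AddCommGroup D.L := inferInstanceAs (AddCommGroup ((ℤ →₀ ℂ) × D.loop))
instance : Module ℂ D.L := inferInstanceAs (Module ℂ ((ℤ →₀ ℂ) × D.loop))

/-- The bracket of the semidirect product `W ⋉ 𝔤`; the Witt algebra is even. -/
instance : LieSuperalgebra D.L where
  part i :=
    { carrier := {u : (ℤ →₀ ℂ) × D.loop | (i = 1 → u.1 = 0) ∧ u.2.1 ∈ loopPart g i}
      zero_mem' := ⟨fun _ => rfl, Submodule.zero_mem _⟩
      add_mem' := fun {a b} ha hb => ⟨fun h => by
        change a.1 + b.1 = 0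
        rw [ha.1 h, hb.1 h, add_zero], Submodule.add_mem _ ha.2 hb.2⟩
      smul_mem' := fun c {a} ha => ⟨fun h => by
        change c • a.1 = 0
        rw [ha.1 h, smul_zero], Submodule.smul_mem _ c ha.2⟩ }
  isCompl := by
    apply isCompl_of_decomp
    · rintro ⟨w, f⟩ h0 h1
      refine Prod.ext (h1.1 rfl) (Subtype.ext (Finsupp.ext fun k => ?_))
      exact eq_zero_of_even_odd (h0.2 k) (h1.2 k)
    · rintro ⟨w, f⟩
      obtain ⟨a, b, ha, hb, rfl⟩ := D.exists_loop_decomp f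
      exact ⟨(w, a), ⟨fun h => absurd h (by decide), ha⟩, (0, b), ⟨fun _ => rfl, hb⟩,
        Prod.ext (add_zero w) rfl⟩
  br := D.brL
  br_mem := by
    rintro i j ⟨w, f⟩ ⟨h1, h2⟩ ⟨w', f'⟩ ⟨h1', h2'⟩
    dsimp only at h1 h2 h1' h2'
    refine ⟨fun h => ?_, ?_⟩
    · change witt w w' = 0
      have : i = 1 ∨ j = 1 := by clear h1 h2 h1' h2'; revert i j; decide
      rcases this with h | h
      · simp [h1 h]
      · simp [h1' h]
    · change D.act w f'.1 - D.act w' f.1 + loopBr g f.1 f'.1 ∈ _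
      refine Submodule.add_mem _ (Submodule.sub_mem _ ?_ ?_) (loopBr_mem h2 h2')
      · by_cases hi : i = 1
        · simp [h1 hi]
        · have : i = 0 := (zmod2_cases i).resolve_right hi
          subst this; rw [zero_add]; exact D.act_mem _ h2'
      · by_cases hi : j = 1
        · simp [h1' hi]
        · have : j = 0 := (zmod2_cases j).resolve_right hi
          subst this; rw [add_zero]; exact D.act_mem _ h2
  br_skew := by
    rintro i j ⟨w, f⟩ ⟨h1, h2⟩ ⟨w', f'⟩ ⟨h1', h2'⟩
    dsimp only at h1 h2 h1' h2'
    have hw : witt w w' = -(koszul i j • witt w' w) := by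
      by_cases h : i = 1 ∧ j = 1
      · simp [h1 h.1]
      · rw [koszul, if_neg h, one_smul, witt_skew]
    have hf := loopBr_skew h2 h2'
    refine Prod.ext hw (Subtype.ext ?_)
    change D.act w f'.1 - D.act w' f.1 + loopBr g f.1 f'.1 =
      -(koszul i j • (D.act w' f.1 - D.act w f'.1 + loopBr g f'.1 f.1))
    rw [hf]
    by_cases h : i = 1 ∧ j = 1
    · simp [h1 h.1, h1' h.2]
    · rw [koszul, if_neg h]; module
  br_jacobi := by
    rintro i j ⟨w, f⟩ ⟨h1, h2⟩ ⟨w', f'⟩ ⟨h1', h2'⟩ ⟨w'', f''⟩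
    dsimp only at h1 h2 h1' h2'
    refine Prod.ext ?_ (Subtype.ext ?_)
    · change witt w (witt w' w'') = witt (witt w w') w'' + koszul i j • witt w' (witt w w'')
      by_cases h : i = 1 ∧ j = 1
      · simp [h1 h.1, h1' h.2]
      · rw [koszul, if_neg h, one_smul, witt_jacobi]
    · change D.act w (D.act w' f''.1 - D.act w'' f'.1 + loopBr g f'.1 f''.1)
          - D.act (witt w' w'') f.1
          + loopBr g f.1 (D.act w' f''.1 - D.act w'' f'.1 + loopBr g f'.1 f''.1)
        = (D.act (witt w w') f''.1
          - D.act w'' (D.act w f'.1 - D.act w' f.1 + loopBr g f.1 f'.1)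
          + loopBr g (D.act w f'.1 - D.act w' f.1 + loopBr g f.1 f'.1) f''.1)
          + koszul i j • (D.act w' (D.act w f''.1 - D.act w'' f.1 + loopBr g f.1 f''.1)
          - D.act (witt w w'') f'.1
          + loopBr g f'.1 (D.act w f''.1 - D.act w'' f.1 + loopBr g f.1 f''.1))
      have hJ := loopBr_jacobi h2 h2' f''.1
      have hS := loopBr_skew (D.act_mem w'' h2) h2'
      simp only [map_add, map_sub, LinearMap.add_apply, LinearMap.sub_apply, act_witt,
        act_loopBr, hJ, hS]
      by_cases hi : i = 1
      · have hw := h1 hi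
        by_cases hj : j = 1
        · have hw' := h1' hj
          subst hw; subst hw'
          simp only [map_zero, LinearMap.zero_apply]
          module
        · have hk : koszul i j = 1 := if_neg fun h => hj h.2
          subst hw
          simp only [map_zero, LinearMap.zero_apply, hk]
          module
      · have hk : koszul i j = 1 := if_neg fun h => hi h.1
        simp only [hk]
        by_cases hj : j = 1
        · have hw' := h1' hj
          subst hw'
          simp only [map_zero, LinearMap.zero_apply]
          module
        · module

/-- The basis element `𝔩_i` of the Witt algebra. -/
def lElt (i : ℤ) : D.L := ((Finsupp.single i 1, 0) : (ℤ →₀ ℂ) × D.loop)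

/-- The eigenspace `g_[k] = {x | σ x = ω^k x}`. -/
def eigen (k : ℤ) : Submodule ℂ g := LinearMap.eqLocus D.σ.toLinearMap ((D.ω ^ k) • LinearMap.id)

/-- The element `x t^{k/n}`, for `x ∈ g_[k]`. -/
def xt (k : ℤ) (x : D.eigen k) : D.L :=
  ((0, ⟨Finsupp.single k x.1, by
    have hx : D.σ x.1 = D.ω ^ k • x.1 := x.2
    rw [mem_loop, loopσ_single, hx, smul_smul, ← zpow_add₀ D.ω_ne, neg_add_cancel, zpow_zero,
      one_smul]⟩) : (ℤ →₀ ℂ) × D.loop)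

/-! #### The cohomology of `g` fixed by `d` and `σ` -/

theorem derForm_mem {M : Type*} [AddCommGroup M] [Module ℂ M] [SuperSpace M] :
    ∀ α ∈ evenCocycles g M, derForm D.d α ∈ evenCocycles g M := by
  rintro α ⟨h1, h2, h3⟩
  refine ⟨fun i j x hx y hy => ?_, fun i j x hx y hy => ?_, fun i j x hx y hy z => ?_⟩
  · exact Submodule.add_mem _ (h1 i j _ (D.d_mem i x hx) y hy) (h1 i j x hx _ (D.d_mem j y hy))
  · simp only [derForm_apply]
    rw [h2 i j _ (D.d_mem i x hx) y hy, h2 i j x hx _ (D.d_mem j y hy)]; module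
  · simp only [derForm_apply, D.d_br, map_add, LinearMap.add_apply]
    rw [h3 i j _ (D.d_mem i x hx) y hy, h3 i j x hx _ (D.d_mem j y hy), h3 i j x hx y hy]
    module

theorem pullForm_mem {M : Type*} [AddCommGroup M] [Module ℂ M] [SuperSpace M] :
    ∀ α ∈ evenCocycles g M, pullForm D.σ.toLinearMap α ∈ evenCocycles g M := by
  rintro α ⟨h1, h2, h3⟩
  refine ⟨fun i j x hx y hy => ?_, fun i j x hx y hy => ?_, fun i j x hx y hy z => ?_⟩
  · exact h1 i j _ (D.σ_mem i x hx) _ (D.σ_mem j y hy)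
  · exact h2 i j _ (D.σ_mem i x hx) _ (D.σ_mem j y hy)
  · simp only [pullForm_apply, LinearEquiv.coe_coe, D.σ_br]
    exact h3 i j _ (D.σ_mem i x hx) _ (D.σ_mem j y hy) _

/-- The operator induced by `d` on `H²(g, ℂ^{1|1})₀`. -/
def dH2 : EvenH2 g (ℂ × ℂ) →ₗ[ℂ] EvenH2 g (ℂ × ℂ) :=
  Submodule.mapQ _ _ ((derForm D.d).restrict D.derForm_mem) <| by
    rintro α ⟨f, hf, hα⟩
    refine ⟨f ∘ₗ D.d, fun i x hx => hf i _ (D.d_mem i x hx), fun x y => ?_⟩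
    simp [hα, D.d_br]

/-- The operator induced by `σ` on `H²(g, ℂ^{1|1})₀`. -/
def σH2 : EvenH2 g (ℂ × ℂ) →ₗ[ℂ] EvenH2 g (ℂ × ℂ) :=
  Submodule.mapQ _ _ ((pullForm D.σ.toLinearMap).restrict D.pullForm_mem) <| by
    rintro α ⟨f, hf, hα⟩
    refine ⟨f ∘ₗ D.σ.toLinearMap, fun i x hx => hf i _ (D.σ_mem i x hx), fun x y => ?_⟩
    simp [hα, D.σ_br]

/-- `H²(g, ℂ^{1|1})₀^{d,σ}`: the classes `c` with `d c = c` and `σ c = c`. -/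
def H2Fixed : Submodule ℂ (EvenH2 g (ℂ × ℂ)) :=
  LinearMap.eqLocus D.dH2 LinearMap.id ⊓ LinearMap.eqLocus D.σH2 LinearMap.id

/-- `Z²(g)^{d,σ}`: the scalar-valued cocycles `α` with `d α = α` and `σ α = α`. -/
def Z2Fixed : Submodule ℂ (g →ₗ[ℂ] g →ₗ[ℂ] ℂ) :=
  scalarCocycles g ⊓ LinearMap.eqLocus (derForm D.d) LinearMap.id ⊓
    LinearMap.eqLocus (pullForm D.σ.toLinearMap) LinearMap.id

/-! #### The superalgebra `ℂ∂ ⋉ g` and its invariant forms -/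

/-- The underlying space of `ℂ∂ ⋉ g`; the pair `(c, x)` stands for `c∂ + x`. -/
def DDot (_D : TwistDatum g) : Type u := ℂ × g

/-- The bracket `[c∂ + x, c'∂ + x'] = c d(x') - c' d(x) + [x, x']`. -/
def brDDot : (ℂ × g) →ₗ[ℂ] (ℂ × g) →ₗ[ℂ] (ℂ × g) :=
  LinearMap.mk₂ ℂ (fun u v => (0, u.1 • D.d v.2 - v.1 • D.d u.2 + br u.2 v.2))
    (fun a b c => Prod.ext (by simp) (by simp; module))
    (fun c a b => Prod.ext (by simp) (by simp; module))
    (fun a b c => Prod.ext (by simp) (by simp; module))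
    (fun c a b => Prod.ext (by simp) (by simp; module))

instance : AddCommGroup D.DDot := inferInstanceAs (AddCommGroup (ℂ × g))
instance : Module ℂ D.DDot := inferInstanceAs (Module ℂ (ℂ × g))

/-- The bracket with `[∂, x] = d x`; the element `∂` is even. -/
instance : LieSuperalgebra D.DDot where
  part i :=
    { carrier := {u : ℂ × g | (i = 1 → u.1 = 0) ∧ u.2 ∈ part (V := g) i}
      zero_mem' := ⟨fun _ => rfl, Submodule.zero_mem _⟩
      add_mem' := fun {a b} ha hb => ⟨fun h => by
        change a.1 + b.1 = 0
        rw [ha.1 h, hb.1 h, add_zero], Submodule.add_mem _ ha.2 hb.2⟩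
      smul_mem' := fun c {a} ha => ⟨fun h => by
        change c • a.1 = 0
        rw [ha.1 h, smul_zero], Submodule.smul_mem _ c ha.2⟩ }
  isCompl := by
    apply isCompl_of_decomp
    · rintro ⟨w, f⟩ h0 h1
      exact Prod.ext (h1.1 rfl) (eq_zero_of_even_odd h0.2 h1.2)
    · rintro ⟨w, f⟩
      obtain ⟨a, ha, b, hb, rfl⟩ := exists_decomp f
      exact ⟨(w, a), ⟨fun h => absurd h (by decide), ha⟩, (0, b), ⟨fun _ => rfl, hb⟩,
        Prod.ext (add_zero w) rfl⟩
  br := D.brDDot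
  br_mem := by
    rintro i j ⟨w, f⟩ ⟨h1, h2⟩ ⟨w', f'⟩ ⟨h1', h2'⟩
    dsimp only at h1 h2 h1' h2'
    refine ⟨fun h => rfl, ?_⟩
    change w • D.d f' - w' • D.d f + br f f' ∈ _
    refine Submodule.add_mem _ (Submodule.sub_mem _ ?_ ?_) (br_mem i j f h2 f' h2')
    · by_cases hi : i = 1
      · simp [h1 hi]
      · have : i = 0 := (zmod2_cases i).resolve_right hi
        subst this; rw [zero_add]; exact Submodule.smul_mem _ _ (D.d_mem _ _ h2')
    · by_cases hi : j = 1
      · simp [h1' hi]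
      · have : j = 0 := (zmod2_cases j).resolve_right hi
        subst this; rw [add_zero]; exact Submodule.smul_mem _ _ (D.d_mem _ _ h2)
  br_skew := by
    rintro i j ⟨w, f⟩ ⟨h1, h2⟩ ⟨w', f'⟩ ⟨h1', h2'⟩
    dsimp only at h1 h2 h1' h2'
    have hf := br_skew i j f h2 f' h2'
    refine Prod.ext ?_ ?_
    · change (0 : ℂ) = -(koszul i j • 0)
      simp
    change w • D.d f' - w' • D.d f + br f f' =
      -(koszul i j • (w' • D.d f - w • D.d f' + br f' f))
    rw [hf]
    by_cases h : i = 1 ∧ j = 1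
    · simp [h1 h.1, h1' h.2]
    · rw [koszul, if_neg h]; module
  br_jacobi := by
    rintro i j ⟨w, f⟩ ⟨h1, h2⟩ ⟨w', f'⟩ ⟨h1', h2'⟩ ⟨w'', f''⟩
    dsimp only at h1 h2 h1' h2'
    refine Prod.ext ?_ ?_
    · change (0 : ℂ) = 0 + koszul i j • 0
      simp
    · change w • D.d (w' • D.d f'' - w'' • D.d f' + br f' f'') - (0 : ℂ) • D.d f
          + br f (w' • D.d f'' - w'' • D.d f' + br f' f'')
        = ((0 : ℂ) • D.d f'' - w'' • D.d (w • D.d f' - w' • D.d f + br f f')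
          + br (w • D.d f' - w' • D.d f + br f f') f'')
          + koszul i j • (w' • D.d (w • D.d f'' - w'' • D.d f + br f f'') - (0 : ℂ) • D.d f'
          + br f' (w • D.d f'' - w'' • D.d f + br f f''))
      have hJ := br_jacobi i j f h2 f' h2' f''
      have hS := br_skew i j _ (D.d_mem i f h2) f' h2'
      simp only [map_add, map_sub, map_smul, LinearMap.add_apply, LinearMap.sub_apply,
        LinearMap.smul_apply, D.d_br, hJ, hS]
      by_cases hi : i = 1
      · have hw := h1 hi
        by_cases hj : j = 1
        · have hw' := h1' hj
          subst hw; subst hw'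
          module
        · have hk : koszul i j = 1 := if_neg fun h => hj h.2
          subst hw
          simp only [hk]
          module
      · have hk : koszul i j = 1 := if_neg fun h => hi h.1
        simp only [hk]
        by_cases hj : j = 1
        · have hw' := h1' hj
          subst hw'
          module
        · module

/-- The element `∂`. -/
def del : D.DDot := ((1, 0) : ℂ × g)

/-- The embedding `g → ℂ∂ ⋉ g`. -/
def incl : g →ₗ[ℂ] D.DDot := LinearMap.inr ℂ ℂ g

/-- The extension of `σ` to `ℂ∂ ⋉ g` that fixes `∂`. -/
def σDDot : D.DDot →ₗ[ℂ] D.DDot := LinearMap.prodMap LinearMap.id D.σ.toLinearMap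

/-- The `σ`-invariant supersymmetric invariant bilinear forms on `ℂ∂ ⋉ g`. -/
def InvFixed : Submodule ℂ (D.DDot →ₗ[ℂ] D.DDot →ₗ[ℂ] ℂ) :=
  invForms D.DDot ⊓ LinearMap.eqLocus (pullForm D.σDDot) LinearMap.id

/-! #### The quotient of `g` -/

/-- The subspace `(d + 1) g + [(d + 1/2) g, g] + [g, [g, g]]`. -/
def relations : Submodule ℂ g :=
  LinearMap.range (D.d + LinearMap.id) ⊔
  Submodule.span ℂ {z | ∃ x y : g, z = br (D.d x + (1 / 2 : ℂ) • x) y} ⊔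
  Submodule.span ℂ {w | ∃ x y z : g, w = br x (br y z)}

theorem relations_stable (f : g →ₗ[ℂ] g) (hd : ∀ x, f (D.d x) = D.d (f x))
    (hb : ∀ x y, f (br x y) = br (f x) (f y)) : D.relations ≤ D.relations.comap f := by
  refine sup_le (sup_le ?_ ?_) ?_
  · rintro _ ⟨x, rfl⟩
    refine Submodule.mem_sup_left (Submodule.mem_sup_left ⟨f x, ?_⟩)
    simp [hd]
  · rw [Submodule.span_le]
    rintro _ ⟨x, y, rfl⟩
    refine Submodule.mem_sup_left (Submodule.mem_sup_right (Submodule.subset_span ⟨f x, f y, ?_⟩))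
    rw [hb, map_add, map_smul, hd]
  · rw [Submodule.span_le]
    rintro _ ⟨x, y, z, rfl⟩
    exact Submodule.mem_sup_right (Submodule.subset_span ⟨f x, f y, f z, by rw [hb, hb]⟩)

/-- The map induced by `σ` on `g / ((d + 1) g + [(d + 1/2) g, g] + [g, [g, g]])`. -/
def σQuot : (g ⧸ D.relations) →ₗ[ℂ] (g ⧸ D.relations) :=
  Submodule.mapQ _ _ D.σ.toLinearMap (D.relations_stable _ D.σ_d D.σ_br)

/-- The `σ`-invariants of `g / ((d + 1) g + [(d + 1/2) g, g] + [g, [g, g]])`. -/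
def QuotFixed : Submodule ℂ (g ⧸ D.relations) := LinearMap.eqLocus D.σQuot LinearMap.id

/-! #### The explicit universal central extension -/

/-- The centre: the `σ`-invariants of the quotient of `g`, the dual of the space of invariant
forms, and the dual of `Z²(g)^{d,σ}`. -/
abbrev Centre : Type u := D.QuotFixed × Module.Dual ℂ D.InvFixed × Module.Dual ℂ D.Z2Fixed

/-- The classes in the quotient that have a representative of parity `i`. -/
def quotPart (i : ZMod 2) : Submodule ℂ D.QuotFixed :=
  ((part (V := g) i).map D.relations.mkQ).comap D.QuotFixed.subtype

theorem quotPart_isCompl : IsCompl (D.quotPart 0) (D.quotPart 1) := by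
  have hst := D.relations_stable (parityMap g)
    (parityMap_comm D.d D.d_mem) parityMap_br
  have hσP : ∀ x, D.σ (parityMap g x) = parityMap g (D.σ x) := fun x =>
    (parityMap_comm D.σ.toLinearMap D.σ_mem x).symm
  have hP : ∀ v ∈ D.QuotFixed, Submodule.mapQ _ _ (parityMap g) hst v ∈ D.QuotFixed := by
    intro v hv
    obtain ⟨x, rfl⟩ := D.relations.mkQ_surjective v
    have h : D.relations.mkQ (D.σ x) = D.relations.mkQ x := hv
    change D.relations.mkQ (D.σ (parityMap g x)) = D.relations.mkQ (parityMap g x)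
    rw [hσP]
    exact congrArg (Submodule.mapQ _ _ (parityMap g) hst) h
  apply isCompl_of_decomp
  · rintro ⟨v, hv⟩ ⟨x, hx, hxv⟩ ⟨y, hy, hyv⟩
    apply Subtype.ext
    change D.relations.mkQ x = v at hxv
    change D.relations.mkQ y = v at hyv
    have h1 := congrArg (Submodule.mapQ _ _ (parityMap g) hst) (hxv.trans hyv.symm)
    change D.relations.mkQ (parityMap g x) = D.relations.mkQ (parityMap g y) at h1
    rw [parityMap_even hx, parityMap_odd hy, map_neg, hxv, hyv] at h1
    have h2 : (2 : ℂ) • v = 0 := by rw [two_smul]; nth_rewrite 1 [h1]; simp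
    simpa using h2
  · rintro ⟨v, hv⟩
    have hv' := hP v hv
    obtain ⟨x, rfl⟩ := D.relations.mkQ_surjective v
    refine ⟨(2⁻¹ : ℂ) • (⟨_, hv⟩ + ⟨_, hv'⟩),
      ⟨_, half_add_parityMap_mem x, ?_⟩, (2⁻¹ : ℂ) • (⟨_, hv⟩ - ⟨_, hv'⟩),
      ⟨_, half_sub_parityMap_mem x, ?_⟩, by module⟩
    · rfl
    · rfl

theorem Z2Fixed_stable : ∀ α ∈ D.Z2Fixed, pullForm (parityMap g) α ∈ D.Z2Fixed := by
  rintro α ⟨⟨⟨h1, h2⟩, h3⟩, h4⟩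
  refine ⟨⟨⟨fun i j x hx y hy => ?_, fun i j x hx y hy z => ?_⟩, ?_⟩, ?_⟩
  · exact h1 i j _ (parityMap_mem i hx) _ (parityMap_mem j hy)
  · simp only [pullForm_apply, parityMap_br]
    exact h2 i j _ (parityMap_mem i hx) _ (parityMap_mem j hy) _
  · apply LinearMap.ext; intro x; apply LinearMap.ext; intro y
    have := LinearMap.congr_fun₂ h3 (parityMap g x) (parityMap g y)
    simp only [derForm_apply, LinearMap.id_apply] at this
    simpa [parityMap_comm D.d D.d_mem] using this
  · apply LinearMap.ext; intro x; apply LinearMap.ext; intro y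
    have := LinearMap.congr_fun₂ h4 (parityMap g x) (parityMap g y)
    have hc := parityMap_comm D.σ.toLinearMap D.σ_mem
    simp only [LinearEquiv.coe_coe] at hc
    simp only [pullForm_apply, LinearMap.id_apply, LinearEquiv.coe_coe] at this
    simpa [hc] using this

theorem σDDot_mem : ∀ i, ∀ x ∈ part (V := D.DDot) i, D.σDDot x ∈ part (V := D.DDot) i :=
  fun i _ hx => ⟨hx.1, D.σ_mem i _ hx.2⟩

theorem InvFixed_stable :
    ∀ B ∈ D.InvFixed, pullForm (parityMap D.DDot) B ∈ D.InvFixed := by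
  rintro B ⟨⟨h1, h2⟩, h3⟩
  refine ⟨⟨fun i j x hx y hy => ?_, fun x y z => ?_⟩, ?_⟩
  · exact h1 i j _ (parityMap_mem i hx) _ (parityMap_mem j hy)
  · simp only [pullForm_apply, parityMap_br]
    exact h2 _ _ _
  · apply LinearMap.ext; intro x; apply LinearMap.ext; intro y
    have := LinearMap.congr_fun₂ h3 (parityMap D.DDot x) (parityMap D.DDot y)
    simp only [pullForm_apply, LinearMap.id_apply] at this
    simpa [parityMap_comm D.σDDot D.σDDot_mem] using this

/-- The gradation of the centre. -/
instance : SuperSpace D.Centre where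
  part i := (D.quotPart i).prod ((dualPart D.InvFixed i).prod (dualPart D.Z2Fixed i))
  isCompl := by
    have hB := dualPart_isCompl D.InvFixed D.InvFixed_stable
    have hZ := dualPart_isCompl D.Z2Fixed D.Z2Fixed_stable
    have hQ := D.quotPart_isCompl
    apply isCompl_of_decomp
    · rintro ⟨a, b, c⟩ ⟨h1, h2, h3⟩ ⟨k1, k2, k3⟩
      exact Prod.ext (Submodule.disjoint_def.1 hQ.disjoint _ h1 k1)
        (Prod.ext (Submodule.disjoint_def.1 hB.disjoint _ h2 k2)
          (Submodule.disjoint_def.1 hZ.disjoint _ h3 k3))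
    · rintro ⟨a, b, c⟩
      obtain ⟨a0, ha0, a1, ha1, rfl⟩ := Submodule.mem_sup.1 (hQ.sup_eq_top ▸ Submodule.mem_top (x := a))
      obtain ⟨b0, hb0, b1, hb1, rfl⟩ := Submodule.mem_sup.1 (hB.sup_eq_top ▸ Submodule.mem_top (x := b))
      obtain ⟨c0, hc0, c1, hc1, rfl⟩ := Submodule.mem_sup.1 (hZ.sup_eq_top ▸ Submodule.mem_top (x := c))
      exact ⟨(a0, b0, c0), ⟨ha0, hb0, hc0⟩, (a1, b1, c1), ⟨ha1, hb1, hc1⟩, rfl⟩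

/-- The cocycle `Ω : 𝔏 × 𝔏 → Centre` is given by the explicit formulas below; they determine it,
because `𝔏` is spanned by the `𝔩_i` and the `x t^{k/n}` and `Ω` is super skew-symmetric. -/
structure IsExplicit (Ω : evenCocycles D.L D.Centre) : Prop where
  l_l_quot : ∀ i j : ℤ, (Ω.1 (D.lElt i) (D.lElt j)).1 = 0
  l_l_inv : ∀ (i j : ℤ) (B : D.InvFixed), (Ω.1 (D.lElt i) (D.lElt j)).2.1 B =
    if i + j = 0 then ((i : ℂ) ^ 3 - i) / 12 * B.1 D.del D.del else 0
  l_l_coc : ∀ i j : ℤ, (Ω.1 (D.lElt i) (D.lElt j)).2.2 = 0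
  l_x_quot : ∀ (i k : ℤ) (x : D.eigen k),
    ((Ω.1 (D.lElt i) (D.xt k x)).1 : g ⧸ D.relations) =
      if D.n * i + k = 0 then (((i : ℂ) ^ 3 - i) / 12) • D.relations.mkQ x.1 else 0
  l_x_inv : ∀ (i k : ℤ) (x : D.eigen k) (B : D.InvFixed),
    (Ω.1 (D.lElt i) (D.xt k x)).2.1 B =
      if D.n * i + k = 0 then ((i : ℂ) ^ 2 - i) * B.1 D.del (D.incl x.1) else 0
  l_x_coc : ∀ (i k : ℤ) (x : D.eigen k), (Ω.1 (D.lElt i) (D.xt k x)).2.2 = 0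
  x_x_quot : ∀ (k l : ℤ) (x : D.eigen k) (y : D.eigen l),
    ((Ω.1 (D.xt k x) (D.xt l y)).1 : g ⧸ D.relations) =
      if k + l = 0 then ((1 - 4 * ((k : ℂ) / D.n) ^ 2) / 24) • D.relations.mkQ (br x.1 y.1)
      else 0
  x_x_inv : ∀ (k l : ℤ) (x : D.eigen k) (y : D.eigen l) (B : D.InvFixed),
    (Ω.1 (D.xt k x) (D.xt l y)).2.1 B =
      if k + l = 0 then
        ((k : ℂ) / D.n) * B.1 (D.incl x.1) (D.incl y.1) + B.1 D.del (D.incl (br x.1 y.1))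
      else 0
  x_x_coc : ∀ (k l : ℤ) (x : D.eigen k) (y : D.eigen l) (α : D.Z2Fixed),
    (Ω.1 (D.xt k x) (D.xt l y)).2.2 α = if k + l = 0 then α.1 x.1 y.1 else 0

end TwistDatum

end

noncomputable section

open SuperSpace LieSuperalgebra

/-! ### Two recursions over the Witt algebra -/

/-! Everything follows from two facts about scalar cocycles of `𝔏`. Factorization
(`exists_factor_add_coboundary`): every scalar cocycle has the form `f([u,v]) + ν(Ω(u,v))` with `f`
and `ν` linear. Perfectness (`eq_zero_of_functional`): if `f([u,v]) + ν(Ω(u,v))` vanishes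
identically, then `f = 0` and `ν = 0`. Together they identify the dual of the centre with the second
cohomology of `𝔏` (`nonempty_dual_equiv_EvenH2`) and make the extension by `Ω` universal
(`isUniversalCentralExtension_proj`). An even `ℂ^{1|1}`-valued cocycle is the same thing as a scalar
cocycle split into its even and odd parts, so scalar cocycles suffice throughout.

For the factorization, the invertibility of `d - 1` allows a cocycle to be changed by a coboundary
until it vanishes on `(𝔩_0, ·)`, `(𝔩_1, 𝔩_{-1})` and `(𝔩_1, x t^{-1})`. Since `𝔩_0` acts by the
degree, the new cocycle lives in total degree zero. The cocycle identity with two Witt arguments is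
then a recursion solved by combinations of `(i³ - i)/12` and `i² - i` (`exists_of_witt_relations`);
the coefficients are a number `c` and linear forms `q`, `p` on `g`.

The identity for `(𝔩_i, x t^a, y t^b)` is a recursion along `a + ℤ`, whose coefficients are the two
commuting operators on bilinear forms given by `d` in the first and in the second slot. Its
solutions are polynomials of degree at most two in `a` (`exists_of_density_relations`): a quadratic
multiple of `q([x,y])`, a term `a B(x,y)`, and the constant `p([x,y]) + α(x,y)`. This recursion also
forces `q([(d + 1/2)x, y]) = 0`. Different residues of `a` modulo `ℤ` are glued into forms on all of
`g`, because a `σ`-invariant form pairs `g_[k]` only with `g_[-k]`.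

Finally, skew-symmetry and the cocycle identity on three loop elements are compared as polynomials
in the degrees. They say that `q` kills `[g,[g,g]]`, that `c`, `p`, `B` form an invariant form on
`ℂ∂ ⋉ g`, and that `α` is a cocycle with `dα = α` and `σα = α`. Hence `(q, (c,p,B), α)` is a
functional on the centre.

Part (1) also needs `Z²(g)^{d,σ} ≅ H²(g)^{d,σ}` (`nonempty_Z2Fixed_equiv_H2Fixed`), again by
invertibility of `d - 1`, and a count of dimensions. -/

theorem exists_of_witt_relations {M : Type*} [AddCommGroup M] [Module ℂ M] (D : M →ₗ[ℂ] M)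
    (φ : ℤ → M)
    (h : ∀ i j : ℤ, (j : ℂ) • D (φ i) - ((i : ℂ) + j) • φ i - (i : ℂ) • D (φ j) +
      ((i : ℂ) + j) • φ j = ((j : ℂ) - i) • φ (i + j))
    (h0 : φ 0 = 0) (h1 : φ 1 = 0) :
    ∃ p q : M, D p = 0 ∧ D q = -q ∧
      ∀ i : ℤ, φ i = (((i : ℂ) ^ 3 - i) / 12) • q + ((i : ℂ) ^ 2 - i) • p := by
  -- These four instances express `φ (-1)` and `φ (-2)` through `φ 2` and `D (φ 2)`, and show that
  -- `D` acts by `-1` on `D (φ 2)`.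
  have e1 := h (-1) 1
  have e2 := h 2 (-1)
  have e3 := h 2 (-2)
  have e4 := h (-2) 1
  norm_num [h0, h1] at e1 e2 e3 e4
  have e2' : φ (-1) = D (φ 2) + φ 2 := by
    rw [e1] at e2; linear_combination (norm := module) e2
  have e3' : D (φ (-2)) = - D (φ 2) := by
    have : (2 : ℂ) • (D (φ (-2)) + D (φ 2)) = 0 := by linear_combination (norm := module) -e3
    rcases smul_eq_zero.1 this with h | h
    · norm_num at h
    · exact eq_neg_of_add_eq_zero_left h
  have e4' : φ (-2) = (3 : ℂ) • φ (-1) + D (φ 2) := by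
    rw [e3'] at e4; linear_combination (norm := module) e4
  have e5 : D (D (φ 2)) = - D (φ 2) := by
    have := congrArg D e2'
    rw [e1, map_add] at this
    exact eq_neg_of_add_eq_zero_left this.symm
  -- The witnesses are forced: at `i = -1` the cubic vanishes and leaves `2p`, and at `i = 2` the
  -- formula reads `q/2 + 2p`.
  refine ⟨(2⁻¹ : ℂ) • φ (-1), (-2 : ℂ) • D (φ 2), by rw [map_smul, e1, smul_zero],
    by rw [map_smul, e5]; module, ?_⟩
  -- The instance `j = 1` has coefficient `1 - i` at `φ (i + 1)`, so it determines the values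
  -- upwards only from `i = 2` on. Downwards, `j = -1` works from `i = -2` on.
  have up : ∀ m : ℕ, φ (m + 2 : ℤ) = ((((m + 2 : ℤ) : ℂ) ^ 3 - (m + 2 : ℤ)) / 12) •
      (-2 : ℂ) • D (φ 2) + (((m + 2 : ℤ) : ℂ) ^ 2 - (m + 2 : ℤ)) • (2⁻¹ : ℂ) • φ (-1) := by
    intro m
    induction m with
    | zero => norm_num; rw [e2']; module
    | succ m ih =>
      have := h (m + 2) 1
      rw [h1, ih] at this
      simp only [map_add, map_smul, e1, e5] at this
      have hm : (m : ℂ) + 1 ≠ 0 := by exact_mod_cast m.succ_ne_zero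
      rw [show ((m + 1 : ℕ) : ℤ) + 2 = m + 2 + 1 by push_cast; ring]
      refine smul_right_injective M hm ?_
      push_cast at this ⊢
      simp only [map_zero] at this
      linear_combination (norm := module) this
  have down : ∀ m : ℕ, φ (-m - 2 : ℤ) = ((((-m - 2 : ℤ) : ℂ) ^ 3 - (-m - 2 : ℤ)) / 12) •
      (-2 : ℂ) • D (φ 2) + (((-m - 2 : ℤ) : ℂ) ^ 2 - (-m - 2 : ℤ)) • (2⁻¹ : ℂ) • φ (-1) := by
    intro m
    induction m with
    | zero => norm_num; rw [e4']; module
    | succ m ih =>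
      have := h (-m - 2) (-1)
      rw [ih] at this
      simp only [map_add, map_smul, e1, e5] at this
      have hm : (m : ℂ) + 1 ≠ 0 := by exact_mod_cast m.succ_ne_zero
      rw [show -((m + 1 : ℕ) : ℤ) - 2 = -m - 2 + -1 by push_cast; ring]
      refine smul_right_injective M hm ?_
      push_cast at this ⊢
      linear_combination (norm := module) -this
  intro i
  rcases lt_or_ge i 2 with hi | hi
  · rcases lt_or_ge (-2) i with hi' | hi'
    · obtain rfl | rfl | rfl : i = -1 ∨ i = 0 ∨ i = 1 := by omega
      · norm_num; module
      · simp [h0]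
      · simp [h1]
    · have := down (-i - 2).toNat
      rwa [Int.toNat_of_nonneg (by omega), show -(-i - 2) - 2 = i by ring] at this
  · have := up (i - 2).toNat
    rwa [Int.toNat_of_nonneg (by omega), show i - 2 + 2 = i by ring] at this

/-- In the application `M` consists of bilinear forms on `g`, `X` and `Y` insert `d` in the first
and second slot, and `a + m` is the exponent of `t`. The operator `S = X + Y` sorts the solution: it
is `-1` on `Q`, `0` on `P` and `B`, and `1` on `α`. After the `Q`-part is subtracted, the remainder
is killed by `S(1 - S)`, and its two components are determined separately. -/
theorem exists_of_density_relations {R M : Type*} [CommRing R] [AddCommGroup M] [Module R M]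
    (hM : ∀ N : ℕ, N ≠ 0 → ∀ m : M, (N : R) • m = 0 → m = 0)
    (X Y a : R) (hY : ∀ m : M, (1 - Y) • m = 0 → m = 0) (γ : ℤ → M) (P Q : M)
    (hP : (X + Y) • P = 0) (hQ : (X + Y + 1) • Q = 0)
    (h : ∀ m i : ℤ, (a + m + i * X) • γ (m + i) - (a + m + i - i * Y) • γ m =
      (2 * ((i : R) ^ 3 - i)) • Q + ((i : R) ^ 2 - i) • P) :
    (2 * X + 1) • Q = 0 ∧ ∃ B α : M, X • B = P ∧ (X + Y) • B = 0 ∧ (X + Y) • α = α ∧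
      ∀ m : ℤ, γ m = (1 - 4 * (a + m) ^ 2) • Q + (a + m) • B + P + α := by
  -- Going from `m` to `m + i` and back eliminates `γ (m + i)`.
  have hT : ∀ m i : ℤ, ((i : R) ^ 2 * (X - Y) * (1 - X - Y)) • γ m =
      (2 * i ^ 2 * (i ^ 2 - 1) * (Y - X)) • Q + (2 * i ^ 2 * (a + m + X)) • P := by
    intro m i
    have e1 := h m i
    have e2 := h (m + i) (-i)
    rw [add_neg_cancel_right] at e2
    push_cast at e1 e2
    linear_combination (norm := module) (a + m + i * Y) • e1 + (a + m + i * X) • e2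
      + ((i : R) ^ 2 * (i - 1)) • hP
  -- Everything in `hT` is homogeneous quadratic in `i` except the `Q`-term, which contains `i⁴`;
  -- comparing `i = 1` with `i = 2` isolates it. Together with `hQ` this makes both `X` and `Y` act
  -- by `-1/2` on `Q`.
  have hTQ : (Y - X) • Q = 0 := by
    have e1 := hT 0 1
    have e2 := hT 0 2
    push_cast at e1 e2
    refine hM 24 (by norm_num) _ ?_
    push_cast
    linear_combination (norm := module) (4 : R) • e1 - e2
  have hXQ : (2 * X + 1) • Q = 0 := by linear_combination (norm := module) hQ - hTQ
  have hYQ : (2 * Y + 1) • Q = 0 := by linear_combination (norm := module) hQ + hTQ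
  refine ⟨hXQ, ?_⟩
  -- The quadratic polynomial times `Q` is a particular solution, so `δ` satisfies the recursion
  -- without `Q`.
  obtain ⟨δ, hδ⟩ : ∃ δ : ℤ → M, ∀ m, δ m = γ m - (1 - 4 * (a + m) ^ 2) • Q := ⟨_, fun _ => rfl⟩
  have h' : ∀ m i : ℤ, (a + m + i * X) • δ (m + i) - (a + m + i - i * Y) • δ m =
      ((i : R) ^ 2 - i) • P := by
    intro m i
    have e := h m i
    rw [hδ, hδ]
    push_cast
    linear_combination (norm := module) e - (i : R) • hQ
      + (2 * i * (a + m + i) ^ 2) • hXQ + (2 * i * (a + m) ^ 2) • hYQ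
  have hT' : ∀ m : ℤ, ((X - Y) * (1 - X - Y)) • δ m = (2 * (a + m + X)) • P := by
    intro m
    have e := hT m 1
    rw [hδ]
    push_cast at e
    linear_combination (norm := module) e + ((1 - X - Y) * (1 - 4 * (a + m) ^ 2)) • hTQ
  -- The steps `m → m+1 → m+2` and `m → m+2` eliminate `δ (m+1)` and `δ (m+2)`. With `hT'`, what
  -- remains is the claim multiplied by `2(1 - Y)`, which is injective.
  have E1 : ∀ m : ℤ, ((1 - X - Y) * X) • δ m = (a + m + X) • P := by
    intro m
    have e1 := h' m 1
    have e2 := h' (m + 1) 1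
    have e3 := h' m 2
    have e4 := hT' m
    rw [show m + 1 + 1 = m + 2 by ring] at e2
    push_cast at e1 e2 e3
    rw [← sub_eq_zero]
    refine hM 2 (by norm_num) _ (hY _ ?_)
    push_cast
    linear_combination (norm := module) ((a + m + 1 + X) * (a + m + X)) • e3
      - ((a + m + 2 * X) * (a + m + X)) • e2 - ((a + m + 2 * X) * (a + m + 2 - Y)) • e1
      - (a + m) • e4 + (2 * (a + m + X)) • hP
  have E2 : ∀ m : ℤ, ((1 - X - Y) * Y) • δ m = -(a + m + X) • P := by
    intro m
    linear_combination (norm := module) E1 m - hT' m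
  -- Thus `δ m` is the sum of `(1 - S) δ m`, on which `S` is `0`, and `S δ m`, on which `S` is `1`.
  have E3 : ∀ m : ℤ, ((1 - X - Y) * (X + Y)) • δ m = 0 := by
    intro m
    linear_combination (norm := module) E1 m + E2 m
  have F : ∀ m i : ℤ, (a + m) • (1 - X - Y) • δ (m + i) =
      (a + m + i) • (1 - X - Y) • δ m - (i : R) • P := by
    intro m i
    have e1 := E1 (m + i)
    have e2 := E2 m
    push_cast at e1
    linear_combination (norm := module) (1 - X - Y) • h' m i - (i : R) • e1 - (i : R) • e2
      - ((i : R) ^ 2 - i) • hP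
  -- The component with `S = 0` is affine in `a + m`; its slope is the `B` of the conclusion.
  have G : ∀ m : ℤ, (1 - X - Y) • δ m =
      P + (a + m) • ((1 - X - Y) • δ 1 - (1 - X - Y) • δ 0) := by
    intro m
    have e1 := F 0 m
    have e2 := F 1 (m - 1)
    rw [zero_add] at e1
    rw [add_sub_cancel] at e2
    push_cast at e1 e2
    linear_combination (norm := module) e2 - e1
  have r : ∀ m i : ℤ, (a + m + i * X) • ((X + Y) • δ (m + i) - (X + Y) • δ m) = 0 := by
    intro m i
    linear_combination (norm := module) (X + Y) • h' m i + (i : R) • E3 m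
      + ((i : R) ^ 2 - i) • hP
  -- Exchanging the two endpoints in `r` removes the operator `X` from the factor.
  have s : ∀ m i : ℤ, (2 * (a + m) + i) • ((X + Y) • δ (m + i) - (X + Y) • δ m) = 0 := by
    intro m i
    have e := r (m + i) (-i)
    rw [add_neg_cancel_right] at e
    push_cast at e
    linear_combination (norm := module) r m i - e
  -- A single factor `2(a + m) + i` may vanish. The relations for `m → m+1`, `m → m+2` and `m+1 →
  -- m+2` together first give equal consecutive differences and then twice the difference equal to
  -- zero.
  have step : ∀ m : ℤ, (X + Y) • δ (m + 1) = (X + Y) • δ m := by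
    intro m
    have e1 := s m 1
    have e2 := s m 2
    have e3 := s (m + 1) 1
    rw [show m + 1 + 1 = m + 2 by ring] at e3
    push_cast at e1 e2 e3
    rw [← sub_eq_zero]
    refine hM 2 (by norm_num) _ ?_
    push_cast
    linear_combination (norm := module) e2 - (2 : R) • e1
      - (2 * (a + m) + 2) • (e3 - e2 + e1)
  have const : ∀ m : ℤ, (X + Y) • δ m = (X + Y) • δ 0 := by
    intro m
    induction m with
    | zero => rfl
    | succ m ih => rw [step, ih]
    | pred m ih => rw [← ih, ← step, sub_add_cancel]
  refine ⟨(1 - X - Y) • δ 1 - (1 - X - Y) • δ 0, (X + Y) • δ 0, ?_, ?_, ?_, fun m => ?_⟩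
  · have e1 := E1 1
    have e0 := E1 0
    push_cast at e0 e1
    linear_combination (norm := module) e1 - e0
  · linear_combination (norm := module) E3 1 - E3 0
  · linear_combination (norm := module) -E3 0
  · have := hδ m
    linear_combination (norm := module) G m + const m - this

namespace TwistDatum

variable {g : Type u} [AddCommGroup g] [Module ℂ g] [LieSuperalgebra g] (D : TwistDatum g)

/-! ### The eigenspace decomposition for `σ` -/

theorem ω_primitive : IsPrimitiveRoot D.ω D.n := Complex.isPrimitiveRoot_exp _ D.n_pos.ne'

theorem ω_zpow_add_mul (k i : ℤ) : D.ω ^ (k + D.n * i) = D.ω ^ k := by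
  rw [zpow_add₀ D.ω_ne, zpow_mul, zpow_natCast, D.ω_pow, one_zpow, mul_one]

theorem geom_sum_ω (j : ℤ) :
    ∑ m ∈ Finset.range D.n, (D.ω ^ j) ^ m = if (D.n : ℤ) ∣ j then (D.n : ℂ) else 0 := by
  split_ifs with h
  · rw [(D.ω_primitive.zpow_eq_one_iff_dvd j).2 h]; simp
  · have h1 : D.ω ^ j ≠ 1 := fun h' => h ((D.ω_primitive.zpow_eq_one_iff_dvd j).1 h')
    rw [geom_sum_eq h1, ← zpow_natCast, ← zpow_mul, mul_comm, zpow_mul, zpow_natCast, D.ω_pow,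
      one_zpow, sub_self, zero_div]

theorem mem_eigen {k : ℤ} {x : g} : x ∈ D.eigen k ↔ D.σ x = D.ω ^ k • x := Iff.rfl

theorem eigen_add_mul (k i : ℤ) : D.eigen (k + D.n * i) = D.eigen k := by
  ext x; rw [mem_eigen, mem_eigen, ω_zpow_add_mul]

theorem eigen_congr {k l : ℤ} (h : (D.n : ℤ) ∣ k - l) : D.eigen k = D.eigen l := by
  obtain ⟨i, hi⟩ := h
  rw [show k = l + D.n * i by omega, eigen_add_mul]

theorem d_mem_eigen {k : ℤ} {x : g} (hx : x ∈ D.eigen k) : D.d x ∈ D.eigen k := by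
  rw [mem_eigen, D.σ_d, D.mem_eigen.1 hx, map_smul]

theorem br_mem_eigen {k l : ℤ} {x y : g} (hx : x ∈ D.eigen k) (hy : y ∈ D.eigen l) :
    br x y ∈ D.eigen (k + l) := by
  rw [mem_eigen, D.σ_br, D.mem_eigen.1 hx, D.mem_eigen.1 hy, map_smul, map_smul,
    LinearMap.smul_apply, smul_smul, zpow_add₀ D.ω_ne, mul_comm]

theorem σ_pow_order (x : g) : (D.σ.toLinearMap ^ D.n) x = x := by
  have h : D.σ ^ D.n = 1 := by rw [← D.order_σ]; exact pow_orderOf_eq_one _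
  have h2 := congrArg LinearEquiv.automorphismGroup.toLinearMapMonoidHom h
  rw [map_pow, map_one] at h2
  exact LinearMap.congr_fun h2 x

/-- The projection of `g` onto the eigenspace `g_[k]`. -/
def eigProj (k : ℤ) : g →ₗ[ℂ] g :=
  (D.n : ℂ)⁻¹ • ∑ m ∈ Finset.range D.n, (D.ω ^ (-k)) ^ m • D.σ.toLinearMap ^ m

theorem eigProj_apply (k : ℤ) (x : g) : D.eigProj k x =
    (D.n : ℂ)⁻¹ • ∑ m ∈ Finset.range D.n, (D.ω ^ (-k)) ^ m • (D.σ.toLinearMap ^ m) x := by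
  simp [eigProj]

theorem eigProj_mem (k : ℤ) (x : g) : D.eigProj k x ∈ D.eigen k := by
  rw [mem_eigen, eigProj_apply, map_smul, map_sum, smul_comm]
  congr 1
  have h : ∀ m, D.σ ((D.ω ^ (-k)) ^ m • (D.σ.toLinearMap ^ m) x) =
      D.ω ^ k • ((D.ω ^ (-k)) ^ (m + 1) • (D.σ.toLinearMap ^ (m + 1)) x) := by
    intro m
    rw [map_smul, smul_smul, pow_succ' (D.ω ^ (-k)), ← mul_assoc, ← zpow_add₀ D.ω_ne,
      add_neg_cancel, zpow_zero, one_mul, pow_succ']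
    rfl
  simp only [h]
  rw [← Finset.smul_sum]
  congr 1
  have h1 := Finset.sum_range_succ
    (fun m => (D.ω ^ (-k)) ^ m • (D.σ.toLinearMap ^ m) x) D.n
  have h2 : (D.ω ^ (-k)) ^ D.n = 1 := by
    rw [← zpow_natCast, ← zpow_mul, mul_comm, zpow_mul, zpow_natCast, D.ω_pow, one_zpow]
  rw [Finset.sum_range_succ', σ_pow_order, h2] at h1
  simpa using h1

/-- Orthogonality of the characters of `ℤ/n`. The index `k` is an integer, but only its residue
modulo `n` matters. -/
theorem eigProj_of_mem {k l : ℤ} {x : g} (hx : x ∈ D.eigen l) :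
    D.eigProj k x = if (D.n : ℤ) ∣ l - k then x else 0 := by
  have h : ∀ m : ℕ, (D.σ.toLinearMap ^ m) x = (D.ω ^ l) ^ m • x := by
    intro m
    induction m with
    | zero => simp
    | succ m ih =>
      rw [pow_succ', Module.End.mul_apply, ih, map_smul, pow_succ, mul_smul]
      exact congrArg _ hx
  rw [eigProj_apply]
  simp only [h, smul_smul, ← mul_pow, ← zpow_add₀ D.ω_ne]
  rw [← Finset.sum_smul, geom_sum_ω, smul_smul, show -k + l = l - k by ring]
  split_ifs
  · rw [inv_mul_cancel₀ D.n_ne, one_smul]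
  · rw [mul_zero, zero_smul]

theorem eigProj_self {k : ℤ} {x : g} (hx : x ∈ D.eigen k) : D.eigProj k x = x := by
  rw [D.eigProj_of_mem hx, sub_self, if_pos (dvd_zero _)]

theorem sum_eigProj (x : g) : ∑ k ∈ Finset.range D.n, D.eigProj k x = x := by
  simp only [eigProj_apply]
  rw [← Finset.smul_sum, Finset.sum_comm]
  have h : ∀ m ∈ Finset.range D.n, ∑ k ∈ Finset.range D.n,
      (D.ω ^ (-(k : ℤ))) ^ m • (D.σ.toLinearMap ^ m) x =
      if m = 0 then (D.n : ℂ) • x else 0 := by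
    intro m hm
    rw [← Finset.sum_smul]
    have : ∀ k : ℕ, (D.ω ^ (-(k : ℤ))) ^ m = (D.ω ^ (-(m : ℤ))) ^ k := by
      intro k
      rw [← zpow_natCast, ← zpow_natCast, ← zpow_mul, ← zpow_mul]; congr 1; ring
    simp only [this]
    rw [geom_sum_ω]
    have hm' := Finset.mem_range.1 hm
    by_cases h0 : m = 0
    · subst h0; simp
    · rw [if_neg h0, if_neg, zero_smul]
      rw [dvd_neg, Int.natCast_dvd_natCast]
      exact Nat.not_dvd_of_pos_of_lt (Nat.pos_of_ne_zero h0) hm'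
  rw [Finset.sum_congr rfl h, Finset.sum_ite_eq' (Finset.range D.n) 0,
    if_pos (Finset.mem_range.2 D.n_pos), smul_smul, inv_mul_cancel₀ D.n_ne, one_smul]

theorem eigProj_part (k : ℤ) (i : ZMod 2) {x : g} (hx : x ∈ part (V := g) i) :
    D.eigProj k x ∈ part (V := g) i := by
  rw [eigProj_apply]
  refine Submodule.smul_mem _ _ (Submodule.sum_mem _ fun m _ => Submodule.smul_mem _ _ ?_)
  clear * - hx
  induction m with
  | zero => simpa using hx
  | succ m ih => rw [pow_succ', Module.End.mul_apply]; exact D.σ_mem i _ ih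

theorem eigProj_comm (f : g →ₗ[ℂ] g) (hf : ∀ x, f (D.σ x) = D.σ (f x)) (k : ℤ) (x : g) :
    D.eigProj k (f x) = f (D.eigProj k x) := by
  simp only [eigProj_apply, map_smul, map_sum]
  congr 1
  refine Finset.sum_congr rfl fun m _ => ?_
  congr 1
  clear * - hf
  induction m with
  | zero => simp
  | succ m ih => rw [pow_succ', Module.End.mul_apply, ih, Module.End.mul_apply]; exact (hf _).symm

theorem eigProj_d (k : ℤ) (x : g) : D.eigProj k (D.d x) = D.d (D.eigProj k x) :=
  D.eigProj_comm D.d (fun x => (D.σ_d x).symm) k x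

theorem eigProj_congr {k l : ℤ} (h : (D.n : ℤ) ∣ k - l) : D.eigProj k = D.eigProj l := by
  obtain ⟨i, hi⟩ := h
  have : D.ω ^ (-k) = D.ω ^ (-l) := by
    rw [show -k = -l + D.n * (-i) by rw [mul_neg]; omega, ω_zpow_add_mul]
  simp only [eigProj, this]

theorem eigProj_σ (k : ℤ) (x : g) : D.eigProj k (D.σ x) = D.ω ^ k • D.eigProj k x :=
  (D.eigProj_comm D.σ.toLinearMap (fun _ => rfl) k x).trans (D.eigProj_mem k x)

theorem eigen_induction {p : g → Prop} (hadd : ∀ x y, p x → p y → p (x + y)) (h0 : p 0)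
    (h : ∀ k : ℤ, ∀ x ∈ D.eigen k, p x) (x : g) : p x := by
  rw [← D.sum_eigProj x]
  exact Finset.sum_induction _ p hadd h0 fun k _ => h k _ (D.eigProj_mem _ _)

theorem part_eigen_induction {i : ZMod 2} {p : g → Prop} (hadd : ∀ x y, p x → p y → p (x + y))
    (h0 : p 0) (h : ∀ k : ℤ, ∀ x ∈ D.eigen k, x ∈ part (V := g) i → p x) {x : g}
    (hx : x ∈ part (V := g) i) : p x := by
  rw [← D.sum_eigProj x]
  exact Finset.sum_induction _ p hadd h0 fun k _ => h k _ (D.eigProj_mem _ _)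
    (D.eigProj_part k i hx)

/-! ### Generators of `𝔏` -/

/-- The map `g → 𝔏` that sends `x` to `π_k(x) t^{k/n}`, with `π_k` the projection
onto `g_[k]`. -/
def xl (k : ℤ) : g →ₗ[ℂ] D.L where
  toFun x := D.xt k ⟨D.eigProj k x, D.eigProj_mem k x⟩
  map_add' x y := Prod.ext (add_zero _).symm (Subtype.ext (by
    change Finsupp.single k _ = Finsupp.single k _ + Finsupp.single k _
    simp))
  map_smul' c x := Prod.ext (smul_zero c).symm (Subtype.ext (by
    change Finsupp.single k _ = c • Finsupp.single k _
    simp))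

theorem xl_apply (k : ℤ) (x : g) : D.xl k x = D.xt k ⟨D.eigProj k x, D.eigProj_mem k x⟩ := rfl

theorem xt_eq_xl (k : ℤ) (x : D.eigen k) : D.xt k x = D.xl k x.1 := by
  rw [xl_apply]; congr 1; exact Subtype.ext (D.eigProj_self x.2).symm

theorem xl_of_mem {k : ℤ} {x : g} (hx : x ∈ D.eigen k) : D.xl k x = D.xt k ⟨x, hx⟩ :=
  (D.xt_eq_xl k ⟨x, hx⟩).symm

theorem xl_eigProj (k : ℤ) (x : g) : D.xl k (D.eigProj k x) = D.xl k x :=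
  D.xl_of_mem (D.eigProj_mem k x)

theorem br_lElt_lElt (i j : ℤ) :
    br (D.lElt i) (D.lElt j) = ((j : ℂ) - i) • D.lElt (i + j) := by
  refine Prod.ext ?_ (Subtype.ext ?_)
  · change witt _ _ = _ • Finsupp.single _ _
    simp [witt_single, lElt]
  · change D.act _ 0 - D.act _ 0 + loopBr g 0 0 = (_ • (0 : D.loop)).1
    simp

theorem br_lElt_xl (i k : ℤ) (x : g) : br (D.lElt i) (D.xl k x) =
    D.xl (k + D.n * i) (((k : ℂ) / D.n) • x + (i : ℂ) • D.d x) := by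
  refine Prod.ext ?_ (Subtype.ext ?_)
  · change witt _ 0 = 0
    simp
  · change D.act (Finsupp.single i 1) (Finsupp.single k _) - D.act 0 0 +
      loopBr g 0 (Finsupp.single k _) = Finsupp.single _ _
    have h : D.eigProj (k + D.n * i) = D.eigProj k := D.eigProj_congr ⟨i, by ring⟩
    simp [h, eigProj_d]

theorem br_xl_xl (k l : ℤ) (x y : g) : br (D.xl k x) (D.xl l y) =
    D.xl (k + l) (br (D.eigProj k x) (D.eigProj l y)) := by
  refine Prod.ext ?_ (Subtype.ext ?_)
  · change witt 0 0 = 0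
    simp
  · change D.act 0 (Finsupp.single l _) - D.act 0 (Finsupp.single k _) +
      loopBr g (Finsupp.single k (D.eigProj k x)) (Finsupp.single l (D.eigProj l y)) =
      Finsupp.single (k + l) (D.eigProj (k + l) (br (D.eigProj k x) (D.eigProj l y)))
    rw [loopBr_single, D.eigProj_self (D.br_mem_eigen (D.eigProj_mem k x) (D.eigProj_mem l y))]
    simp

theorem lElt_mem (i : ℤ) : D.lElt i ∈ part (V := D.L) 0 :=
  ⟨fun h => absurd h (by decide), Submodule.zero_mem _⟩

theorem xl_mem (k : ℤ) (i : ZMod 2) {x : g} (hx : x ∈ part (V := g) i) :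
    D.xl k x ∈ part (V := D.L) i :=
  ⟨fun _ => rfl, single_mem_loopPart (D.eigProj_part k i hx) k⟩

/-- The parity of the generators is kept, so identities with Koszul signs can be checked on
generators. The Witt generators occur in the even part only. -/
theorem part_induction {i : ZMod 2} {p : D.L → Prop} {u : D.L} (hu : u ∈ part (V := D.L) i)
    (h0 : p 0) (hadd : ∀ a b, p a → p b → p (a + b)) (hsmul : ∀ (c : ℂ) a, p a → p (c • a))
    (hl : i = 0 → ∀ m, p (D.lElt m))
    (hx : ∀ k : ℤ, ∀ x ∈ D.eigen k, x ∈ part (V := g) i → p (D.xl k x)) : p u := by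
  obtain ⟨w, f⟩ := u
  obtain ⟨h1, h2⟩ := hu
  dsimp only at h1 h2
  have e : ((w, f) : D.L) = (LinearMap.inl ℂ (ℤ →₀ ℂ) D.loop w : D.L) +
      (LinearMap.inr ℂ (ℤ →₀ ℂ) D.loop f : D.L) :=
    Prod.ext (add_zero _).symm (zero_add _).symm
  rw [e]
  refine hadd _ _ ?_ ?_
  · by_cases hi : i = 1
    · rw [h1 hi, map_zero]; exact h0
    · have hi0 := (zmod2_cases i).resolve_right hi
      rw [← Finsupp.sum_single w, Finsupp.sum, map_sum]
      refine Finset.sum_induction _ (fun a => p (a : D.L)) hadd h0 fun m _ => ?_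
      have : LinearMap.inl ℂ (ℤ →₀ ℂ) D.loop (Finsupp.single m (w m)) =
          (w m • D.lElt m : D.L) := by
        refine Prod.ext ?_ (smul_zero _).symm
        change Finsupp.single m (w m) = w m • Finsupp.single m 1
        simp
      rw [this]
      exact hsmul _ _ (hl hi0 m)
  · have hf : ∀ k, f.1 k ∈ D.eigen k := by
      intro k
      have := DFunLike.congr_fun (D.mem_loop.1 f.2) k
      rw [loopσ_apply] at this
      rw [mem_eigen]
      nth_rewrite 2 [← this]
      rw [smul_smul, ← zpow_add₀ D.ω_ne, add_neg_cancel, zpow_zero, one_smul]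
    have : LinearMap.inr ℂ (ℤ →₀ ℂ) D.loop f = ∑ k ∈ f.1.support, (D.xl k (f.1 k) : D.L) := by
      refine Prod.ext ?_ (Subtype.ext ?_)
      · exact (map_sum (LinearMap.fst ℂ (ℤ →₀ ℂ) D.loop) (fun k => D.xl k (f.1 k)) _).trans
          (Finset.sum_eq_zero fun k _ => rfl) |>.symm
      · refine Eq.trans ?_ (map_sum (D.loop.subtype ∘ₗ LinearMap.snd ℂ (ℤ →₀ ℂ) D.loop)
          (fun k => D.xl k (f.1 k)) _).symm
        change f.1 = ∑ k ∈ f.1.support, Finsupp.single k (D.eigProj k (f.1 k))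
        simp only [fun k => D.eigProj_self (hf k)]
        exact (Finsupp.sum_single f.1).symm
    rw [this]
    exact Finset.sum_induction _ p hadd h0 fun k _ => hx k _ (hf k) (h2 k)

theorem L_induction {p : D.L → Prop} (u : D.L) (hadd : ∀ a b, p a → p b → p (a + b))
    (hsmul : ∀ (c : ℂ) a, p a → p (c • a)) (hl : ∀ m, p (D.lElt m))
    (hx : ∀ k : ℤ, ∀ x ∈ D.eigen k, p (D.xl k x)) : p u := by
  have h0 : p 0 := by simpa using hsmul 0 _ (hl 0)
  obtain ⟨a, ha, b, hb, rfl⟩ := exists_decomp u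
  exact hadd _ _ (D.part_induction ha h0 hadd hsmul (fun _ => hl) fun k x hx' _ => hx k x hx')
    (D.part_induction hb h0 hadd hsmul (fun _ => hl) fun k x hx' _ => hx k x hx')

theorem L_hom_ext {M : Type*} [AddCommGroup M] [Module ℂ M] {f f' : D.L →ₗ[ℂ] M}
    (hl : ∀ m, f (D.lElt m) = f' (D.lElt m))
    (hx : ∀ k : ℤ, ∀ x ∈ D.eigen k, f (D.xl k x) = f' (D.xl k x)) : f = f' := by
  refine LinearMap.ext fun u => ?_
  refine D.L_induction (p := fun u => f u = f' u) u (fun a b ha hb => ?_) (fun c a ha => ?_) hl hx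
  · rw [map_add, map_add, ha, hb]
  · rw [map_smul, map_smul, ha]

end TwistDatum

/-! ### Cocycles that are not necessarily even -/

theorem koszul_zero_left (j : ZMod 2) : koszul 0 j = 1 := by simp [koszul]

theorem koszul_zero_right (i : ZMod 2) : koszul i 0 = 1 := by simp [koszul]

theorem koszul_one_one : koszul 1 1 = -1 := by simp [koszul]

theorem koszul_comm (i j : ZMod 2) : koszul i j = koszul j i := by simp [koszul, and_comm]

theorem koszul_mul_self (i j : ZMod 2) : koszul i j * koszul i j = 1 := by
  unfold koszul; split_ifs <;> norm_num

theorem koszul_add_right (i j k : ZMod 2) : koszul i (j + k) = koszul i j * koszul i k := by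
  rcases zmod2_cases i with rfl | rfl <;> rcases zmod2_cases j with rfl | rfl <;>
    rcases zmod2_cases k with rfl | rfl <;>
    simp [koszul_zero_left, koszul_zero_right, koszul_one_one, CharTwo.add_self_eq_zero]

section Cocycle

variable {L : Type*} [AddCommGroup L] [Module ℂ L] [LieSuperalgebra L]
variable {M : Type*} [AddCommGroup M] [Module ℂ M]

/-- Super skew-symmetry of a bilinear map. -/
def IsSuperSkew (β : L →ₗ[ℂ] L →ₗ[ℂ] M) : Prop :=
  ∀ i j : ZMod 2, ∀ x ∈ part (V := L) i, ∀ y ∈ part (V := L) j, β x y = -(koszul i j • β y x)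

/-- The cocycle identity of a bilinear map. -/
def IsSuperClosed (β : L →ₗ[ℂ] L →ₗ[ℂ] M) : Prop :=
  ∀ i j : ZMod 2, ∀ x ∈ part (V := L) i, ∀ y ∈ part (V := L) j, ∀ z,
    β x (br y z) = β (br x y) z + koszul i j • β y (br x z)

/-- Together with `closed_swap_right` this makes the cocycle identity of a homogeneous triple
independent of the order of its entries, so one ordering per kind of triple has to be verified. -/
theorem IsSuperSkew.closed_swap_left {β : L →ₗ[ℂ] L →ₗ[ℂ] M} {i j : ZMod 2}
    {x y z : L} (hx : x ∈ part (V := L) i) (hy : y ∈ part (V := L) j)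
    (h : β x (br y z) = β (br x y) z + koszul i j • β y (br x z)) :
    β y (br x z) = β (br y x) z + koszul j i • β x (br y z) := by
  rw [br_skew j i y hy x hx, h, koszul_comm j i]
  simp only [map_neg, map_smul, LinearMap.neg_apply, LinearMap.smul_apply, smul_add, smul_smul,
    koszul_mul_self]
  module

theorem IsSuperSkew.closed_swap_right {β : L →ₗ[ℂ] L →ₗ[ℂ] M} (hβ : IsSuperSkew β)
    {i j k : ZMod 2} {x y z : L} (hx : x ∈ part (V := L) i) (hy : y ∈ part (V := L) j)
    (hz : z ∈ part (V := L) k)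
    (h : β x (br y z) = β (br x y) z + koszul i j • β y (br x z)) :
    β x (br z y) = β (br x z) y + koszul i k • β z (br x y) := by
  rw [br_skew k j z hz y hy, map_neg, map_smul, h, hβ _ _ _ (br_mem i k x hx z hz) y hy,
    hβ _ _ z hz _ (br_mem i j x hx y hy), koszul_comm (i + k) j, koszul_add_right,
    koszul_add_right, koszul_comm k j, koszul_comm k i, koszul_comm j i]
  have h1 := koszul_mul_self i k
  linear_combination (norm := skip) (koszul j k) • congrArg (fun c => c • β (br x y) z) h1
  module

end Cocycle

namespace TwistDatum

variable {g : Type u} [AddCommGroup g] [Module ℂ g] [LieSuperalgebra g] (D : TwistDatum g)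
variable {M : Type*} [AddCommGroup M] [Module ℂ M]

theorem act_mem_eigen (i : ℤ) {k : ℤ} {x : g} (hx : x ∈ D.eigen k) :
    ((k : ℂ) / D.n) • x + (i : ℂ) • D.d x ∈ D.eigen (k + D.n * i) := by
  rw [eigen_add_mul]
  exact Submodule.add_mem _ (Submodule.smul_mem _ _ hx) (Submodule.smul_mem _ _ (D.d_mem_eigen hx))

theorem br_xl_xl_of_mem {k l : ℤ} {x y : g} (hx : x ∈ D.eigen k) (hy : y ∈ D.eigen l) :
    br (D.xl k x) (D.xl l y) = D.xl (k + l) (br x y) := by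
  rw [br_xl_xl, D.eigProj_self hx, D.eigProj_self hy]

/-! ### Bilinear maps on `𝔏` of total degree zero -/

/-- The bilinear map on `𝔏` whose only nonzero values on generators are
`(𝔩_i, 𝔩_{-i}) ↦ a_i`, `(𝔩_i, x t^{-i}) ↦ b_i(x)` and `(x t^{k/n}, y t^{-k/n}) ↦ c_k(x, y)`. -/
def diagForm (a : ℤ → M) (b : ℤ → g →ₗ[ℂ] M) (c : ℤ → g →ₗ[ℂ] g →ₗ[ℂ] M) :
    D.L →ₗ[ℂ] D.L →ₗ[ℂ] M :=
  let pW : D.L →ₗ[ℂ] (ℤ →₀ ℂ) := LinearMap.fst ℂ (ℤ →₀ ℂ) D.loop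
  let pG : D.L →ₗ[ℂ] (ℤ →₀ g) := D.loop.subtype ∘ₗ LinearMap.snd ℂ (ℤ →₀ ℂ) D.loop
  let A : (ℤ →₀ ℂ) →ₗ[ℂ] (ℤ →₀ ℂ) →ₗ[ℂ] M :=
    Finsupp.linearCombination ℂ fun i : ℤ => (Finsupp.lapply (-i)).smulRight (a i)
  let B : (ℤ →₀ ℂ) →ₗ[ℂ] (ℤ →₀ g) →ₗ[ℂ] M :=
    Finsupp.linearCombination ℂ fun i : ℤ => b i ∘ₗ Finsupp.lapply (-(D.n * i))
  let C : (ℤ →₀ g) →ₗ[ℂ] (ℤ →₀ g) →ₗ[ℂ] M :=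
    Finsupp.lsum ℂ fun k : ℤ => (c k).compl₂ (Finsupp.lapply (-k))
  A.compl₁₂ pW pW + B.compl₁₂ pW pG - (B.compl₁₂ pW pG).flip + C.compl₁₂ pG pG

section DiagForm

variable (a : ℤ → M) (b : ℤ → g →ₗ[ℂ] M) (c : ℤ → g →ₗ[ℂ] g →ₗ[ℂ] M)

theorem diagForm_lElt_lElt (i j : ℤ) :
    D.diagForm a b c (D.lElt i) (D.lElt j) = if i + j = 0 then a i else 0 := by
  have e : D.diagForm a b c (D.lElt i) (D.lElt j) =
    Finsupp.linearCombination ℂ (fun i : ℤ => (Finsupp.lapply (-i) : (ℤ →₀ ℂ) →ₗ[ℂ] ℂ).smulRight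
      (a i)) (Finsupp.single i 1) (Finsupp.single j 1) +
    Finsupp.linearCombination ℂ (fun i : ℤ => b i ∘ₗ Finsupp.lapply (-(D.n * i)))
      (Finsupp.single i 1) 0 - Finsupp.linearCombination ℂ (fun i : ℤ => b i ∘ₗ Finsupp.lapply
      (-(D.n * i))) (Finsupp.single j 1) 0 +
    Finsupp.lsum ℂ (fun k : ℤ => (c k).compl₂ (Finsupp.lapply (-k))) 0 0 := rfl
  rw [e]
  simp [Finsupp.single_apply, eq_neg_iff_add_eq_zero, add_comm j i]

theorem diagForm_lElt_xl (i : ℤ) {k : ℤ} {x : g} (hx : x ∈ D.eigen k) :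
    D.diagForm a b c (D.lElt i) (D.xl k x) = if D.n * i + k = 0 then b i x else 0 := by
  have e : D.diagForm a b c (D.lElt i) (D.xl k x) =
    Finsupp.linearCombination ℂ (fun i : ℤ => (Finsupp.lapply (-i) : (ℤ →₀ ℂ) →ₗ[ℂ] ℂ).smulRight
      (a i)) (Finsupp.single i 1) 0 +
    Finsupp.linearCombination ℂ (fun i : ℤ => b i ∘ₗ Finsupp.lapply (-(D.n * i)))
      (Finsupp.single i 1) (Finsupp.single k (D.eigProj k x)) -
    Finsupp.linearCombination ℂ (fun i : ℤ => b i ∘ₗ Finsupp.lapply (-(D.n * i))) 0 0 +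
    Finsupp.lsum ℂ (fun k : ℤ => (c k).compl₂ (Finsupp.lapply (-k))) 0
      (Finsupp.single k (D.eigProj k x)) := rfl
  rw [e, D.eigProj_self hx]
  simp [Finsupp.single_apply, eq_neg_iff_add_eq_zero, add_comm k, apply_ite (b i)]

theorem diagForm_xl_lElt (i : ℤ) {k : ℤ} {x : g} (hx : x ∈ D.eigen k) :
    D.diagForm a b c (D.xl k x) (D.lElt i) = -D.diagForm a b c (D.lElt i) (D.xl k x) := by
  have e : D.diagForm a b c (D.xl k x) (D.lElt i) =
    Finsupp.linearCombination ℂ (fun i : ℤ => (Finsupp.lapply (-i) : (ℤ →₀ ℂ) →ₗ[ℂ] ℂ).smulRight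
      (a i)) 0 (Finsupp.single i 1) +
    Finsupp.linearCombination ℂ (fun i : ℤ => b i ∘ₗ Finsupp.lapply (-(D.n * i))) 0 0 -
    Finsupp.linearCombination ℂ (fun i : ℤ => b i ∘ₗ Finsupp.lapply (-(D.n * i)))
      (Finsupp.single i 1) (Finsupp.single k (D.eigProj k x)) +
    Finsupp.lsum ℂ (fun k : ℤ => (c k).compl₂ (Finsupp.lapply (-k)))
      (Finsupp.single k (D.eigProj k x)) 0 := rfl
  rw [e, D.eigProj_self hx, diagForm_lElt_xl _ _ _ _ _ hx]
  simp [Finsupp.single_apply, eq_neg_iff_add_eq_zero, add_comm k, apply_ite (b i)]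

theorem diagForm_xl_xl {k l : ℤ} {x y : g} (hx : x ∈ D.eigen k) (hy : y ∈ D.eigen l) :
    D.diagForm a b c (D.xl k x) (D.xl l y) = if k + l = 0 then c k x y else 0 := by
  have e : D.diagForm a b c (D.xl k x) (D.xl l y) =
    Finsupp.linearCombination ℂ (fun i : ℤ => (Finsupp.lapply (-i) : (ℤ →₀ ℂ) →ₗ[ℂ] ℂ).smulRight
      (a i)) 0 0 +
    Finsupp.linearCombination ℂ (fun i : ℤ => b i ∘ₗ Finsupp.lapply (-(D.n * i)))
      0 (Finsupp.single l (D.eigProj l y)) - Finsupp.linearCombination ℂ (fun i : ℤ => b i ∘ₗ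
      Finsupp.lapply (-(D.n * i))) 0 (Finsupp.single k (D.eigProj k x)) +
    Finsupp.lsum ℂ (fun k : ℤ => (c k).compl₂ (Finsupp.lapply (-k)))
      (Finsupp.single k (D.eigProj k x)) (Finsupp.single l (D.eigProj l y)) := rfl
  rw [e, D.eigProj_self hx, D.eigProj_self hy]
  simp [Finsupp.single_apply, eq_neg_iff_add_eq_zero, add_comm l, apply_ite (c k x)]

variable {a b c}

/-- No condition on `b` is needed: the mixed values are skew by construction. -/
theorem diagForm_skew (ha : ∀ i, a (-i) = -a i)
    (hc : ∀ (k : ℤ) (i j : ZMod 2), ∀ x ∈ part (V := g) i, ∀ y ∈ part (V := g) j,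
      c k x y = -(koszul i j • c (-k) y x)) : IsSuperSkew (D.diagForm a b c) := by
  intro i j u hu v hv
  refine D.part_induction (p := fun u => D.diagForm a b c u v =
    -(koszul i j • D.diagForm a b c v u)) hu (by simp) (fun a b ha hb => ?_) (fun c a ha => ?_)
    ?_ ?_
  · simp only [map_add, LinearMap.add_apply, ha, hb]; module
  · simp only [map_smul, LinearMap.smul_apply, ha]; module
  all_goals
    intro t x
    try intro hx hxi
    refine D.part_induction (p := fun v => D.diagForm a b c _ v =
      -(koszul i j • D.diagForm a b c v _)) hv (by simp) (fun a b ha hb => ?_) (fun c a ha => ?_)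
      ?_ ?_
    · simp only [map_add, LinearMap.add_apply, ha, hb]; module
    · simp only [map_smul, LinearMap.smul_apply, ha]; module
    all_goals
      intro s y
      try intro hy hyi
  · subst s t
    rw [diagForm_lElt_lElt, diagForm_lElt_lElt, koszul_zero_left, one_smul, add_comm y x]
    split_ifs with h
    · rw [show y = -x by omega, ha, neg_neg]
    · rw [neg_zero]
  · subst t
    rw [D.diagForm_xl_lElt _ _ _ _ hy, koszul_zero_left, one_smul, neg_neg]
  · subst s
    rw [D.diagForm_xl_lElt _ _ _ _ hx, koszul_zero_right, one_smul]
  · rw [D.diagForm_xl_xl _ _ _ hx hy, D.diagForm_xl_xl _ _ _ hy hx, add_comm s t]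
    split_ifs with h
    · rw [show s = -t by omega]; exact hc t i j x hxi y hyi
    · rw [smul_zero, neg_zero]

/-- The four conditions are the cocycle identities on `(𝔩,𝔩,𝔩)`, `(𝔩,𝔩,x)`, `(𝔩,x,y)` and `(x,y,z)`
in total degree zero. In the first two the last degree `-i-j` has been substituted. They are stated
on all of `g`, because the formulas to which they are applied hold there without regard to
eigenspaces. -/
theorem diagForm_closed (hskew : IsSuperSkew (D.diagForm a b c))
    (haaa : ∀ i j : ℤ, (-(i : ℂ) - 2 * j) • a i =
      ((j : ℂ) - i) • a (i + j) + (-2 * (i : ℂ) - j) • a j)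
    (hb : ∀ (i j : ℤ) (x : g), b i ((-(i : ℂ) - j) • x + (j : ℂ) • D.d x) =
      ((j : ℂ) - i) • b (i + j) x + b j ((-(i : ℂ) - j) • x + (i : ℂ) • D.d x))
    (hbc : ∀ (i k l : ℤ) (x y : g), k + l + D.n * i = 0 →
      b i (br x y) = c (k + D.n * i) (((k : ℂ) / D.n) • x + (i : ℂ) • D.d x) y +
        c k x (((l : ℂ) / D.n) • y + (i : ℂ) • D.d y))
    (hc : ∀ (k l : ℤ) (i j : ZMod 2), ∀ x ∈ part (V := g) i, ∀ y ∈ part (V := g) j, ∀ z,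
      c k x (br y z) = c (k + l) (br x y) z + koszul i j • c l y (br x z)) :
    IsSuperClosed (D.diagForm a b c) := by
  have hn := D.n_ne
  set β := D.diagForm a b c with hβ
  have lll : ∀ i j k : ℤ, β (D.lElt i) (br (D.lElt j) (D.lElt k)) =
      β (br (D.lElt i) (D.lElt j)) (D.lElt k) +
        koszul 0 0 • β (D.lElt j) (br (D.lElt i) (D.lElt k)) := by
    intro i j k
    simp only [br_lElt_lElt, map_smul, LinearMap.smul_apply, hβ, diagForm_lElt_lElt,
      koszul_zero_left, one_smul, ← add_assoc]
    rw [add_comm j i]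
    split_ifs with h
    · have hk : (k : ℂ) = -i - j := by
        rw [show k = -i - j by omega]; push_cast; ring
      rw [hk]
      linear_combination (norm := module) haaa i j
    · simp
  have llx : ∀ (p : ZMod 2) (i j k : ℤ), ∀ x ∈ D.eigen k,
      β (D.lElt i) (br (D.lElt j) (D.xl k x)) =
      β (br (D.lElt i) (D.lElt j)) (D.xl k x) +
        koszul 0 p • β (D.lElt j) (br (D.lElt i) (D.xl k x)) := by
    intro p i j k x hx
    simp only [br_lElt_lElt, br_lElt_xl, map_smul, LinearMap.smul_apply, hβ, koszul_zero_left,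
      one_smul, D.diagForm_lElt_xl _ _ _ _ hx, D.diagForm_lElt_xl _ _ _ _ (D.act_mem_eigen _ hx)]
    rw [show D.n * i + (k + D.n * j) = D.n * (i + j) + k by ring,
      show D.n * j + (k + D.n * i) = D.n * (i + j) + k by ring]
    split_ifs with h
    · have hk : (k : ℂ) / D.n = -i - j := by
        rw [show k = -(D.n * (i + j)) by omega]; push_cast; field_simp; ring
      rw [hk, hb]
    · simp
  have lxx : ∀ (p : ZMod 2) (i k l : ℤ), ∀ x ∈ D.eigen k, ∀ y ∈ D.eigen l,
      β (D.lElt i) (br (D.xl k x) (D.xl l y)) =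
      β (br (D.lElt i) (D.xl k x)) (D.xl l y) +
        koszul 0 p • β (D.xl k x) (br (D.lElt i) (D.xl l y)) := by
    intro p i k l x hx y hy
    simp only [D.br_xl_xl_of_mem hx hy, br_lElt_xl, hβ, koszul_zero_left, one_smul,
      D.diagForm_lElt_xl _ _ _ _ (D.br_mem_eigen hx hy),
      D.diagForm_xl_xl _ _ _ (D.act_mem_eigen _ hx) hy,
      D.diagForm_xl_xl _ _ _ hx (D.act_mem_eigen _ hy)]
    rw [show D.n * i + (k + l) = k + l + D.n * i by ring,
      show k + D.n * i + l = k + l + D.n * i by ring, ← add_assoc]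
    split_ifs with h
    · exact hbc i k l x y h
    · simp
  have xxx : ∀ (p q : ZMod 2) (k l m : ℤ), ∀ x ∈ D.eigen k, x ∈ part (V := g) p →
      ∀ y ∈ D.eigen l, y ∈ part (V := g) q → ∀ z ∈ D.eigen m,
      β (D.xl k x) (br (D.xl l y) (D.xl m z)) =
      β (br (D.xl k x) (D.xl l y)) (D.xl m z) +
        koszul p q • β (D.xl l y) (br (D.xl k x) (D.xl m z)) := by
    intro p q k l m x hx hxp y hy hyq z hz
    simp only [D.br_xl_xl_of_mem hx hy, D.br_xl_xl_of_mem hx hz, D.br_xl_xl_of_mem hy hz, hβ,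
      D.diagForm_xl_xl _ _ _ hx (D.br_mem_eigen hy hz),
      D.diagForm_xl_xl _ _ _ hy (D.br_mem_eigen hx hz),
      D.diagForm_xl_xl _ _ _ (D.br_mem_eigen hx hy) hz]
    rw [show l + (k + m) = k + l + m by ring, ← add_assoc]
    split_ifs with h
    · exact hc k l p q x hxp y hyq z
    · simp
  intro p q u hu v hv w
  -- The third entry has to be homogeneous as well before the entries can be permuted.
  suffices H : ∀ r, ∀ w ∈ part (V := D.L) r,
      β u (br v w) = β (br u v) w + koszul p q • β v (br u w) by
    obtain ⟨w0, h0, w1, h1, rfl⟩ := exists_decomp w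
    simp only [map_add, H 0 w0 h0, H 1 w1 h1]; module
  intro r w hw
  refine D.part_induction (p := fun u => β u (br v w) = β (br u v) w + koszul p q • β v (br u w))
    hu (by simp) (fun a b ha hb => ?_) (fun c a ha => ?_) ?_ ?_
  · simp only [map_add, LinearMap.add_apply, ha, hb]; module
  · simp only [map_smul, LinearMap.smul_apply, ha]; module
  all_goals
    intro t x
    try intro hx hxp
    refine D.part_induction (p := fun v => β _ (br v w) = β (br _ v) w +
      koszul p q • β v (br _ w)) hv (by simp) (fun a b ha hb => ?_) (fun c a ha => ?_) ?_ ?_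
    · simp only [map_add, LinearMap.add_apply, ha, hb]; module
    · simp only [map_smul, LinearMap.smul_apply, ha]; module
    all_goals
      intro s y
      try intro hy hyq
      refine D.part_induction (p := fun w => β _ (br _ w) = β (br _ _) w +
        koszul p q • β _ (br _ w)) hw (by simp) (fun a b ha hb => ?_) (fun c a ha => ?_) ?_ ?_
      · simp only [map_add, ha, hb]; module
      · simp only [map_smul, ha]; module
      all_goals
        intro m z
        try intro hz hzr
  -- Of the eight patterns of Witt and loop entries, four are the families above and the other four
  -- are permutations of them.
  · subst t s; exact lll _ _ _
  · subst t s; exact llx _ _ _ _ _ hz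
  · subst t m
    exact hskew.closed_swap_right (D.lElt_mem _) (D.lElt_mem _) (D.xl_mem _ _ hyq)
      (llx 0 _ _ _ _ hy)
  · subst t; exact lxx _ _ _ _ _ hy _ hz
  · subst s m
    exact IsSuperSkew.closed_swap_left (D.lElt_mem _) (D.xl_mem _ _ hxp)
      (hskew.closed_swap_right (D.lElt_mem _) (D.lElt_mem _) (D.xl_mem _ _ hxp)
      (llx 0 _ _ _ _ hx))
  · subst s
    exact IsSuperSkew.closed_swap_left (D.lElt_mem _) (D.xl_mem _ _ hxp) (lxx p _ _ _ _ hx _ hz)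
  · subst m
    exact hskew.closed_swap_right (D.xl_mem _ _ hxp) (D.lElt_mem _) (D.xl_mem _ _ hyq)
      (IsSuperSkew.closed_swap_left (D.lElt_mem _) (D.xl_mem _ _ hxp) (lxx p _ _ _ _ hx _ hy))
  · exact xxx _ _ _ _ _ _ hx hxp _ hy hyq _ hz

end DiagForm

theorem L_hom_ext₂ {f f' : D.L →ₗ[ℂ] D.L →ₗ[ℂ] M}
    (hll : ∀ i j, f (D.lElt i) (D.lElt j) = f' (D.lElt i) (D.lElt j))
    (hlx : ∀ i k : ℤ, ∀ x ∈ D.eigen k, f (D.lElt i) (D.xl k x) = f' (D.lElt i) (D.xl k x))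
    (hxl : ∀ i k : ℤ, ∀ x ∈ D.eigen k, f (D.xl k x) (D.lElt i) = f' (D.xl k x) (D.lElt i))
    (hxx : ∀ k l : ℤ, ∀ x ∈ D.eigen k, ∀ y ∈ D.eigen l,
      f (D.xl k x) (D.xl l y) = f' (D.xl k x) (D.xl l y)) : f = f' :=
  D.L_hom_ext (fun i => D.L_hom_ext (hll i) (hlx i))
    fun k x hx => D.L_hom_ext (fun i => hxl i k x hx) fun l y hy => hxx k l x hx y hy

theorem diagForm_add (a a' : ℤ → M) (b b' : ℤ → g →ₗ[ℂ] M) (c c' : ℤ → g →ₗ[ℂ] g →ₗ[ℂ] M) :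
    D.diagForm (a + a') (b + b') (c + c') = D.diagForm a b c + D.diagForm a' b' c' := by
  refine D.L_hom_ext₂ (fun i j => ?_) (fun i k x hx => ?_) (fun i k x hx => ?_)
    fun k l x hx y hy => ?_
  · simp only [LinearMap.add_apply, diagForm_lElt_lElt]; split_ifs <;> simp
  · simp only [LinearMap.add_apply, D.diagForm_lElt_xl _ _ _ _ hx]; split_ifs <;> simp
  · simp only [LinearMap.add_apply, D.diagForm_xl_lElt _ _ _ _ hx, D.diagForm_lElt_xl _ _ _ _ hx]
    split_ifs <;> simp [add_comm]
  · simp only [LinearMap.add_apply, D.diagForm_xl_xl _ _ _ hx hy]; split_ifs <;> simp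

theorem diagForm_smul (r : ℂ) (a : ℤ → M) (b : ℤ → g →ₗ[ℂ] M) (c : ℤ → g →ₗ[ℂ] g →ₗ[ℂ] M) :
    D.diagForm (r • a) (r • b) (r • c) = r • D.diagForm a b c := by
  refine D.L_hom_ext₂ (fun i j => ?_) (fun i k x hx => ?_) (fun i k x hx => ?_)
    fun k l x hx y hy => ?_
  · simp only [LinearMap.smul_apply, diagForm_lElt_lElt]; split_ifs <;> simp
  · simp only [LinearMap.smul_apply, D.diagForm_lElt_xl _ _ _ _ hx]; split_ifs <;> simp
  · simp only [LinearMap.smul_apply, D.diagForm_xl_lElt _ _ _ _ hx, D.diagForm_lElt_xl _ _ _ _ hx]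
    split_ifs <;> simp
  · simp only [LinearMap.smul_apply, D.diagForm_xl_xl _ _ _ hx hy]; split_ifs <;> simp

/-! ### The quotient of `g` -/

theorem mkQ_d (x : g) : D.relations.mkQ (D.d x) = -D.relations.mkQ x := by
  have h : D.relations.mkQ (D.d x + x) = 0 := by
    rw [Submodule.mkQ_apply, Submodule.Quotient.mk_eq_zero]
    exact Submodule.mem_sup_left (Submodule.mem_sup_left ⟨x, rfl⟩)
  rw [map_add] at h
  exact eq_neg_of_add_eq_zero_left h

theorem mkQ_br_d_left (x y : g) :
    D.relations.mkQ (br (D.d x) y) = -((1 / 2 : ℂ) • D.relations.mkQ (br x y)) := by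
  have h : D.relations.mkQ (br (D.d x + (1 / 2 : ℂ) • x) y) = 0 := by
    rw [Submodule.mkQ_apply, Submodule.Quotient.mk_eq_zero]
    exact Submodule.mem_sup_left (Submodule.mem_sup_right (Submodule.subset_span ⟨x, y, rfl⟩))
  rw [map_add, LinearMap.add_apply, map_add, map_smul, LinearMap.smul_apply, map_smul] at h
  exact eq_neg_of_add_eq_zero_left h

/-- By the derivation rule the two slots of a bracket together contribute `-1`, the action of `d` on
the quotient, and the first slot contributes `-1/2`. -/
theorem mkQ_br_d_right (x y : g) :
    D.relations.mkQ (br x (D.d y)) = -((1 / 2 : ℂ) • D.relations.mkQ (br x y)) := by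
  have h := D.mkQ_d (br x y)
  rw [D.d_br, map_add, mkQ_br_d_left] at h
  linear_combination (norm := module) h

theorem mkQ_br_br (x y z : g) : D.relations.mkQ (br x (br y z)) = 0 := by
  rw [Submodule.mkQ_apply, Submodule.Quotient.mk_eq_zero]
  exact Submodule.mem_sup_right (Submodule.subset_span ⟨x, y, z, rfl⟩)

theorem mkQ_br_br_left {i j : ZMod 2} {x y : g} (hx : x ∈ part (V := g) i)
    (hy : y ∈ part (V := g) j) (z : g) : D.relations.mkQ (br (br x y) z) = 0 := by
  have h := congrArg D.relations.mkQ (br_jacobi i j x hx y hy z)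
  rw [map_add, map_smul, mkQ_br_br, mkQ_br_br, smul_zero, add_zero] at h
  exact h.symm

/-- The component of the universal cocycle with values in the quotient of `g`. -/
def quotForm : D.L →ₗ[ℂ] D.L →ₗ[ℂ] g ⧸ D.relations :=
  D.diagForm 0 (fun i => (((i : ℂ) ^ 3 - i) / 12) • D.relations.mkQ)
    fun k => ((1 - 4 * ((k : ℂ) / D.n) ^ 2) / 24) • (br (L := g)).compr₂ D.relations.mkQ

theorem quotForm_skew : IsSuperSkew D.quotForm := by
  refine D.diagForm_skew (fun i => by simp) fun k i j x hx y hy => ?_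
  simp only [LinearMap.smul_apply, LinearMap.compr₂_apply]
  rw [br_skew i j x hx y hy]
  push_cast
  simp only [map_neg, map_smul]
  module

/-- In the quotient `d` is the scalar `-1`, and inside either slot of a bracket it is `-1/2`. The
identities with a Witt element thus become polynomial identities in the degrees. The identity on
three loop elements is trivial because iterated brackets vanish. -/
theorem quotForm_closed : IsSuperClosed D.quotForm := by
  have hn := D.n_ne
  refine D.diagForm_closed D.quotForm_skew (fun i j => by simp) (fun i j x => ?_)
    (fun i k l x y h => ?_) fun k l i j x hx y hy z => ?_
  · simp only [LinearMap.smul_apply, map_add, map_smul, mkQ_d]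
    push_cast
    module
  · have h' : (l : ℂ) / D.n = -(k / D.n) - i := by
      rw [show l = -k - D.n * i by omega]; push_cast; field_simp
    simp only [LinearMap.smul_apply, LinearMap.compr₂_apply, map_add, map_smul,
      LinearMap.add_apply, mkQ_br_d_left, mkQ_br_d_right, h']
    have h2 : ((k + D.n * i : ℤ) : ℂ) / D.n = k / D.n + i := by push_cast; field_simp
    rw [h2]
    module
  · simp only [LinearMap.smul_apply, LinearMap.compr₂_apply, mkQ_br_br,
      D.mkQ_br_br_left hx hy, smul_zero, add_zero]

/-- A nonzero value has total degree zero, so the element whose class is taken lies in `g_[0]`, the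
fixed space of `σ`. -/
theorem quotForm_fixed (u v : D.L) : D.quotForm u v ∈ D.QuotFixed := by
  have h0 : ∀ x ∈ D.eigen 0, D.relations.mkQ x ∈ D.QuotFixed := by
    intro x hx
    have : D.σ x = x := by simpa using D.mem_eigen.1 hx
    change D.relations.mkQ (D.σ x) = D.relations.mkQ x
    rw [this]
  have hlx : ∀ i k : ℤ, ∀ x ∈ D.eigen k, D.quotForm (D.lElt i) (D.xl k x) ∈ D.QuotFixed := by
    intro i k x hx
    rw [quotForm, D.diagForm_lElt_xl _ _ _ _ hx]
    split_ifs with h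
    · refine Submodule.smul_mem _ _ (h0 x ?_)
      rwa [← D.eigen_congr (k := k) ⟨-i, by rw [mul_neg]; omega⟩]
    · exact Submodule.zero_mem _
  refine D.L_induction (p := fun u => D.quotForm u v ∈ D.QuotFixed) u (fun a b ha hb => ?_)
    (fun c a ha => ?_) (fun i => ?_) fun k x hx => ?_
  · rw [map_add]; exact Submodule.add_mem _ ha hb
  · rw [map_smul]; exact Submodule.smul_mem _ _ ha
  all_goals
    refine D.L_induction (p := fun v => D.quotForm _ v ∈ D.QuotFixed) v (fun a b ha hb => ?_)
      (fun c a ha => ?_) (fun j => ?_) fun l y hy => ?_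
    · rw [map_add]; exact Submodule.add_mem _ ha hb
    · rw [map_smul]; exact Submodule.smul_mem _ _ ha
  · rw [quotForm, D.diagForm_lElt_lElt]
    split_ifs <;> exact Submodule.zero_mem _
  · exact hlx i l y hy
  · have h := hlx j k x hx
    rw [quotForm] at h ⊢
    rw [D.diagForm_xl_lElt _ _ _ _ hx]
    exact Submodule.neg_mem _ h
  · rw [quotForm, D.diagForm_xl_xl _ _ _ hx hy]
    split_ifs with h
    · refine Submodule.smul_mem _ _ (h0 _ ?_)
      rw [← h]; exact D.br_mem_eigen hx hy
    · exact Submodule.zero_mem _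

/-! ### Invariant forms on `ℂ∂ ⋉ g` -/

theorem br_del_del : br D.del D.del = 0 :=
  Prod.ext rfl (by
    change (1 : ℂ) • D.d 0 - (1 : ℂ) • D.d 0 + br (0 : g) (0 : g) = 0
    simp)

theorem br_del_incl (x : g) : br D.del (D.incl x) = D.incl (D.d x) :=
  Prod.ext rfl (by
    change (1 : ℂ) • D.d x - (0 : ℂ) • D.d 0 + br (0 : g) x = D.d x
    simp)

theorem br_incl_del (x : g) : br (D.incl x) D.del = -D.incl (D.d x) := by
  rw [← map_neg]
  exact Prod.ext rfl (by
    change (0 : ℂ) • D.d 0 - (1 : ℂ) • D.d x + br x (0 : g) = -D.d x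
    simp)

theorem br_incl_incl (x y : g) : br (D.incl x) (D.incl y) = D.incl (br x y) :=
  Prod.ext rfl (by
    change (0 : ℂ) • D.d y - (0 : ℂ) • D.d x + br x y = br x y
    simp)

theorem del_mem : D.del ∈ part (V := D.DDot) 0 :=
  ⟨fun h => absurd h (by decide), Submodule.zero_mem _⟩

theorem incl_mem {i : ZMod 2} {x : g} (hx : x ∈ part (V := g) i) :
    D.incl x ∈ part (V := D.DDot) i := ⟨fun _ => rfl, hx⟩

section InvForm

variable {D} {B : D.DDot →ₗ[ℂ] D.DDot →ₗ[ℂ] ℂ} (hB : B ∈ invForms D.DDot)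
include hB

/-- Writing `d x = [∂, x]` and using invariance moves `d` out of the form; here `[∂, ∂] = 0` ends
the computation. -/
theorem invForms_del_d (x : g) : B D.del (D.incl (D.d x)) = 0 := by
  rw [← br_del_incl, ← hB.2, br_del_del, map_zero, LinearMap.zero_apply]

theorem invForms_d_left (x y : g) :
    B (D.incl (D.d x)) (D.incl y) = B D.del (D.incl (br x y)) := by
  rw [← br_del_incl, hB.2, br_incl_incl]

theorem invForms_d_right (x y : g) :
    B (D.incl x) (D.incl (D.d y)) = -B D.del (D.incl (br x y)) := by
  rw [← br_del_incl, ← hB.2, br_incl_del, map_neg, LinearMap.neg_apply, invForms_d_left hB]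

theorem invForms_br (x y z : g) :
    B (D.incl (br x y)) (D.incl z) = B (D.incl x) (D.incl (br y z)) := by
  rw [← br_incl_incl, hB.2, br_incl_incl]

theorem invForms_symm {i j : ZMod 2} {x y : g} (hx : x ∈ part (V := g) i)
    (hy : y ∈ part (V := g) j) :
    B (D.incl x) (D.incl y) = koszul i j * B (D.incl y) (D.incl x) :=
  hB.1 i j _ (D.incl_mem hx) _ (D.incl_mem hy)

end InvForm

/-- The scalar cocycle of `𝔏` defined by an invariant form on `ℂ∂ ⋉ g`. -/
def invFormCocycle : (D.DDot →ₗ[ℂ] D.DDot →ₗ[ℂ] ℂ) →ₗ[ℂ] (D.L →ₗ[ℂ] D.L →ₗ[ℂ] ℂ) where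
  toFun B := D.diagForm (fun i => ((i : ℂ) ^ 3 - i) / 12 * B D.del D.del)
    (fun i => ((i : ℂ) ^ 2 - i) • B D.del ∘ₗ D.incl)
    fun k => ((k : ℂ) / D.n) • B.compl₁₂ D.incl D.incl + (br (L := g)).compr₂ (B D.del ∘ₗ D.incl)
  map_add' B B' := by
    rw [← diagForm_add]
    congr 1
    · funext i; simp [mul_add]
    · funext i; ext; simp [mul_add]
    · funext i; ext; simp [mul_add]; ring
  map_smul' c B := by
    rw [RingHom.id_apply, ← diagForm_smul]
    congr 1
    · funext i; simp; ring
    · funext i; ext; simp; ring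
    · funext i; ext; simp; ring

theorem invFormCocycle_skew {B : D.DDot →ₗ[ℂ] D.DDot →ₗ[ℂ] ℂ} (hB : B ∈ invForms D.DDot) :
    IsSuperSkew (D.invFormCocycle B) := by
  refine D.diagForm_skew (fun i => by push_cast; ring) fun k i j x hx y hy => ?_
  simp only [LinearMap.add_apply, LinearMap.smul_apply, LinearMap.compl₁₂_apply,
    LinearMap.compr₂_apply, LinearMap.comp_apply, smul_eq_mul]
  rw [invForms_symm hB hx hy, br_skew i j x hx y hy]
  push_cast
  simp only [map_neg, map_smul, smul_eq_mul]
  ring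

theorem invFormCocycle_closed {B : D.DDot →ₗ[ℂ] D.DDot →ₗ[ℂ] ℂ} (hB : B ∈ invForms D.DDot) :
    IsSuperClosed (D.invFormCocycle B) := by
  have hn := D.n_ne
  refine D.diagForm_closed (D.invFormCocycle_skew hB) (fun i j => ?_) (fun i j x => ?_)
    (fun i k l x y h => ?_) fun k l i j x hx y hy z => ?_
  · push_cast; simp only [smul_eq_mul]; ring
  · simp only [LinearMap.smul_apply, LinearMap.comp_apply, map_add, map_smul,
      invForms_del_d hB, smul_eq_mul]
    push_cast
    ring
  · have h' : (l : ℂ) / D.n = -(k / D.n) - i := by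
      rw [show l = -k - D.n * i by omega]; push_cast; field_simp
    have h2 : ((k + D.n * i : ℤ) : ℂ) / D.n = k / D.n + i := by push_cast; field_simp
    -- Since `B(∂, ·)` kills the image of `d`, the contributions of `d` in the two slots of `B(∂,
    -- [x, y])` cancel.
    have h3 := invForms_del_d hB (br x y)
    rw [D.d_br, map_add, map_add] at h3
    simp only [LinearMap.add_apply, LinearMap.smul_apply, LinearMap.compl₁₂_apply,
      LinearMap.compr₂_apply, LinearMap.comp_apply, smul_eq_mul, map_add, map_smul,
      invForms_d_left hB, invForms_d_right hB, h', h2]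
    linear_combination -(i : ℂ) * h3
  · simp only [LinearMap.add_apply, LinearMap.smul_apply, LinearMap.compl₁₂_apply,
      LinearMap.compr₂_apply, LinearMap.comp_apply, smul_eq_mul]
    -- The Jacobi identity accounts for the terms `B(∂, ·)`, which do not depend on the degrees. The
    -- terms linear in `k` and in `l` cancel by invariance for `(x, y, z)` and for `(y, x, z)`.
    have h1 := congrArg (fun w => B D.del (D.incl w)) (br_jacobi i j x hx y hy z)
    have h2 := invForms_br hB x y z
    have h3 := invForms_br hB y x z
    rw [br_skew j i y hy x hx, koszul_comm j i] at h3
    simp only [map_add, map_neg, map_smul, smul_eq_mul, LinearMap.neg_apply,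
      LinearMap.smul_apply] at h1 h3
    have h4 := koszul_mul_self i j
    push_cast
    field_simp
    linear_combination D.n * h1 - k * h2 + koszul i j * l * h3 +
      l * B (D.incl (br x y)) (D.incl z) * h4

/-- The scalar cocycle of `𝔏` defined by a scalar cocycle of `g`. -/
def baseCocycle : (g →ₗ[ℂ] g →ₗ[ℂ] ℂ) →ₗ[ℂ] (D.L →ₗ[ℂ] D.L →ₗ[ℂ] ℂ) where
  toFun α := D.diagForm 0 0 fun _ => α
  map_add' α α' := by
    rw [← diagForm_add]
    congr 1 <;> simp
  map_smul' c α := by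
    rw [RingHom.id_apply, ← diagForm_smul]
    congr 1 <;> simp

theorem Z2Fixed_d {α : g →ₗ[ℂ] g →ₗ[ℂ] ℂ} (hα : α ∈ D.Z2Fixed) (x y : g) :
    α (D.d x) y + α x (D.d y) = α x y :=
  LinearMap.congr_fun₂ hα.1.2 x y

theorem baseCocycle_skew {α : g →ₗ[ℂ] g →ₗ[ℂ] ℂ} (hα : α ∈ D.Z2Fixed) :
    IsSuperSkew (D.baseCocycle α) :=
  D.diagForm_skew (fun i => by simp) fun _ i j x hx y hy => hα.1.1.1 i j x hx y hy

/-- Only the identity on `(𝔩_i, x t^a, y t^b)` involves `d`. With `b = -a - i` it reads `i (dα - α)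
= 0`. -/
theorem baseCocycle_closed {α : g →ₗ[ℂ] g →ₗ[ℂ] ℂ} (hα : α ∈ D.Z2Fixed) :
    IsSuperClosed (D.baseCocycle α) := by
  have hn := D.n_ne
  refine D.diagForm_closed (D.baseCocycle_skew hα) (fun i j => by simp) (fun i j x => by simp)
    (fun i k l x y h => ?_) fun _ _ i j x hx y hy z => hα.1.1.2 i j x hx y hy z
  have h' : (l : ℂ) / D.n = -(k / D.n) - i := by
    rw [show l = -k - D.n * i by omega]; push_cast; field_simp
  simp only [map_add, map_smul, LinearMap.add_apply, LinearMap.smul_apply, smul_eq_mul, h',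
    Pi.zero_apply, LinearMap.zero_apply]
  linear_combination -(i : ℂ) * D.Z2Fixed_d hα x y

/-! ### The universal cocycle -/

/-- The bilinear map that underlies the universal cocycle. -/
def univForm : D.L →ₗ[ℂ] D.L →ₗ[ℂ] D.Centre :=
  LinearMap.mk₂ ℂ (fun u v => (⟨D.quotForm u v, D.quotForm_fixed u v⟩,
      (((D.invFormCocycle.flip u).flip v) ∘ₗ D.InvFixed.subtype : Module.Dual ℂ D.InvFixed),
      (((D.baseCocycle.flip u).flip v) ∘ₗ D.Z2Fixed.subtype : Module.Dual ℂ D.Z2Fixed)))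
    (fun _ _ _ => Prod.ext (Subtype.ext (by simp))
      (Prod.ext (by ext; simp) (by ext; simp)))
    (fun _ _ _ => Prod.ext (Subtype.ext (by simp))
      (Prod.ext (by ext; simp) (by ext; simp)))
    (fun _ _ _ => Prod.ext (Subtype.ext (by simp))
      (Prod.ext (by ext; simp) (by ext; simp)))
    (fun _ _ _ => Prod.ext (Subtype.ext (by simp))
      (Prod.ext (by ext; simp) (by ext; simp)))

theorem univForm_quot (u v : D.L) : ((D.univForm u v).1 : g ⧸ D.relations) = D.quotForm u v := rfl

theorem Centre_ext {z z' : D.Centre} (h1 : (z.1 : g ⧸ D.relations) = z'.1)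
    (h2 : ∀ B, z.2.1 B = z'.2.1 B) (h3 : ∀ α, z.2.2 α = z'.2.2 α) : z = z' :=
  Prod.ext (Subtype.ext h1) (Prod.ext (LinearMap.ext h2) (LinearMap.ext h3))

/-- A form of parity `i + j + 1` vanishes on arguments of parities `i` and `j`, which is what the
gradation of a dual space asks of an evaluation. -/
theorem univForm_mem (i j : ZMod 2) (u : D.L) (hu : u ∈ part (V := D.L) i) (v : D.L)
    (hv : v ∈ part (V := D.L) j) : D.univForm u v ∈ part (V := D.Centre) (i + j) := by
  have hne : ∀ r : ZMod 2, r ≠ r + 1 := by decide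
  have hlx : ∀ (m k : ℤ) (r : ZMod 2), ∀ x ∈ D.eigen k, x ∈ part (V := g) r →
      D.univForm (D.lElt m) (D.xl k x) ∈ part (V := D.Centre) r := by
    intro m k r x hx hxr
    refine ⟨?_, fun B hB => ?_, fun α hα => ?_⟩
    · change D.quotForm _ _ ∈ (part (V := g) r).map D.relations.mkQ
      rw [quotForm, D.diagForm_lElt_xl _ _ _ _ hx]
      split_ifs
      · exact Submodule.smul_mem _ _ (Submodule.mem_map_of_mem hxr)
      · exact Submodule.zero_mem _
    · change D.diagForm _ _ _ _ _ = 0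
      rw [D.diagForm_lElt_xl _ _ _ _ hx]
      have := hB 0 r (by rw [zero_add]; exact hne r) _ D.del_mem _ (D.incl_mem hxr)
      simp [this]
    · change D.diagForm _ _ _ _ _ = 0
      rw [D.diagForm_lElt_xl _ _ _ _ hx]
      simp
  refine D.part_induction (p := fun u => D.univForm u v ∈ part (V := D.Centre) (i + j)) hu
    (by simp) (fun a b ha hb => ?_) (fun c a ha => ?_) ?_ ?_
  · rw [map_add]; exact Submodule.add_mem _ ha hb
  · rw [map_smul]; exact Submodule.smul_mem _ _ ha
  all_goals
    intro t x
    try intro hx hxi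
    refine D.part_induction (p := fun v => D.univForm _ v ∈ part (V := D.Centre) (i + j)) hv
      (by simp) (fun a b ha hb => ?_) (fun c a ha => ?_) ?_ ?_
    · rw [map_add]; exact Submodule.add_mem _ ha hb
    · rw [map_smul]; exact Submodule.smul_mem _ _ ha
    all_goals
      intro s y
      try intro hy hyi
  · subst s t
    refine ⟨?_, fun B hB => ?_, fun α hα => ?_⟩
    · change D.quotForm _ _ ∈ (part (V := g) (0 + 0)).map D.relations.mkQ
      rw [quotForm, D.diagForm_lElt_lElt]
      split_ifs <;> exact Submodule.zero_mem _
    · change D.diagForm _ _ _ _ _ = 0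
      rw [D.diagForm_lElt_lElt]
      have := hB 0 0 (by decide) _ D.del_mem _ D.del_mem
      simp [this]
    · change D.diagForm _ _ _ _ _ = 0
      rw [D.diagForm_lElt_lElt]
      simp
  · subst t
    rw [zero_add]
    exact hlx _ _ _ _ hy hyi
  · subst s
    rw [add_zero]
    have : D.univForm (D.xl t x) (D.lElt y) = -D.univForm (D.lElt y) (D.xl t x) :=
      D.Centre_ext (D.diagForm_xl_lElt _ _ _ _ hx) (fun B => D.diagForm_xl_lElt _ _ _ _ hx)
        fun α => D.diagForm_xl_lElt _ _ _ _ hx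
    rw [this]
    exact Submodule.neg_mem _ (hlx _ _ _ _ hx hxi)
  · refine ⟨?_, fun B hB => ?_, fun α hα => ?_⟩
    · change D.quotForm _ _ ∈ (part (V := g) (i + j)).map D.relations.mkQ
      rw [quotForm, D.diagForm_xl_xl _ _ _ hx hy]
      split_ifs
      · exact Submodule.smul_mem _ _ (Submodule.mem_map_of_mem (br_mem i j x hxi y hyi))
      · exact Submodule.zero_mem _
    · change D.diagForm _ _ _ _ _ = 0
      rw [D.diagForm_xl_xl _ _ _ hx hy]
      have h1 := hB 0 (i + j) (by rw [zero_add]; exact hne _) _ D.del_mem _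
        (D.incl_mem (br_mem i j x hxi y hyi))
      have h2 := hB i j (hne _) _ (D.incl_mem hxi) _ (D.incl_mem hyi)
      simp [h1, h2]
    · change D.diagForm _ _ _ _ _ = 0
      rw [D.diagForm_xl_xl _ _ _ hx hy]
      have h2 := hα i j (hne _) _ hxi _ hyi
      simp [h2]

/-- The universal cocycle. -/
def univCocycle : evenCocycles D.L D.Centre :=
  ⟨D.univForm, D.univForm_mem,
    fun i j x hx y hy => D.Centre_ext (D.quotForm_skew i j x hx y hy)
      (fun B => D.invFormCocycle_skew B.2.1 i j x hx y hy)
      fun α => D.baseCocycle_skew α.2 i j x hx y hy,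
    fun i j x hx y hy z => D.Centre_ext (D.quotForm_closed i j x hx y hy z)
      (fun B => D.invFormCocycle_closed B.2.1 i j x hx y hy z)
      fun α => D.baseCocycle_closed α.2 i j x hx y hy z⟩

theorem univCocycle_isExplicit : D.IsExplicit D.univCocycle where
  l_l_quot i j := Subtype.ext ((D.diagForm_lElt_lElt _ _ _ i j).trans (ite_self _))
  l_l_inv i j B := D.diagForm_lElt_lElt _ _ _ i j
  l_l_coc i j := LinearMap.ext fun α =>
    (D.diagForm_lElt_lElt _ _ _ i j).trans (ite_self _)
  l_x_quot i k x := by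
    rw [xt_eq_xl]
    change D.quotForm _ _ = _
    rw [quotForm, D.diagForm_lElt_xl _ _ _ i x.2, LinearMap.smul_apply]
  l_x_inv i k x B := by
    rw [xt_eq_xl]
    change D.diagForm _ _ _ _ _ = _
    rw [D.diagForm_lElt_xl _ _ _ i x.2]
    rfl
  l_x_coc i k x := by
    rw [xt_eq_xl]
    refine LinearMap.ext fun α => ?_
    change D.diagForm _ _ _ _ _ = _
    rw [D.diagForm_lElt_xl _ _ _ i x.2]
    exact ite_self _
  x_x_quot k l x y :=
    (congrArg₂ (fun u v => D.quotForm u v) (D.xt_eq_xl k x) (D.xt_eq_xl l y)).trans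
      (D.diagForm_xl_xl _ _ _ x.2 y.2)
  x_x_inv k l x y B :=
    (congrArg₂ (fun u v => D.invFormCocycle B.1 u v) (D.xt_eq_xl k x) (D.xt_eq_xl l y)).trans
      (D.diagForm_xl_xl _ _ _ x.2 y.2)
  x_x_coc k l x y α :=
    (congrArg₂ (fun u v => D.baseCocycle α.1 u v) (D.xt_eq_xl k x) (D.xt_eq_xl l y)).trans
      (D.diagForm_xl_xl _ _ _ x.2 y.2)

end TwistDatum

/-! ### The recursion along the loop degree for bilinear forms on a vector space -/

/-- `R` stands for a commutative algebra containing the two operators that insert `d` in a slot.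
Keeping it abstract lets the operators act as scalars in `exists_of_density_relations`. Surjectivity
of `d - 1` becomes injectivity of `1 - Y` on forms. -/
theorem exists_of_form_relations_aux {R V : Type*} [AddCommGroup V] [Module ℂ V] [CommRing R]
    [Algebra ℂ R] [Module R (V →ₗ[ℂ] V →ₗ[ℂ] ℂ)] [IsScalarTower ℂ R (V →ₗ[ℂ] V →ₗ[ℂ] ℂ)]
    (x' y' : R) (d : V →ₗ[ℂ] V)
    (hX : ∀ (B : V →ₗ[ℂ] V →ₗ[ℂ] ℂ) (x y : V), (x' • B) x y = B (d x) y)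
    (hY : ∀ (B : V →ₗ[ℂ] V →ₗ[ℂ] ℂ) (x y : V), (y' • B) x y = B x (d y))
    (hd : Function.Surjective (d - LinearMap.id : V →ₗ[ℂ] V)) (a : ℂ) (γ : ℤ → V →ₗ[ℂ] V →ₗ[ℂ] ℂ)
    (P Q : V →ₗ[ℂ] V →ₗ[ℂ] ℂ) (hP : ∀ x y, P (d x) y + P x (d y) = 0)
    (hQ : ∀ x y, Q (d x) y + Q x (d y) + Q x y = 0)
    (h : ∀ (m i : ℤ) (x y : V), γ (m + i) ((a + m) • x + (i : ℂ) • d x) y -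
      γ m x ((a + m + i) • y - (i : ℂ) • d y) =
      2 * ((i : ℂ) ^ 3 - i) * Q x y + ((i : ℂ) ^ 2 - i) * P x y) :
    (∀ x y, 2 * Q (d x) y + Q x y = 0) ∧ ∃ B α : V →ₗ[ℂ] V →ₗ[ℂ] ℂ,
      (∀ x y, B (d x) y = P x y) ∧ (∀ x y, B (d x) y + B x (d y) = 0) ∧
      (∀ x y, α (d x) y + α x (d y) = α x y) ∧
      ∀ (m : ℤ) (x y : V), γ m x y =
        (1 - 4 * (a + m) ^ 2) * Q x y + (a + m) * B x y + P x y + α x y := by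
  have hi : ∀ (i : ℤ) (B : V →ₗ[ℂ] V →ₗ[ℂ] ℂ) (x y : V),
      ((i : R) • B) x y = (i : ℂ) * B x y := by
    intro i B x y
    rw [Int.cast_smul_eq_zsmul]; simp
  have hext : ∀ B B' : V →ₗ[ℂ] V →ₗ[ℂ] ℂ, (∀ x y, B x y = B' x y) → B = B' := fun _ _ h =>
    LinearMap.ext₂ h
  have hc : ∀ (c : ℂ) (B : V →ₗ[ℂ] V →ₗ[ℂ] ℂ) (x y : V),
      ((algebraMap ℂ R c) • B) x y = c * B x y := fun c B x y => by
    rw [algebraMap_smul]; rfl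
  have key := exists_of_density_relations (R := R) (M := V →ₗ[ℂ] V →ₗ[ℂ] ℂ) ?_ x' y' (algebraMap ℂ _ a)
    ?_ γ P Q ?_ ?_ ?_
  · obtain ⟨k1, B, α, k2, k3, k4, k5⟩ := key
    refine ⟨fun x y => ?_, B, α, fun x y => ?_, fun x y => ?_, fun x y => ?_, fun m x y => ?_⟩
    · have := LinearMap.congr_fun₂ k1 x y
      simpa [add_smul, mul_smul, hX, ofNat_smul_eq_nsmul] using this
    · rw [← hX, k2]
    · have := LinearMap.congr_fun₂ k3 x y
      simpa [add_smul, mul_smul, hX, hY] using this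
    · have := LinearMap.congr_fun₂ k4 x y
      simpa [add_smul, mul_smul, hX, hY] using this
    · have := LinearMap.congr_fun₂ (k5 m) x y
      have h4 : algebraMap ℂ R 4 = 4 := map_ofNat _ _
      rw [show (1 - 4 * (algebraMap ℂ R a + m) ^ 2) =
        algebraMap ℂ R (1 - 4 * (a + m) ^ 2) by simp [h4],
        show (algebraMap ℂ R a + m) =
        algebraMap ℂ R (a + m) by simp] at this
      simpa only [hc, LinearMap.add_apply] using this
  · intro N hN B hB
    refine hext _ _ fun x y => ?_
    have := LinearMap.congr_fun₂ hB x y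
    rw [Nat.cast_smul_eq_nsmul] at this
    simpa [hN] using this
  · intro B hB
    refine hext _ _ fun x y => ?_
    obtain ⟨y, rfl⟩ := hd y
    have := LinearMap.congr_fun₂ hB x y
    simp only [sub_smul, one_smul, LinearMap.sub_apply, hY, LinearMap.zero_apply] at this
    simp only [LinearMap.sub_apply, map_sub, LinearMap.id_apply, LinearMap.zero_apply]
    linear_combination -this
  · refine hext _ _ fun x y => ?_
    simpa [add_smul, hX, hY] using hP x y
  · refine hext _ _ fun x y => ?_
    simpa [add_smul, hX, hY] using hQ x y
  · intro m i
    refine hext _ _ fun x y => ?_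
    have := h m i x y
    have h2 : algebraMap ℂ R 2 = 2 := map_ofNat _ _
    rw [show (2 * ((i : R) ^ 3 - i)) =
        algebraMap ℂ R (2 * ((i : ℂ) ^ 3 - i)) by simp [h2],
      show ((i : R) ^ 2 - i) =
        algebraMap ℂ R ((i : ℂ) ^ 2 - i) by simp]
    simp only [add_smul, sub_smul, mul_smul, LinearMap.add_apply, LinearMap.sub_apply, hc, hi,
      hX, hY]
    simp only [map_add, map_sub, map_smul, LinearMap.add_apply, LinearMap.smul_apply,
      smul_eq_mul] at this
    linear_combination this

/-- The operators `X` and `Y` act on different slots and therefore commute, so the algebra they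
generate can serve as the commutative ring of scalars. -/
theorem exists_of_form_relations {V : Type*} [AddCommGroup V] [Module ℂ V] (d : V →ₗ[ℂ] V)
    (hd : Function.Surjective (d - LinearMap.id : V →ₗ[ℂ] V)) (a : ℂ) (γ : ℤ → V →ₗ[ℂ] V →ₗ[ℂ] ℂ)
    (P Q : V →ₗ[ℂ] V →ₗ[ℂ] ℂ) (hP : ∀ x y, P (d x) y + P x (d y) = 0)
    (hQ : ∀ x y, Q (d x) y + Q x (d y) + Q x y = 0)
    (h : ∀ (m i : ℤ) (x y : V), γ (m + i) ((a + m) • x + (i : ℂ) • d x) y -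
      γ m x ((a + m + i) • y - (i : ℂ) • d y) =
      2 * ((i : ℂ) ^ 3 - i) * Q x y + ((i : ℂ) ^ 2 - i) * P x y) :
    (∀ x y, 2 * Q (d x) y + Q x y = 0) ∧ ∃ B α : V →ₗ[ℂ] V →ₗ[ℂ] ℂ,
      (∀ x y, B (d x) y = P x y) ∧ (∀ x y, B (d x) y + B x (d y) = 0) ∧
      (∀ x y, α (d x) y + α x (d y) = α x y) ∧
      ∀ (m : ℤ) (x y : V), γ m x y =
        (1 - 4 * (a + m) ^ 2) * Q x y + (a + m) * B x y + P x y + α x y := by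
  let X : Module.End ℂ (V →ₗ[ℂ] V →ₗ[ℂ] ℂ) := LinearMap.lcomp ℂ (V →ₗ[ℂ] ℂ) d
  let Y : Module.End ℂ (V →ₗ[ℂ] V →ₗ[ℂ] ℂ) :=
    { toFun := fun B => B.compl₂ d, map_add' := fun _ _ => rfl, map_smul' := fun _ _ => rfl }
  have hX : ∀ B x y, X B x y = B (d x) y := fun _ _ _ => rfl
  have hY : ∀ B x y, Y B x y = B x (d y) := fun _ _ _ => rfl
  have hXY : X * Y = Y * X := by ext B x y; rfl
  obtain ⟨R, hR, hXR, hYR⟩ : ∃ R : Subalgebra ℂ (Module.End ℂ (V →ₗ[ℂ] V →ₗ[ℂ] ℂ)),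
      (∀ p ∈ R, ∀ q ∈ R, p * q = q * p) ∧ X ∈ R ∧ Y ∈ R :=
    ⟨Algebra.adjoin ℂ {X, Y}, fun p hp q hq => by
      have := Algebra.isMulCommutative_adjoin ℂ (s := {X, Y}) (by
        rintro x (rfl | rfl) y (rfl | rfl)
        exacts [rfl, hXY, hXY.symm, rfl])
      exact congrArg Subtype.val (mul_comm' (⟨p, hp⟩ : Algebra.adjoin ℂ {X, Y}) ⟨q, hq⟩),
      Algebra.subset_adjoin (by simp), Algebra.subset_adjoin (by simp)⟩
  let x' : R := ⟨X, hXR⟩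
  let y' : R := ⟨Y, hYR⟩
  let _ : CommRing R := { (inferInstance : Ring R) with
    mul_comm := fun p q => Subtype.ext (hR p p.2 q q.2) }
  exact exists_of_form_relations_aux x' y' d (fun _ _ _ => rfl) (fun _ _ _ => rfl) hd a γ P
    Q hP hQ h

/-! ### Normalization of scalar cocycles -/

namespace TwistDatum

variable {g : Type u} [AddCommGroup g] [Module ℂ g] [LieSuperalgebra g] (D : TwistDatum g)

/-- The assumption on the eigenvalue `1` enters all later arguments in this form. -/
theorem bijective_d_sub_id [FiniteDimensional ℂ g] (hd : ¬ Module.End.HasEigenvalue D.d 1) :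
    Function.Bijective (D.d - LinearMap.id : g →ₗ[ℂ] g) := by
  have hinj : Function.Injective (D.d - LinearMap.id : g →ₗ[ℂ] g) := by
    rw [← LinearMap.ker_eq_bot]
    by_contra h
    refine hd ?_
    rw [Module.End.hasEigenvalue_iff, Module.End.eigenspace_def, one_smul]
    exact h
  exact ⟨hinj, LinearMap.surjective_of_injective hinj⟩

theorem exists_functional (c : ℤ → ℂ) (ψ : ℤ → g →ₗ[ℂ] ℂ) : ∃ f : D.L →ₗ[ℂ] ℂ,
    (∀ i, f (D.lElt i) = c i) ∧ ∀ k x, f (D.xl k x) = ψ k (D.eigProj k x) := by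
  refine ⟨Finsupp.linearCombination ℂ c ∘ₗ LinearMap.fst ℂ (ℤ →₀ ℂ) D.loop +
    Finsupp.lsum ℂ ψ ∘ₗ D.loop.subtype ∘ₗ LinearMap.snd ℂ (ℤ →₀ ℂ) D.loop, fun i => ?_,
    fun k x => ?_⟩
  · change Finsupp.linearCombination ℂ c (Finsupp.single i 1) + Finsupp.lsum ℂ ψ 0 = c i
    simp
  · change Finsupp.linearCombination ℂ c 0 + Finsupp.lsum ℂ ψ (Finsupp.single k (D.eigProj k x)) = _
    simp

end TwistDatum

section

variable {L : Type*} [AddCommGroup L] [Module ℂ L] [LieSuperalgebra L]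
variable {M : Type*} [AddCommGroup M] [Module ℂ M]

theorem IsSuperClosed.of_even {β : L →ₗ[ℂ] L →ₗ[ℂ] M} (h : IsSuperClosed β) {u : L}
    (hu : u ∈ part (V := L) 0) (v w : L) : β u (br v w) = β (br u v) w + β v (br u w) := by
  obtain ⟨a, ha, b, hb, rfl⟩ := exists_decomp v
  have h0 := h 0 0 u hu a ha w
  have h1 := h 0 1 u hu b hb w
  rw [koszul_zero_left, one_smul] at h0 h1
  simp only [map_add, LinearMap.add_apply, h0, h1]
  abel

theorem IsSuperSkew.of_even {β : L →ₗ[ℂ] L →ₗ[ℂ] M} (h : IsSuperSkew β) {u : L}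
    (hu : u ∈ part (V := L) 0) (v : L) : β u v = -β v u := by
  obtain ⟨a, ha, b, hb, rfl⟩ := exists_decomp v
  have h0 := h 0 0 u hu a ha
  have h1 := h 0 1 u hu b hb
  rw [koszul_zero_left, one_smul] at h0 h1
  simp only [map_add, LinearMap.add_apply, h0, h1]
  abel

theorem isSuperSkew_coboundary (f : L →ₗ[ℂ] M) : IsSuperSkew ((br (L := L)).compr₂ f) := by
  intro i j x hx y hy
  simp only [LinearMap.compr₂_apply]
  rw [br_skew i j x hx y hy, map_neg, map_smul]

theorem isSuperClosed_coboundary (f : L →ₗ[ℂ] M) : IsSuperClosed ((br (L := L)).compr₂ f) := by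
  intro i j x hx y hy z
  simp only [LinearMap.compr₂_apply]
  rw [br_jacobi i j x hx y hy z, map_add, map_smul]

theorem IsSuperSkew.sub {β β' : L →ₗ[ℂ] L →ₗ[ℂ] M} (h : IsSuperSkew β) (h' : IsSuperSkew β') :
    IsSuperSkew (β - β') := by
  intro i j x hx y hy
  simp only [LinearMap.sub_apply]
  rw [h i j x hx y hy, h' i j x hx y hy]
  module

theorem IsSuperClosed.sub {β β' : L →ₗ[ℂ] L →ₗ[ℂ] M} (h : IsSuperClosed β)
    (h' : IsSuperClosed β') : IsSuperClosed (β - β') := by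
  intro i j x hx y hy z
  simp only [LinearMap.sub_apply]
  rw [h i j x hx y hy, h' i j x hx y hy]
  module

end

namespace TwistDatum

variable {g : Type u} [AddCommGroup g] [Module ℂ g] [LieSuperalgebra g] (D : TwistDatum g)

theorem br_lElt_zero_xl (k : ℤ) (x : g) :
    br (D.lElt 0) (D.xl k x) = ((k : ℂ) / D.n) • D.xl k x := by
  rw [br_lElt_xl]; simp

theorem br_lElt_xl_neg (i j : ℤ) (x : g) : br (D.lElt j) (D.xl (-(D.n * (i + j))) x) =
    D.xl (-(D.n * i)) ((j : ℂ) • D.d x - ((i : ℂ) + j) • x) := by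
  have hn := D.n_ne
  rw [br_lElt_xl]
  congr 2
  · ring
  · push_cast
    rw [show -((D.n : ℂ) * (i + j)) / D.n = -(i + j) by field_simp]
    module

/-- Every cocycle is cohomologous to one that is normalized at `𝔩_0` and `𝔩_1`. -/
theorem exists_normalization [FiniteDimensional ℂ g] (hd : ¬ Module.End.HasEigenvalue D.d 1)
    {β : D.L →ₗ[ℂ] D.L →ₗ[ℂ] ℂ} (hs : IsSuperSkew β) (hc : IsSuperClosed β) :
    ∃ f : D.L →ₗ[ℂ] ℂ, (∀ w, β (D.lElt 0) w = f (br (D.lElt 0) w)) ∧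
      β (D.lElt 1) (D.lElt (-1)) = f (br (D.lElt 1) (D.lElt (-1))) ∧
      ∀ x, β (D.lElt 1) (D.xl (-D.n) x) = f (br (D.lElt 1) (D.xl (-D.n) x)) := by
  have hn := D.n_ne
  have hbij := D.bijective_d_sub_id hd
  let T : g ≃ₗ[ℂ] g := LinearEquiv.ofBijective _ hbij
  have hT : ∀ x, T x = D.d x - x := fun _ => rfl
  -- Write the coefficient as `d y - y`, so that the element is `[𝔩_1, y t^{-1}]`. In the cocycle
  -- identity with `𝔩_0` the two terms carry the degrees `1` and `-1` and cancel.
  have h0 : ∀ x, β (D.lElt 0) (D.xl 0 x) = 0 := by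
    intro x
    obtain ⟨y, rfl⟩ := T.surjective x
    have e := hc.of_even (D.lElt_mem 0) (D.lElt 1) (D.xl (-(D.n * 1)) y)
    have e2 := D.br_lElt_xl_neg 0 1 y
    rw [Int.cast_one, Int.cast_zero, one_smul, zero_add, zero_add, one_smul, ← hT, mul_zero,
      neg_zero] at e2
    rw [e2, br_lElt_lElt, br_lElt_zero_xl] at e
    rw [e]
    have : ((-(D.n * 1) : ℤ) : ℂ) / D.n = -1 := by push_cast; field_simp
    rw [this]
    simp
  -- In nonzero degree, `f` is `β(𝔩_0, ·)` divided by the degree. In degree zero it is prescribed by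
  -- the values on `[𝔩_1, 𝔩_{-1}] = -2 𝔩_0` and on `[𝔩_1, y t^{-1}] = (d - 1) y`, where `d - 1` is
  -- inverted.
  obtain ⟨f, hf1, hf2⟩ := D.exists_functional
    (fun i => if i = 0 then -(1 / 2) * β (D.lElt 1) (D.lElt (-1)) else
      (i : ℂ)⁻¹ * β (D.lElt 0) (D.lElt i))
    (fun k => if k = 0 then (β (D.lElt 1) ∘ₗ D.xl (-D.n)) ∘ₗ T.symm.toLinearMap else
      ((k : ℂ) / D.n)⁻¹ • (β (D.lElt 0) ∘ₗ D.xl k))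
  refine ⟨f, fun w => ?_, ?_, fun x => ?_⟩
  · refine LinearMap.congr_fun (f := β (D.lElt 0)) (g := f ∘ₗ br (D.lElt 0))
      (D.L_hom_ext (fun m => ?_) fun k x hx => ?_) w
    · rw [LinearMap.comp_apply, br_lElt_lElt, map_smul, zero_add, hf1]
      split_ifs with h
      · subst h
        have := hs.of_even (D.lElt_mem 0) (D.lElt 0)
        simp only [Int.cast_zero, sub_zero, zero_smul]
        linear_combination (1 / 2) * this
      · have hm : (m : ℂ) ≠ 0 := Int.cast_ne_zero.2 h
        simp only [Int.cast_zero, sub_zero, smul_eq_mul]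
        field_simp
    · rw [LinearMap.comp_apply, br_lElt_zero_xl, map_smul, hf2, D.eigProj_self hx]
      split_ifs with h
      · subst h; rw [h0]; simp
      · have hm : (k : ℂ) / D.n ≠ 0 := div_ne_zero (Int.cast_ne_zero.2 h) hn
        rw [LinearMap.smul_apply, LinearMap.comp_apply, smul_smul, mul_inv_cancel₀ hm, one_smul]
  · rw [br_lElt_lElt, map_smul, add_neg_cancel, hf1, if_pos rfl]
    push_cast
    rw [smul_eq_mul]
    ring
  · have e := D.br_lElt_xl_neg 0 1 x
    rw [Int.cast_one, Int.cast_zero, one_smul, zero_add, zero_add, one_smul, ← hT, mul_zero,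
      neg_zero, mul_one] at e
    rw [e, hf2, if_pos rfl, LinearMap.comp_apply, LinearMap.comp_apply]
    have e3 : D.eigProj 0 (T x) = T (D.eigProj 0 x) := by
      rw [hT, hT, map_sub, eigProj_d]
    have e4 : D.xl (-D.n) (D.eigProj 0 x) = D.xl (-D.n) x := by
      rw [← D.eigProj_congr (k := -D.n) ⟨-1, by ring⟩, xl_eigProj]
    rw [e3, LinearEquiv.coe_coe, LinearEquiv.symm_apply_apply, e4]

/-- A scalar cocycle that is normalized at `𝔩_0` and `𝔩_1`. -/
structure IsNormalized (β : D.L →ₗ[ℂ] D.L →ₗ[ℂ] ℂ) : Prop where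
  skew : IsSuperSkew β
  closed : IsSuperClosed β
  zero : ∀ w, β (D.lElt 0) w = 0
  one_neg_one : β (D.lElt 1) (D.lElt (-1)) = 0
  one : ∀ x, β (D.lElt 1) (D.xl (-D.n) x) = 0

/-! ### Values of a normalized cocycle with an argument in the Witt algebra -/

namespace IsNormalized

variable {D} {β : D.L →ₗ[ℂ] D.L →ₗ[ℂ] ℂ} (hβ : D.IsNormalized β)
include hβ

/-- As `β(𝔩_0, ·) = 0`, the cocycle identity with `𝔩_0` leaves only the total weight times the
value. -/
theorem eq_zero_of_weight {u v : D.L} {a b : ℂ} (hu : br (D.lElt 0) u = a • u)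
    (hv : br (D.lElt 0) v = b • v) (hab : a + b ≠ 0) : β u v = 0 := by
  have h := hβ.closed.of_even (D.lElt_mem 0) u v
  rw [hβ.zero, hu, hv, map_smul, map_smul, LinearMap.smul_apply, ← add_smul, eq_comm,
    smul_eq_zero] at h
  exact h.resolve_left hab

/-- The values in total degree zero satisfy the Witt recursion with `D = -1`. The condition `D p =
0` then removes the quadratic solution, and only the Virasoro cocycle is left. -/
theorem lElt_lElt : ∃ c : ℂ, ∀ i j : ℤ, β (D.lElt i) (D.lElt j) =
    if i + j = 0 then ((i : ℂ) ^ 3 - i) / 12 * c else 0 := by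
  have key := exists_of_witt_relations (-LinearMap.id : ℂ →ₗ[ℂ] ℂ)
    (fun i => β (D.lElt i) (D.lElt (-i))) (fun i j => ?_) (hβ.zero _) hβ.one_neg_one
  · obtain ⟨p, q, hp, -, h⟩ := key
    refine ⟨q, fun i j => ?_⟩
    split_ifs with hij
    · rw [show j = -i by omega, h i]
      have : p = 0 := by simpa using hp
      rw [this, smul_zero, add_zero, smul_eq_mul]
    · refine hβ.eq_zero_of_weight (a := i) (b := j) ?_ ?_ (by exact_mod_cast hij)
      · rw [br_lElt_lElt, zero_add, Int.cast_zero, sub_zero]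
      · rw [br_lElt_lElt, zero_add, Int.cast_zero, sub_zero]
  · have e := hβ.closed.of_even (D.lElt_mem i) (D.lElt j) (D.lElt (-(i + j)))
    rw [br_lElt_lElt, br_lElt_lElt, br_lElt_lElt, show j + -(i + j) = -i by ring,
      show i + -(i + j) = -j by ring] at e
    push_cast at e
    simp only [map_smul, LinearMap.smul_apply, smul_eq_mul, LinearMap.neg_apply,
      LinearMap.id_apply] at e ⊢
    linear_combination e

/-- The functionals `x ↦ β(𝔩_i, x t^{-i})` satisfy the Witt recursion in the dual of `g`, with `D`
the transpose of `d`. -/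
theorem lElt_xl : ∃ p q : g →ₗ[ℂ] ℂ, (∀ x, p (D.d x) = 0) ∧ (∀ x, q (D.d x) = -q x) ∧
    (∀ x, p (D.σ x) = p x) ∧ (∀ x, q (D.σ x) = q x) ∧
    ∀ i k : ℤ, ∀ x ∈ D.eigen k, β (D.lElt i) (D.xl k x) =
      if D.n * i + k = 0 then ((i : ℂ) ^ 3 - i) / 12 * q x + ((i : ℂ) ^ 2 - i) * p x else 0 := by
  have hn := D.n_ne
  let φ : ℤ → Module.Dual ℂ g := fun i => β (D.lElt i) ∘ₗ D.xl (-(D.n * i))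
  have key := exists_of_witt_relations
    (LinearMap.lcomp ℂ ℂ D.d : Module.Dual ℂ g →ₗ[ℂ] Module.Dual ℂ g) φ (fun i j => ?_)
    (LinearMap.ext fun x => hβ.zero _) (LinearMap.ext fun x => ?_)
  · obtain ⟨p, q, hp, hq, h⟩ := key
    have hσ : ∀ i x, φ i (D.σ x) = φ i x := by
      intro i x
      change β _ (D.xl _ _) = β _ (D.xl _ _)
      rw [← xl_eigProj, eigProj_σ, map_smul, xl_eigProj,
        show -(D.n * i) = 0 + D.n * (-i) by ring, ω_zpow_add_mul, zpow_zero, one_smul]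
    -- The values at `2` and `-1` recover `p` and `q` from the `φ i`. All `φ i` are `σ`-invariant
    -- since they see only the component in `g_[0]`, so `p` and `q` are invariant too.
    have h2 : ∀ x, φ 2 x = (1 / 2) * q x + 2 * p x := by
      intro x
      rw [h 2]
      simp only [LinearMap.add_apply, LinearMap.smul_apply, smul_eq_mul]
      norm_num
    have hm1 : ∀ x, φ (-1) x = 2 * p x := by
      intro x
      rw [h (-1)]
      simp only [LinearMap.add_apply, LinearMap.smul_apply, smul_eq_mul]
      norm_num
    have hpσ : ∀ x, p (D.σ x) = p x := by
      intro x
      linear_combination (1 / 2) * (hσ (-1) x - hm1 (D.σ x) + hm1 x)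
    refine ⟨p, q, fun x => LinearMap.congr_fun hp x, fun x => LinearMap.congr_fun hq x, hpσ,
      fun x => ?_, fun i k x hx => ?_⟩
    · linear_combination 2 * (hσ 2 x - h2 (D.σ x) + h2 x - 2 * hpσ x)
    · split_ifs with hik
      · have := LinearMap.congr_fun (h i) x
        rw [show k = -(D.n * i) by omega]
        simpa [φ] using this
      · refine hβ.eq_zero_of_weight (a := i) (b := k / D.n) ?_ (D.br_lElt_zero_xl k x) ?_
        · rw [br_lElt_lElt, zero_add, Int.cast_zero, sub_zero]
        · intro h
          have h' : (D.n : ℂ) * i + k = 0 := by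
            field_simp at h; linear_combination h
          exact hik (by exact_mod_cast h')
  · refine LinearMap.ext fun x => ?_
    have e := hβ.closed.of_even (D.lElt_mem i) (D.lElt j) (D.xl (-(D.n * (i + j))) x)
    have e2 := D.br_lElt_xl_neg j i x
    rw [add_comm j i] at e2
    rw [br_lElt_xl_neg, e2, br_lElt_lElt] at e
    simp only [map_smul, map_sub, LinearMap.smul_apply, smul_eq_mul, LinearMap.add_apply,
      LinearMap.sub_apply, LinearMap.lcomp_apply] at e ⊢
    change _ = (_ : ℂ) * β _ _
    change (j : ℂ) * β _ _ - _ * β _ _ - _ * β _ _ + _ * β _ _ = _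
    linear_combination e
  · change β _ (D.xl (-(D.n * 1)) x) = 0
    rw [mul_one]; exact hβ.one x

end IsNormalized

/-! ### `σ`-invariant bilinear forms -/

/-- Invariance gives `ω^{km} b(x, σ^m y) = b(x, y)` for `x` in `g_[k]`; the average over `m` is the
projection onto `g_[-k]`. -/
theorem apply_eigProj_of_invariant {b : g →ₗ[ℂ] g →ₗ[ℂ] ℂ}
    (hb : ∀ x y, b (D.σ x) (D.σ y) = b x y) {k : ℤ} {x : g} (hx : x ∈ D.eigen k) (y : g) :
    b x (D.eigProj (-k) y) = b x y := by
  have h : ∀ m : ℕ, (D.ω ^ k) ^ m * b x ((D.σ.toLinearMap ^ m) y) = b x y := by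
    intro m
    induction m with
    | zero => simp
    | succ m ih =>
      rw [← ih, ← hb x ((D.σ.toLinearMap ^ m) y), D.mem_eigen.1 hx, map_smul,
        LinearMap.smul_apply, smul_eq_mul, pow_succ, mul_assoc, pow_succ']
      rfl
  rw [eigProj_apply, neg_neg, map_smul, map_sum]
  simp only [map_smul, smul_eq_mul, h, Finset.sum_const, Finset.card_range, nsmul_eq_mul]
  rw [← mul_assoc, inv_mul_cancel₀ D.n_ne, one_mul]

theorem eq_zero_of_invariant {b : g →ₗ[ℂ] g →ₗ[ℂ] ℂ} (hb : ∀ x y, b (D.σ x) (D.σ y) = b x y)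
    {k l : ℤ} {x y : g} (hx : x ∈ D.eigen k) (hy : y ∈ D.eigen l) (hkl : ¬ (D.n : ℤ) ∣ k + l) :
    b x y = 0 := by
  rw [← D.apply_eigProj_of_invariant hb hx, D.eigProj_of_mem hy, if_neg, map_zero]
  rwa [show l - -k = k + l by ring]

theorem functional_eq_zero_of_invariant {p : g →ₗ[ℂ] ℂ} (hp : ∀ x, p (D.σ x) = p x)
    {k : ℤ} {x : g} (hx : x ∈ D.eigen k) (hk : ¬ (D.n : ℤ) ∣ k) : p x = 0 := by
  have h := hp x
  rw [D.mem_eigen.1 hx, map_smul, smul_eq_mul] at h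
  have h1 : D.ω ^ k ≠ 1 := fun h' => hk ((D.ω_primitive.zpow_eq_one_iff_dvd k).1 h')
  have h2 : (D.ω ^ k - 1) * p x = 0 := by linear_combination h
  exact (mul_eq_zero.1 h2).resolve_left (sub_ne_zero.2 h1)

theorem sum_eigProj_of_invariant {b : g →ₗ[ℂ] g →ₗ[ℂ] ℂ}
    (hb : ∀ x y, b (D.σ x) (D.σ y) = b x y) (x y : g) :
    ∑ k ∈ Finset.range D.n, b (D.eigProj k x) (D.eigProj (-k) y) = b x y := by
  simp only [D.apply_eigProj_of_invariant hb (D.eigProj_mem _ x)]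
  rw [← LinearMap.sum_apply, ← map_sum, sum_eigProj]

theorem eigProj_eigProj (k : ℤ) (x : g) : D.eigProj k (D.eigProj k x) = D.eigProj k x :=
  D.eigProj_self (D.eigProj_mem k x)

/-- The sum over `k` of the components on `g_[k] × g_[-k]` of the forms `b_k`. -/
def glueForm (b : ℤ → g →ₗ[ℂ] g →ₗ[ℂ] ℂ) : g →ₗ[ℂ] g →ₗ[ℂ] ℂ :=
  ∑ k ∈ Finset.range D.n, (b k).compl₁₂ (D.eigProj k) (D.eigProj (-k))

theorem glueForm_apply (b : ℤ → g →ₗ[ℂ] g →ₗ[ℂ] ℂ) (x y : g) : D.glueForm b x y =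
    ∑ k ∈ Finset.range D.n, b k (D.eigProj k x) (D.eigProj (-k) y) := by
  simp [glueForm, LinearMap.sum_apply]

theorem glueForm_σ (b : ℤ → g →ₗ[ℂ] g →ₗ[ℂ] ℂ) (x y : g) :
    D.glueForm b (D.σ x) (D.σ y) = D.glueForm b x y := by
  rw [glueForm_apply, glueForm_apply]
  refine Finset.sum_congr rfl fun k _ => ?_
  rw [eigProj_σ, eigProj_σ, map_smul, map_smul, LinearMap.smul_apply, smul_smul,
    ← zpow_add₀ D.ω_ne, neg_add_cancel, zpow_zero, one_smul]

/-- The sum runs over the representatives `0 ≤ k < n`, hence the residue on the right. -/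
theorem glueForm_of_mem (b : ℤ → g →ₗ[ℂ] g →ₗ[ℂ] ℂ) {k : ℤ} {x y : g} (hx : x ∈ D.eigen k)
    (hy : y ∈ D.eigen (-k)) : D.glueForm b x y = b (k % D.n) x y := by
  have hn : (0 : ℤ) < D.n := Int.natCast_pos.2 D.n_pos
  have h0 := Int.emod_nonneg k hn.ne'
  have h1 := Int.emod_lt_of_pos k hn
  have hdvd : (D.n : ℤ) ∣ k - k % D.n := Int.dvd_self_sub_emod
  rw [glueForm_apply, Finset.sum_eq_single (k % D.n).toNat]
  · rw [Int.toNat_of_nonneg h0, D.eigProj_of_mem hx, D.eigProj_of_mem hy, if_pos hdvd, if_pos]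
    rw [show -k - -(k % D.n) = -(k - k % D.n) by ring]
    exact (dvd_neg).2 hdvd
  · intro m hm hne
    rw [D.eigProj_of_mem hx, if_neg, map_zero, LinearMap.zero_apply]
    intro h
    have hm' := Finset.mem_range.1 hm
    have : k % D.n = m := by
      rw [Int.emod_eq_emod_iff_emod_sub_eq_zero.2 (Int.emod_eq_zero_of_dvd h)]
      exact Int.emod_eq_of_lt (by omega) (by omega)
    omega
  · intro h
    exact absurd (Finset.mem_range.2 (by omega)) h

/-! ### Values of a normalized cocycle on the loop algebra -/

namespace IsNormalized

variable {D} {β : D.L →ₗ[ℂ] D.L →ₗ[ℂ] ℂ}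

/-- For a fixed residue `k`, the cocycle identity for `𝔩_i`, `x t^{k/n+m}` and `y t^{-(k/n+m+i)}` is
the recursion of `exists_of_form_relations`. The eigenprojections extend the forms given by `p` and
`q` from `g_[k] × g_[-k]` to all of `g`. -/
theorem exists_forms [FiniteDimensional ℂ g] (hβ : D.IsNormalized β)
    (hd : ¬ Module.End.HasEigenvalue D.d 1) {p q : g →ₗ[ℂ] ℂ} (hp : ∀ x, p (D.d x) = 0)
    (hq : ∀ x, q (D.d x) = -q x)
    (h : ∀ i k : ℤ, ∀ x ∈ D.eigen k, β (D.lElt i) (D.xl k x) =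
      if D.n * i + k = 0 then ((i : ℂ) ^ 3 - i) / 12 * q x + ((i : ℂ) ^ 2 - i) * p x else 0)
    (k : ℤ) :
    (∀ x ∈ D.eigen k, ∀ y ∈ D.eigen (-k), 2 * q (br (D.d x) y) + q (br x y) = 0) ∧
    ∃ B α : g →ₗ[ℂ] g →ₗ[ℂ] ℂ,
      (∀ x ∈ D.eigen k, ∀ y ∈ D.eigen (-k), B (D.d x) y = p (br x y)) ∧
      (∀ x y, B (D.d x) y + B x (D.d y) = 0) ∧
      (∀ x y, α (D.d x) y + α x (D.d y) = α x y) ∧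
      ∀ (m : ℤ), ∀ x ∈ D.eigen k, ∀ y ∈ D.eigen (-k),
        β (D.xl (k + D.n * m) x) (D.xl (-(k + D.n * m)) y) =
          (1 - 4 * ((k : ℂ) / D.n + m) ^ 2) / 24 * q (br x y) + ((k : ℂ) / D.n + m) * B x y +
            p (br x y) + α x y := by
  have hn := D.n_ne
  let b : (g →ₗ[ℂ] ℂ) → g →ₗ[ℂ] g →ₗ[ℂ] ℂ := fun r =>
    ((br (L := g)).compr₂ r).compl₁₂ (D.eigProj k) (D.eigProj (-k))
  have hb : ∀ r x y, b r x y = r (br (D.eigProj k x) (D.eigProj (-k) y)) := fun _ _ _ => rfl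
  have hbm : ∀ r, ∀ x ∈ D.eigen k, ∀ y ∈ D.eigen (-k), b r x y = r (br x y) := by
    intro r x hx y hy
    rw [hb, D.eigProj_self hx, D.eigProj_self hy]
  -- The factor `1/24` is chosen so that `2(i³ - i) Q` is the value `(i³ - i)/12 · q([x, y])`.
  have key := exists_of_form_relations D.d (D.bijective_d_sub_id hd).2 ((k : ℂ) / D.n)
    (fun m => β.compl₁₂ (D.xl (k + D.n * m)) (D.xl (-(k + D.n * m)))) (b p)
    ((1 / 24 : ℂ) • b q) (fun x y => ?_) (fun x y => ?_) (fun m i x y => ?_)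
  · obtain ⟨h1, B, α, h2, h3, h4, h5⟩ := key
    refine ⟨fun x hx y hy => ?_, B, α, fun x hx y hy => ?_, h3, h4, fun m x hx y hy => ?_⟩
    · have := h1 x y
      simp only [LinearMap.smul_apply, smul_eq_mul, hbm q x hx y hy,
        hbm q _ (D.d_mem_eigen hx) y hy] at this
      linear_combination 24 * this
    · rw [h2, hbm p x hx y hy]
    · have := h5 m x y
      simp only [LinearMap.smul_apply, smul_eq_mul, hbm q x hx y hy, hbm p x hx y hy,
        LinearMap.compl₁₂_apply] at this
      rw [this]
      ring
  · rw [hb, hb, eigProj_d, eigProj_d, ← map_add, ← D.d_br, hp]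
  · simp only [LinearMap.smul_apply, smul_eq_mul, hb]
    have := hq (br (D.eigProj k x) (D.eigProj (-k) y))
    rw [D.d_br, map_add] at this
    rw [eigProj_d, eigProj_d]
    linear_combination (1 / 24) * this
  · have e := hβ.closed.of_even (D.lElt_mem i) (D.xl (k + D.n * m) x)
      (D.xl (-(k + D.n * (m + i))) y)
    rw [br_xl_xl, br_lElt_xl, br_lElt_xl, h _ _ _
      (D.br_mem_eigen (D.eigProj_mem _ x) (D.eigProj_mem _ y)), if_pos (by ring),
      show k + D.n * m + D.n * i = k + D.n * (m + i) by ring,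
      show -(k + D.n * (m + i)) + D.n * i = -(k + D.n * m) by ring,
      D.eigProj_congr (k := k + D.n * m) (l := k) ⟨m, by ring⟩,
      D.eigProj_congr (k := -(k + D.n * (m + i))) (l := -k) ⟨-(m + i), by ring⟩] at e
    have e1 : ((k + D.n * m : ℤ) : ℂ) / D.n = k / D.n + m := by push_cast; field_simp
    have e2 : ((-(k + D.n * (m + i)) : ℤ) : ℂ) / D.n = -(k / D.n + m + i) := by
      push_cast; field_simp; ring
    rw [e1, e2] at e
    simp only [LinearMap.smul_apply, smul_eq_mul, hb, LinearMap.compl₁₂_apply, map_add, map_sub,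
      map_smul, LinearMap.add_apply] at e ⊢
    linear_combination -e

/-- The values of a normalized cocycle on the loop algebra. -/
theorem xl_xl [FiniteDimensional ℂ g] (hβ : D.IsNormalized β)
    (hd : ¬ Module.End.HasEigenvalue D.d 1) {p q : g →ₗ[ℂ] ℂ} (hp : ∀ x, p (D.d x) = 0)
    (hq : ∀ x, q (D.d x) = -q x) (hpσ : ∀ x, p (D.σ x) = p x) (hqσ : ∀ x, q (D.σ x) = q x)
    (h : ∀ i k : ℤ, ∀ x ∈ D.eigen k, β (D.lElt i) (D.xl k x) =
      if D.n * i + k = 0 then ((i : ℂ) ^ 3 - i) / 12 * q x + ((i : ℂ) ^ 2 - i) * p x else 0) :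
    (∀ x y, 2 * q (br (D.d x) y) + q (br x y) = 0) ∧ ∃ B α : g →ₗ[ℂ] g →ₗ[ℂ] ℂ,
      (∀ x y, B (D.σ x) (D.σ y) = B x y) ∧ (∀ x y, α (D.σ x) (D.σ y) = α x y) ∧
      (∀ x y, B (D.d x) y = p (br x y)) ∧ (∀ x y, B x (D.d y) = -p (br x y)) ∧
      (∀ x y, α (D.d x) y + α x (D.d y) = α x y) ∧
      ∀ k l : ℤ, ∀ x ∈ D.eigen k, ∀ y ∈ D.eigen l, β (D.xl k x) (D.xl l y) =
        if k + l = 0 then (1 - 4 * ((k : ℂ) / D.n) ^ 2) / 24 * q (br x y) +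
          ((k : ℂ) / D.n) * B x y + p (br x y) + α x y else 0 := by
  have hn := D.n_ne
  have hpi : ∀ x y, ((br (L := g)).compr₂ p) (D.σ x) (D.σ y) = ((br (L := g)).compr₂ p) x y := by
    intro x y; simp only [LinearMap.compr₂_apply]; rw [← D.σ_br, hpσ]
  -- The forms are chosen independently for every integer `k`; only those with `0 ≤ k < n` enter the
  -- glued forms.
  choose h1 B α h2 h3 h4 h5 using hβ.exists_forms hd hp hq h
  have hB2 : ∀ x y, D.glueForm B (D.d x) y = p (br x y) := by
    intro x y
    rw [glueForm_apply, ← LinearMap.compr₂_apply, ← D.sum_eigProj_of_invariant hpi]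
    refine Finset.sum_congr rfl fun k _ => ?_
    rw [eigProj_d, h2 _ _ (D.eigProj_mem _ _) _ (D.eigProj_mem _ _), LinearMap.compr₂_apply]
  refine ⟨fun x y => ?_, D.glueForm B, D.glueForm α, D.glueForm_σ B, D.glueForm_σ α, hB2,
    fun x y => ?_, fun x y => ?_, fun k l x hx y hy => ?_⟩
  · have hi : ∀ x y, ((br (L := g)).compr₂ q).compl₁₂ ((2 : ℂ) • D.d + LinearMap.id)
        LinearMap.id (D.σ x) (D.σ y) = ((br (L := g)).compr₂ q).compl₁₂
        ((2 : ℂ) • D.d + LinearMap.id) LinearMap.id x y := by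
      intro x y
      simp only [LinearMap.compl₁₂_apply, LinearMap.compr₂_apply, LinearMap.add_apply,
        LinearMap.smul_apply, LinearMap.id_apply]
      rw [← D.σ_d, ← map_smul, ← map_add, ← D.σ_br, hqσ]
    have e := D.sum_eigProj_of_invariant hi x y
    rw [Finset.sum_eq_zero] at e
    · simp only [LinearMap.compl₁₂_apply, LinearMap.compr₂_apply, LinearMap.add_apply,
        LinearMap.smul_apply, LinearMap.id_apply, map_add, map_smul, smul_eq_mul] at e
      exact e.symm
    · intro k _
      simp only [LinearMap.compl₁₂_apply, LinearMap.compr₂_apply, LinearMap.add_apply,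
        LinearMap.smul_apply, LinearMap.id_apply, map_add, map_smul, smul_eq_mul]
      exact h1 k _ (D.eigProj_mem _ _) _ (D.eigProj_mem _ _)
  · have e : D.glueForm B (D.d x) y + D.glueForm B x (D.d y) = 0 := by
      rw [glueForm_apply, glueForm_apply, ← Finset.sum_add_distrib]
      refine Finset.sum_eq_zero fun k _ => ?_
      rw [eigProj_d, eigProj_d, h3]
    rw [hB2] at e
    linear_combination e
  · rw [glueForm_apply, glueForm_apply, glueForm_apply, ← Finset.sum_add_distrib]
    refine Finset.sum_congr rfl fun k _ => ?_
    rw [eigProj_d, eigProj_d, h4]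
  · split_ifs with hkl
    · obtain rfl : l = -k := by omega
      rw [D.glueForm_of_mem B hx hy, D.glueForm_of_mem α hx hy]
      -- The formula for the representative `k % n`, shifted by `m = k / n` (integer division), is
      -- the formula at `k`.
      have hk : k % D.n + D.n * (k / D.n) = k := Int.emod_add_mul_ediv k D.n
      have hkC : ((k % D.n : ℤ) : ℂ) / D.n + ((k / D.n : ℤ) : ℂ) = k / D.n := by
        nth_rewrite 3 [← hk]
        push_cast
        field_simp
      have hx' : x ∈ D.eigen (k % D.n) := by
        rwa [D.eigen_congr (l := k) ⟨-(k / D.n), by rw [mul_neg]; omega⟩]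
      have hy' : y ∈ D.eigen (-(k % D.n)) := by
        rwa [D.eigen_congr (l := -k) ⟨(k / D.n), by omega⟩]
      have e := h5 (k % D.n) (k / D.n) x hx' y hy'
      rwa [hk, hkC] at e
    · refine hβ.eq_zero_of_weight (D.br_lElt_zero_xl k x) (D.br_lElt_zero_xl l y) ?_
      intro h0
      have h' : (k : ℂ) + l = 0 := by field_simp at h0; linear_combination h0
      exact hkl (by exact_mod_cast h')

end IsNormalized

/-! ### Symmetry and Jacobi identities of the data on the loop algebra -/

/-- Linear forms `p`, `q` and bilinear forms `B`, `α` on `g` that describe the values of a scalar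
cocycle on the loop algebra. -/
structure IsLoopData (p q : g →ₗ[ℂ] ℂ) (B α : g →ₗ[ℂ] g →ₗ[ℂ] ℂ) : Prop where
  p_d : ∀ x, p (D.d x) = 0
  q_d : ∀ x, q (D.d x) = -q x
  p_σ : ∀ x, p (D.σ x) = p x
  q_σ : ∀ x, q (D.σ x) = q x
  q_br_d : ∀ x y, 2 * q (br (D.d x) y) + q (br x y) = 0
  B_σ : ∀ x y, B (D.σ x) (D.σ y) = B x y
  α_σ : ∀ x y, α (D.σ x) (D.σ y) = α x y
  B_d_left : ∀ x y, B (D.d x) y = p (br x y)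
  B_d_right : ∀ x y, B x (D.d y) = -p (br x y)
  α_d : ∀ x y, α (D.d x) y + α x (D.d y) = α x y

/-- The bilinear map `β` on the loop algebra is given by `p`, `q`, `B` and `α`. -/
def HasLoopValues (β : D.L →ₗ[ℂ] D.L →ₗ[ℂ] ℂ) (p q : g →ₗ[ℂ] ℂ) (B α : g →ₗ[ℂ] g →ₗ[ℂ] ℂ) :
    Prop :=
  ∀ k l : ℤ, ∀ x ∈ D.eigen k, ∀ y ∈ D.eigen l, β (D.xl k x) (D.xl l y) =
    if k + l = 0 then (1 - 4 * ((k : ℂ) / D.n) ^ 2) / 24 * q (br x y) +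
      ((k : ℂ) / D.n) * B x y + p (br x y) + α x y else 0

section LoopValues

variable {D} {β : D.L →ₗ[ℂ] D.L →ₗ[ℂ] ℂ} {p q : g →ₗ[ℂ] ℂ} {B α : g →ₗ[ℂ] g →ₗ[ℂ] ℂ}

/-- As `g_[k]` depends on `k` modulo `n` only, the same `x` and `y` occur at every shift `m`.
Identities for the cocycle thereby become polynomial identities in `m`, whose coefficients can be
compared. -/
theorem HasLoopValues.apply_shift (h : D.HasLoopValues β p q B α) {k l : ℤ} {x y : g}
    (hx : x ∈ D.eigen k) (hy : y ∈ D.eigen l) (hkl : k + l = 0) (m : ℤ) :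
    β (D.xl (k + D.n * m) x) (D.xl (l - D.n * m) y) =
      (1 - 4 * ((k : ℂ) / D.n + m) ^ 2) / 24 * q (br x y) +
      ((k : ℂ) / D.n + m) * B x y + p (br x y) + α x y := by
  have hn := D.n_ne
  have hx' : x ∈ D.eigen (k + D.n * m) := by rwa [eigen_add_mul]
  have hy' : y ∈ D.eigen (l - D.n * m) := by
    rwa [sub_eq_add_neg, ← mul_neg, eigen_add_mul]
  rw [h _ _ _ hx' _ hy', if_pos (by omega)]
  have e : ((k + D.n * m : ℤ) : ℂ) / D.n = k / D.n + m := by push_cast; field_simp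
  rw [e]

/-- Exchanging the arguments replaces the degree by its negative. The terms with `q` and `p` match
by skew-symmetry of the bracket; in the rest, the part linear in the degree is the symmetry of `B`
and the constant part is the skew-symmetry of `α`. -/
theorem HasLoopValues.symm_of_mem (h : D.HasLoopValues β p q B α) (hβ : IsSuperSkew β)
    {i j : ZMod 2} {k : ℤ} {x y : g} (hx : x ∈ D.eigen k) (hxi : x ∈ part (V := g) i)
    (hy : y ∈ D.eigen (-k)) (hyj : y ∈ part (V := g) j) :
    B x y = koszul i j * B y x ∧ α x y = -(koszul i j * α y x) := by
  have e : ∀ m : ℤ, _ := fun m =>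
    hβ i j _ (D.xl_mem (k + D.n * m) i hxi) _ (D.xl_mem (-k - D.n * m) j hyj)
  have e1 := fun m => h.apply_shift hx hy (by ring) m
  have e2 : ∀ m : ℤ, _ := fun m => h.apply_shift hy hx (by ring) (-m)
  have hbr := br_skew i j x hxi y hyj
  have hq := congrArg q hbr
  have hp := congrArg p hbr
  simp only [map_neg, map_smul, smul_eq_mul] at hq hp
  have e3 : ∀ m : ℤ, (((k : ℂ) / D.n) + m) * (B x y - koszul i j * B y x) +
      (α x y + koszul i j * α y x) = 0 := by
    intro m
    have a := e m
    have b := e2 m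
    rw [mul_neg, ← sub_eq_add_neg, sub_neg_eq_add] at b
    rw [e1, b] at a
    push_cast at a
    rw [smul_eq_mul] at a
    linear_combination a - (1 - 4 * ((k : ℂ) / D.n + m) ^ 2) / 24 * hq - hp
  have a0 := e3 0
  have a1 := e3 1
  push_cast at a0 a1
  have hB : B x y - koszul i j * B y x = 0 := by linear_combination a1 - a0
  refine ⟨by linear_combination hB, ?_⟩
  rw [hB] at a0
  linear_combination a0

/-- The cocycle identity for `x`, `y`, `z` in degrees shifted by `r`, `s`, `-r-s` is a quadratic
polynomial identity in `r` and `s`. Its quadratic, linear and constant parts give the assertions on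
`q`, `B` and `α`; the terms with `p` cancel by the Jacobi identity. -/
theorem HasLoopValues.jacobi_of_mem (h : D.HasLoopValues β p q B α) (hβ : IsSuperClosed β)
    {i j : ZMod 2} {k l m : ℤ} (hklm : k + l + m = 0) {x y z : g} (hx : x ∈ D.eigen k)
    (hxi : x ∈ part (V := g) i) (hy : y ∈ D.eigen l) (hyj : y ∈ part (V := g) j)
    (hz : z ∈ D.eigen m) :
    q (br x (br y z)) = 0 ∧ B (br x y) z = B x (br y z) ∧
      α x (br y z) = α (br x y) z + koszul i j * α y (br x z) := by
  have hn := D.n_ne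
  have hbr := br_jacobi i j x hxi y hyj z
  have hq := congrArg q hbr
  have hp := congrArg p hbr
  simp only [map_add, map_smul, smul_eq_mul] at hq hp
  have e : ∀ r s : ℤ,
      (1 - 4 * ((k : ℂ) / D.n + r) ^ 2) / 24 * q (br x (br y z)) +
        ((k : ℂ) / D.n + r) * B x (br y z) + α x (br y z) =
      (1 - 4 * ((k : ℂ) / D.n + l / D.n + (r + s)) ^ 2) / 24 * q (br (br x y) z) +
        ((k : ℂ) / D.n + l / D.n + (r + s)) * B (br x y) z + α (br x y) z +
      koszul i j * ((1 - 4 * ((l : ℂ) / D.n + s) ^ 2) / 24 * q (br y (br x z)) +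
        ((l : ℂ) / D.n + s) * B y (br x z) + α y (br x z)) := by
    intro r s
    have c := hβ i j _ (D.xl_mem (k + D.n * r) i hxi) _ (D.xl_mem (l + D.n * s) j hyj)
      (D.xl (m - D.n * (r + s)) z)
    have hx' : x ∈ D.eigen (k + D.n * r) := by rwa [eigen_add_mul]
    have hy' : y ∈ D.eigen (l + D.n * s) := by rwa [eigen_add_mul]
    have hz' : z ∈ D.eigen (m - D.n * (r + s)) := by
      rwa [sub_eq_add_neg, ← mul_neg, eigen_add_mul]
    rw [D.br_xl_xl_of_mem hx' hy', D.br_xl_xl_of_mem hx' hz', D.br_xl_xl_of_mem hy' hz',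
      show l + D.n * s + (m - D.n * (r + s)) = l + m - D.n * r by ring,
      show k + D.n * r + (m - D.n * (r + s)) = k + m - D.n * s by ring,
      show k + D.n * r + (l + D.n * s) = k + l + D.n * (r + s) by ring,
      h.apply_shift hx (D.br_mem_eigen hy hz) (by omega),
      h.apply_shift hy (D.br_mem_eigen hx hz) (by omega),
      h.apply_shift (D.br_mem_eigen hx hy) hz hklm, smul_eq_mul] at c
    push_cast at c
    rw [add_div] at c
    linear_combination c - hp
  have e00 := e 0 0
  have e10 := e 1 0
  have e01 := e 0 1
  have e11 := e 1 1
  have e20 := e 2 0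
  push_cast at e00 e10 e01 e11 e20
  -- The mixed second difference in `r` and `s` sees only this term; the second difference in `r`
  -- then gives `q1`.
  have q2 : q (br (br x y) z) = 0 := by linear_combination 3 * (e11 - e10 - e01 + e00)
  rw [q2] at e00 e10 e01 e20 hq
  have q1 : q (br x (br y z)) = 0 := by linear_combination -3 * (e20 - 2 * e10 + e00)
  rw [q1] at e00 e10 e01 hq
  have b1 : B x (br y z) = B (br x y) z := by linear_combination e10 - e00
  -- This is the first difference in `s`.
  have b2 : B (br x y) z + koszul i j * B y (br x z) = 0 := by
    linear_combination e00 - e01 - (4 * ((l : ℂ) / D.n + 1) ^ 2 - 4 * ((l : ℂ) / D.n) ^ 2) / 24 * hq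
  refine ⟨q1, b1.symm, ?_⟩
  linear_combination e00 - ((k : ℂ) / D.n) * b1 + ((l : ℂ) / D.n) * b2
    - (1 - 4 * ((l : ℂ) / D.n) ^ 2) / 24 * hq

/-- An invariant form vanishes on `g_[k] × g_[l]` unless `n` divides `k + l`, and in that case `l`
may be renamed `-k`. Identities known on matching homogeneous eigenvectors therefore extend to `g`.
-/
theorem eq_zero_of_invariant₂ {i j : ZMod 2} {T : g →ₗ[ℂ] g →ₗ[ℂ] ℂ}
    (hT : ∀ x y, T (D.σ x) (D.σ y) = T x y)
    (h : ∀ k : ℤ, ∀ x ∈ D.eigen k, x ∈ part (V := g) i → ∀ y ∈ D.eigen (-k),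
      y ∈ part (V := g) j → T x y = 0)
    {x y : g} (hx : x ∈ part (V := g) i) (hy : y ∈ part (V := g) j) : T x y = 0 := by
  refine D.part_eigen_induction (p := fun x => T x y = 0) (fun a b ha hb => ?_) (by simp)
    (fun k x hx hxi => ?_) hx
  · rw [map_add, LinearMap.add_apply, ha, hb, add_zero]
  refine D.part_eigen_induction (p := fun y => T x y = 0) (fun a b ha hb => ?_) (by simp)
    (fun l y hy hyj => ?_) hy
  · rw [map_add, ha, hb, add_zero]
  by_cases hn : (D.n : ℤ) ∣ k + l
  · refine h k x hx hxi y ?_ hyj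
    rwa [D.eigen_congr (l := l)]
    rw [show -k - l = -(k + l) by ring]
    exact (dvd_neg).2 hn
  · exact D.eq_zero_of_invariant hT hx hy hn

/-- The trilinear analogue, used for the Jacobi-type identities; here the last label becomes `-k-l`.
-/
theorem eq_zero_of_invariant₃ {i j : ZMod 2} {T : g → g → g → ℂ}
    (h1 : ∀ y z, IsLinearMap ℂ fun x => T x y z) (h2 : ∀ x z, IsLinearMap ℂ fun y => T x y z)
    (h3 : ∀ x y, IsLinearMap ℂ fun z => T x y z)
    (hT : ∀ x y z, T (D.σ x) (D.σ y) (D.σ z) = T x y z)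
    (h : ∀ k l m : ℤ, k + l + m = 0 → ∀ x ∈ D.eigen k, x ∈ part (V := g) i →
      ∀ y ∈ D.eigen l, y ∈ part (V := g) j → ∀ z ∈ D.eigen m, T x y z = 0)
    {x y : g} (hx : x ∈ part (V := g) i) (hy : y ∈ part (V := g) j) (z : g) : T x y z = 0 := by
  refine D.part_eigen_induction (p := fun x => T x y z = 0) (fun a b ha hb => ?_)
    (h1 y z).map_zero (fun k x hx hxi => ?_) hx
  · rw [(h1 y z).map_add, ha, hb, add_zero]
  refine D.part_eigen_induction (p := fun y => T x y z = 0) (fun a b ha hb => ?_)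
    (h2 x z).map_zero (fun l y hy hyj => ?_) hy
  · rw [(h2 x z).map_add, ha, hb, add_zero]
  refine D.eigen_induction (p := fun z => T x y z = 0) (fun a b ha hb => ?_)
    (h3 x y).map_zero (fun m z hz => ?_) z
  · rw [(h3 x y).map_add, ha, hb, add_zero]
  by_cases hn : (D.n : ℤ) ∣ k + l + m
  · refine h k l (-k - l) (by ring) x hx hxi y hy hyj z ?_
    rwa [D.eigen_congr (l := m)]
    rw [show -k - l - m = -(k + l + m) by ring]
    exact (dvd_neg).2 hn
  · have e := hT x y z
    rw [D.mem_eigen.1 hx, D.mem_eigen.1 hy, D.mem_eigen.1 hz, (h1 _ _).map_smul,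
      (h2 _ _).map_smul, (h3 _ _).map_smul] at e
    simp only [smul_eq_mul] at e
    have h1 : D.ω ^ k * (D.ω ^ l * D.ω ^ m) ≠ 1 := by
      rw [← zpow_add₀ D.ω_ne, ← zpow_add₀ D.ω_ne, ← add_assoc]
      exact fun h' => hn ((D.ω_primitive.zpow_eq_one_iff_dvd _).1 h')
    have h2 : (D.ω ^ k * (D.ω ^ l * D.ω ^ m) - 1) * T x y z = 0 := by linear_combination e
    exact (mul_eq_zero.1 h2).resolve_left (sub_ne_zero.2 h1)

variable (hD : D.IsLoopData p q B α) (h : D.HasLoopValues β p q B α)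
include hD h

theorem IsLoopData.B_symm (hβ : IsSuperSkew β) {i j : ZMod 2} {x y : g}
    (hx : x ∈ part (V := g) i) (hy : y ∈ part (V := g) j) : B x y = koszul i j * B y x := by
  rw [← sub_eq_zero]
  refine eq_zero_of_invariant₂ (D := D) (T := B - koszul i j • B.flip) (fun x y => ?_)
    (fun k x hx hxi y hy hyj => ?_) hx hy
  · simp [hD.B_σ]
  · simpa [sub_eq_zero] using (h.symm_of_mem hβ hx hxi hy hyj).1

theorem IsLoopData.α_skew (hβ : IsSuperSkew β) {i j : ZMod 2} {x y : g}
    (hx : x ∈ part (V := g) i) (hy : y ∈ part (V := g) j) : α x y = -(koszul i j * α y x) := by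
  rw [← sub_eq_zero]
  refine eq_zero_of_invariant₂ (D := D) (T := α - -(koszul i j • α.flip)) (fun x y => ?_)
    (fun k x hx hxi y hy hyj => ?_) hx hy
  · simp [hD.α_σ]
  · have := (h.symm_of_mem hβ hx hxi hy hyj).2
    simp [this]

theorem IsLoopData.q_br_br (hβ : IsSuperClosed β) (x y z : g) : q (br x (br y z)) = 0 := by
  have key : ∀ i j : ZMod 2, ∀ x ∈ part (V := g) i, ∀ y ∈ part (V := g) j,
      q (br x (br y z)) = 0 := by
    intro i j x hx y hy
    refine eq_zero_of_invariant₃ (D := D) (T := fun x y z => q (br x (br y z)))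
      (fun _ _ => ⟨by intros; simp, by intros; simp⟩)
      (fun _ _ => ⟨by intros; simp, by intros; simp⟩)
      (fun _ _ => ⟨by intros; simp, by intros; simp⟩) (fun x y z => ?_)
      (fun k l m hklm x hx hxi y hy hyj z hz => ?_) hx hy z
    · rw [← D.σ_br, ← D.σ_br, hD.q_σ]
    · exact (h.jacobi_of_mem hβ hklm hx hxi hy hyj hz).1
  obtain ⟨a, ha, b, hb, rfl⟩ := exists_decomp x
  obtain ⟨a', ha', b', hb', rfl⟩ := exists_decomp y
  simp only [map_add, LinearMap.add_apply, key 0 0 a ha a' ha', key 0 1 a ha b' hb',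
    key 1 0 b hb a' ha', key 1 1 b hb b' hb', add_zero]

theorem IsLoopData.B_br (hβ : IsSuperClosed β) (x y z : g) : B (br x y) z = B x (br y z) := by
  have key : ∀ i j : ZMod 2, ∀ x ∈ part (V := g) i, ∀ y ∈ part (V := g) j,
      B (br x y) z = B x (br y z) := by
    intro i j x hx y hy
    rw [← sub_eq_zero]
    refine eq_zero_of_invariant₃ (D := D) (T := fun x y z => B (br x y) z - B x (br y z))
      (fun _ _ => ⟨by intros; simp; ring, by intros; simp; ring⟩)
      (fun _ _ => ⟨by intros; simp; ring, by intros; simp; ring⟩)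
      (fun _ _ => ⟨by intros; simp; ring, by intros; simp; ring⟩) (fun x y z => ?_)
      (fun k l m hklm x hx hxi y hy hyj z hz => ?_) hx hy z
    · rw [← D.σ_br, ← D.σ_br, hD.B_σ, hD.B_σ]
    · exact sub_eq_zero.2 (h.jacobi_of_mem hβ hklm hx hxi hy hyj hz).2.1
  obtain ⟨a, ha, b, hb, rfl⟩ := exists_decomp x
  obtain ⟨a', ha', b', hb', rfl⟩ := exists_decomp y
  simp only [map_add, LinearMap.add_apply, key 0 0 a ha a' ha', key 0 1 a ha b' hb',
    key 1 0 b hb a' ha', key 1 1 b hb b' hb']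

theorem IsLoopData.α_closed (hβ : IsSuperClosed β) {i j : ZMod 2} {x y : g}
    (hx : x ∈ part (V := g) i) (hy : y ∈ part (V := g) j) (z : g) :
    α x (br y z) = α (br x y) z + koszul i j * α y (br x z) := by
  rw [← sub_eq_zero]
  refine eq_zero_of_invariant₃ (D := D)
    (T := fun x y z => α x (br y z) - (α (br x y) z + koszul i j * α y (br x z)))
    (fun _ _ => ⟨by intros; simp; ring, by intros; simp; ring⟩)
    (fun _ _ => ⟨by intros; simp; ring, by intros; simp; ring⟩)
    (fun _ _ => ⟨by intros; simp; ring, by intros; simp; ring⟩) (fun x y z => ?_)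
    (fun k l m hklm x hx hxi y hy hyj z hz => ?_) hx hy z
  · rw [← D.σ_br, ← D.σ_br, ← D.σ_br, hD.α_σ, hD.α_σ, hD.α_σ]
  · exact sub_eq_zero.2 (h.jacobi_of_mem hβ hklm hx hxi hy hyj hz).2.2

theorem IsLoopData.α_mem (hs : IsSuperSkew β) (hc : IsSuperClosed β) : α ∈ D.Z2Fixed :=
  ⟨⟨⟨fun _ _ _ hx _ hy => hD.α_skew h hs hx hy, fun _ _ _ hx _ hy z => hD.α_closed h hc hx hy z⟩,
    LinearMap.ext₂ hD.α_d⟩, LinearMap.ext₂ hD.α_σ⟩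

end LoopValues

/-! ### From the data of a cocycle to a functional on the centre -/

/-- The bilinear form on `ℂ∂ ⋉ g` with `(∂, ∂) ↦ c`, `(∂, x) ↦ p(x)` and `(x, y) ↦ B(x, y)`. -/
def extendForm (c : ℂ) (p : g →ₗ[ℂ] ℂ) (B : g →ₗ[ℂ] g →ₗ[ℂ] ℂ) : D.DDot →ₗ[ℂ] D.DDot →ₗ[ℂ] ℂ :=
  (LinearMap.mk₂ ℂ (fun u v => u.1 * v.1 * c + u.1 * p v.2 + v.1 * p u.2 + B u.2 v.2)
    (fun _ _ _ => by simp; ring) (fun _ _ _ => by simp; ring)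
    (fun _ _ _ => by simp; ring) (fun _ _ _ => by simp; ring) :
    (ℂ × g) →ₗ[ℂ] (ℂ × g) →ₗ[ℂ] ℂ)

theorem extendForm_apply (c : ℂ) (p : g →ₗ[ℂ] ℂ) (B : g →ₗ[ℂ] g →ₗ[ℂ] ℂ) (s t : ℂ) (x y : g) :
    D.extendForm c p B ((s, x) : ℂ × g) ((t, y) : ℂ × g) =
      s * t * c + s * p y + t * p x + B x y := rfl

theorem extendForm_del_del (c : ℂ) (p : g →ₗ[ℂ] ℂ) (B : g →ₗ[ℂ] g →ₗ[ℂ] ℂ) :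
    D.extendForm c p B D.del D.del = c := by
  refine (D.extendForm_apply c p B 1 1 0 0).trans ?_
  simp

theorem extendForm_del_incl (c : ℂ) (p : g →ₗ[ℂ] ℂ) (B : g →ₗ[ℂ] g →ₗ[ℂ] ℂ) (x : g) :
    D.extendForm c p B D.del (D.incl x) = p x := by
  refine (D.extendForm_apply c p B 1 0 0 x).trans ?_
  simp

theorem extendForm_incl_incl (c : ℂ) (p : g →ₗ[ℂ] ℂ) (B : g →ₗ[ℂ] g →ₗ[ℂ] ℂ) (x y : g) :
    D.extendForm c p B (D.incl x) (D.incl y) = B x y := by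
  refine (D.extendForm_apply c p B 0 0 x y).trans ?_
  simp

section

variable {D} {β : D.L →ₗ[ℂ] D.L →ₗ[ℂ] ℂ} {p q : g →ₗ[ℂ] ℂ} {B α : g →ₗ[ℂ] g →ₗ[ℂ] ℂ}

/-- Invariance on triples containing `∂` amounts to `p ∘ d = 0` and `B(dx, y) = p([x, y]) = -B(x,
dy)`. The number `c` is unconstrained because brackets have no `∂`-component. -/
theorem IsLoopData.extendForm_mem (hD : D.IsLoopData p q B α) (h : D.HasLoopValues β p q B α)
    (hs : IsSuperSkew β) (hc : IsSuperClosed β) (c : ℂ) : D.extendForm c p B ∈ D.InvFixed := by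
  refine ⟨⟨?_, ?_⟩, LinearMap.ext₂ ?_⟩
  · rintro i j ⟨s, x⟩ ⟨hs', hx⟩ ⟨t, y⟩ ⟨ht', hy⟩
    rw [extendForm_apply, extendForm_apply, hD.B_symm h hs hx hy]
    dsimp only at hs' ht'
    rcases zmod2_cases i with rfl | rfl
    · rw [koszul_zero_left]; ring
    · rw [hs' rfl]
      rcases zmod2_cases j with rfl | rfl
      · rw [koszul_zero_right]; ring
      · rw [ht' rfl]; ring
  · rintro ⟨s, x⟩ ⟨t, y⟩ ⟨r, z⟩
    change D.extendForm c p B ((0, s • D.d y - t • D.d x + br x y) : ℂ × g) ((r, z) : ℂ × g) =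
      D.extendForm c p B ((s, x) : ℂ × g) ((0, t • D.d z - r • D.d y + br y z) : ℂ × g)
    rw [extendForm_apply, extendForm_apply]
    simp only [map_add, map_sub, map_smul, LinearMap.add_apply, LinearMap.sub_apply,
      LinearMap.smul_apply, smul_eq_mul, hD.p_d, hD.B_d_left, hD.B_d_right]
    linear_combination hD.B_br h hc x y z
  · rintro ⟨s, x⟩ ⟨t, y⟩
    change D.extendForm c p B ((s, D.σ x) : ℂ × g) ((t, D.σ y) : ℂ × g) =
      D.extendForm c p B ((s, x) : ℂ × g) ((t, y) : ℂ × g)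
    rw [extendForm_apply, extendForm_apply, hD.p_σ, hD.p_σ, hD.B_σ]

/-- The three families of relations come from the cocycle identities with two, one and no Witt
arguments, respectively. -/
theorem IsLoopData.relations_le (hD : D.IsLoopData p q B α) (h : D.HasLoopValues β p q B α)
    (hc : IsSuperClosed β) : D.relations ≤ LinearMap.ker q := by
  refine sup_le (sup_le ?_ ?_) ?_
  · rintro _ ⟨x, rfl⟩
    rw [LinearMap.mem_ker, LinearMap.add_apply, LinearMap.id_apply, map_add, hD.q_d,
      neg_add_cancel]
  · rw [Submodule.span_le]
    rintro _ ⟨x, y, rfl⟩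
    have := hD.q_br_d x y
    rw [SetLike.mem_coe, LinearMap.mem_ker, map_add, LinearMap.add_apply, map_add, map_smul,
      LinearMap.smul_apply, map_smul, smul_eq_mul]
    linear_combination (1 / 2) * this
  · rw [Submodule.span_le]
    rintro _ ⟨x, y, z, rfl⟩
    exact hD.q_br_br h hc x y z

end

/-- Every normalized scalar cocycle factors through the universal cocycle. -/
theorem IsNormalized.exists_factor [FiniteDimensional ℂ g] {β : D.L →ₗ[ℂ] D.L →ₗ[ℂ] ℂ}
    (hβ : D.IsNormalized β) (hd : ¬ Module.End.HasEigenvalue D.d 1) :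
    ∃ ν : D.Centre →ₗ[ℂ] ℂ, ∀ u v, β u v = ν (D.univForm u v) := by
  obtain ⟨c, hll⟩ := hβ.lElt_lElt
  obtain ⟨p, q, hp, hq, hpσ, hqσ, hlx⟩ := hβ.lElt_xl
  obtain ⟨h1, B, α, h2, h3, h4, h5, h6, hxx⟩ := hβ.xl_xl hd hp hq hpσ hqσ hlx
  have hD : D.IsLoopData p q B α := ⟨hp, hq, hpσ, hqσ, h1, h2, h3, h4, h5, h6⟩
  have hL : D.HasLoopValues β p q B α := hxx
  let qb : (g ⧸ D.relations) →ₗ[ℂ] ℂ := D.relations.liftQ q (hD.relations_le hL hβ.closed)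
  let Bb : D.InvFixed := ⟨_, hD.extendForm_mem hL hβ.skew hβ.closed c⟩
  let αb : D.Z2Fixed := ⟨_, hD.α_mem hL hβ.skew hβ.closed⟩
  -- The functional is `q` on the quotient and the evaluations at the invariant form and at the
  -- cocycle on the two dual spaces.
  let ν : D.Centre →ₗ[ℂ] ℂ := (qb ∘ₗ D.QuotFixed.subtype).coprod
    ((Module.Dual.eval ℂ D.InvFixed Bb).coprod (Module.Dual.eval ℂ D.Z2Fixed αb))
  have hν : ∀ u v, ν (D.univForm u v) =
      qb (D.quotForm u v) + (D.invFormCocycle Bb.1 u v + D.baseCocycle αb.1 u v) :=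
    fun _ _ => rfl
  have hqb : ∀ x, qb (D.relations.mkQ x) = q x := fun _ => rfl
  have hlx' : ∀ i k : ℤ, ∀ x ∈ D.eigen k, β (D.lElt i) (D.xl k x) =
      ν (D.univForm (D.lElt i) (D.xl k x)) := by
    intro i k x hx
    rw [hlx i k x hx, hν, quotForm, D.diagForm_lElt_xl _ _ _ i hx]
    change _ = _ + (D.diagForm _ _ _ _ _ + D.diagForm _ _ _ _ _)
    rw [D.diagForm_lElt_xl _ _ _ i hx, D.diagForm_lElt_xl _ _ _ i hx]
    split_ifs with h
    · simp only [LinearMap.smul_apply, map_smul, hqb, smul_eq_mul, LinearMap.comp_apply, Bb,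
        extendForm_del_incl, Pi.zero_apply, LinearMap.zero_apply, add_zero]
    · simp
  refine ⟨ν, fun u v => LinearMap.congr_fun₂ (f := β) (g := (D.univForm).compr₂ ν)
    (D.L_hom_ext₂ (fun i j => ?_) hlx' (fun i k x hx => ?_) fun k l x hx y hy => ?_) u v⟩
  · rw [hll, LinearMap.compr₂_apply, hν, quotForm, diagForm_lElt_lElt]
    change _ = _ + (D.diagForm _ _ _ _ _ + D.diagForm _ _ _ _ _)
    rw [diagForm_lElt_lElt, diagForm_lElt_lElt]
    split_ifs with h
    · simp only [Bb, extendForm_del_del, Pi.zero_apply, map_zero, add_zero, zero_add]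
    · simp
  · have e : D.univForm (D.xl k x) (D.lElt i) = -D.univForm (D.lElt i) (D.xl k x) :=
      D.Centre_ext (D.diagForm_xl_lElt _ _ _ _ hx) (fun B => D.diagForm_xl_lElt _ _ _ _ hx)
        fun α => D.diagForm_xl_lElt _ _ _ _ hx
    rw [LinearMap.compr₂_apply, e, map_neg, ← hlx' i k x hx, hβ.skew.of_even (D.lElt_mem i),
      neg_neg]
  · rw [hxx k l x hx y hy, LinearMap.compr₂_apply, hν, quotForm, D.diagForm_xl_xl _ _ _ hx hy]
    change _ = _ + (D.diagForm _ _ _ _ _ + D.diagForm _ _ _ _ _)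
    rw [D.diagForm_xl_xl _ _ _ hx hy, D.diagForm_xl_xl _ _ _ hx hy]
    split_ifs with h
    · simp only [LinearMap.smul_apply, map_smul, LinearMap.compr₂_apply, LinearMap.add_apply,
        LinearMap.compl₁₂_apply, hqb, smul_eq_mul, LinearMap.comp_apply, Bb, αb,
        extendForm_del_incl, extendForm_incl_incl]
      ring
    · simp

/-- Every scalar cocycle is a coboundary plus a factor of the universal cocycle. -/
theorem exists_factor_add_coboundary [FiniteDimensional ℂ g]
    (hd : ¬ Module.End.HasEigenvalue D.d 1) {β : D.L →ₗ[ℂ] D.L →ₗ[ℂ] ℂ} (hs : IsSuperSkew β)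
    (hc : IsSuperClosed β) : ∃ (f : D.L →ₗ[ℂ] ℂ) (ν : D.Centre →ₗ[ℂ] ℂ),
      ∀ u v, β u v = f (br u v) + ν (D.univForm u v) := by
  obtain ⟨f, h0, h1, h2⟩ := D.exists_normalization hd hs hc
  have hβ : D.IsNormalized (β - (br (L := D.L)).compr₂ f) :=
    ⟨hs.sub (isSuperSkew_coboundary f), hc.sub (isSuperClosed_coboundary f),
      fun w => sub_eq_zero.2 (h0 w), sub_eq_zero.2 h1, fun x => sub_eq_zero.2 (h2 x)⟩
  obtain ⟨ν, hν⟩ := hβ.exists_factor D hd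
  refine ⟨f, ν, fun u v => ?_⟩
  rw [← hν, LinearMap.sub_apply, LinearMap.sub_apply, LinearMap.compr₂_apply, add_sub_cancel]

/-! ### Perfectness of the central extension -/

instance [FiniteDimensional ℂ g] : FiniteDimensional ℂ D.DDot :=
  inferInstanceAs (FiniteDimensional ℂ (ℂ × g))

theorem DDot_form_ext {B B' : D.DDot →ₗ[ℂ] D.DDot →ₗ[ℂ] ℂ} (hB : B ∈ invForms D.DDot)
    (hB' : B' ∈ invForms D.DDot) (h1 : B D.del D.del = B' D.del D.del)
    (h2 : ∀ x, B D.del (D.incl x) = B' D.del (D.incl x))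
    (h3 : ∀ x y, B (D.incl x) (D.incl y) = B' (D.incl x) (D.incl y)) : B = B' := by
  have h4 : ∀ {C : D.DDot →ₗ[ℂ] D.DDot →ₗ[ℂ] ℂ} (_ : C ∈ invForms D.DDot) (x : g),
      C (D.incl x) D.del = C D.del (D.incl x) := by
    intro C hC x
    obtain ⟨a, ha, b, hb, rfl⟩ := exists_decomp x
    have e0 := hC.1 0 0 _ (D.incl_mem ha) _ D.del_mem
    have e1 := hC.1 1 0 _ (D.incl_mem hb) _ D.del_mem
    rw [koszul_zero_right, one_mul] at e0 e1
    simp only [map_add, LinearMap.add_apply, e0, e1]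
  have hdec : ∀ u : D.DDot, ∃ (s : ℂ) (x : g), u = s • D.del + D.incl x := by
    rintro ⟨s, x⟩
    refine ⟨s, x, Prod.ext ?_ ?_⟩
    · change s = s * 1 + 0
      ring
    · change x = s • (0 : g) + x
      simp
  refine LinearMap.ext₂ fun u v => ?_
  obtain ⟨s, x, rfl⟩ := hdec u
  obtain ⟨t, y, rfl⟩ := hdec v
  simp only [map_add, map_smul, LinearMap.add_apply, LinearMap.smul_apply, h4 hB, h4 hB', h1, h2,
    h3]

/-- The map from `g` onto the `σ`-invariants of its quotient. -/
def quotProj : g →ₗ[ℂ] D.QuotFixed :=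
  (D.relations.mkQ ∘ₗ D.eigProj 0).codRestrict D.QuotFixed fun x => by
    have h : D.σ (D.eigProj 0 x) = D.eigProj 0 x := by
      simpa using D.mem_eigen.1 (D.eigProj_mem 0 x)
    change D.relations.mkQ (D.σ (D.eigProj 0 x)) = D.relations.mkQ (D.eigProj 0 x)
    rw [h]

/-- An invariant class is also the class of the average of a representative over the powers of `σ`,
and this average lies in `g_[0]`. -/
theorem quotProj_surjective : Function.Surjective D.quotProj := by
  rintro ⟨v, hv⟩
  obtain ⟨x, rfl⟩ := D.relations.mkQ_surjective v
  refine ⟨x, Subtype.ext ?_⟩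
  change D.relations.mkQ (D.eigProj 0 x) = D.relations.mkQ x
  have h1 : ∀ y, D.relations.mkQ y = D.relations.mkQ x →
      D.relations.mkQ (D.σ y) = D.relations.mkQ x :=
    fun y hy => (congrArg D.σQuot hy).trans hv
  have h : ∀ m : ℕ, D.relations.mkQ ((D.σ.toLinearMap ^ m) x) = D.relations.mkQ x := by
    intro m
    induction m with
    | zero => rfl
    | succ m ih => rw [pow_succ']; exact h1 _ ih
  rw [eigProj_apply, map_smul, map_sum]
  simp only [h, neg_zero, zpow_zero, one_pow, one_smul, Finset.sum_const,
    Finset.card_range]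
  rw [← Nat.cast_smul_eq_nsmul ℂ, smul_smul, inv_mul_cancel₀ D.n_ne, one_smul]

theorem univForm_quot_lElt_xl (i : ℤ) {k : ℤ} (h : D.n * i + k = 0) {x : g} (hx : x ∈ D.eigen k) :
    (D.univForm (D.lElt i) (D.xl k x)).1 = (((i : ℂ) ^ 3 - i) / 12) • D.quotProj x := by
  have hx0 : x ∈ D.eigen 0 := by
    rwa [← D.eigen_congr (k := k) ⟨-i, by rw [mul_neg]; omega⟩]
  refine Subtype.ext ?_
  rw [univForm_quot, quotForm, D.diagForm_lElt_xl _ _ _ _ hx, if_pos h, LinearMap.smul_apply]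
  change _ = _ • D.relations.mkQ (D.eigProj 0 x)
  rw [D.eigProj_self hx0]

theorem functional_eq_zero_of_eigen {p : g →ₗ[ℂ] ℂ} (hp : ∀ x, p (D.σ x) = p x)
    (h : ∀ x ∈ D.eigen 0, p x = 0) : p = 0 := by
  refine LinearMap.ext fun x => D.eigen_induction (p := fun x => p x = 0)
    (fun a b ha hb => by rw [map_add, ha, hb, add_zero]) (map_zero p) (fun k x hx => ?_) x
  by_cases hk : (D.n : ℤ) ∣ k
  · exact h x (by rwa [← D.eigen_congr (k := k) (by rwa [sub_zero])])
  · exact D.functional_eq_zero_of_invariant hp hx hk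

theorem form_eq_zero_of_eigen {b : g →ₗ[ℂ] g →ₗ[ℂ] ℂ} (hb : ∀ x y, b (D.σ x) (D.σ y) = b x y)
    (h : ∀ k : ℤ, ∀ x ∈ D.eigen k, ∀ y ∈ D.eigen (-k), b x y = 0) : b = 0 := by
  refine LinearMap.ext₂ fun x y => ?_
  rw [← D.sum_eigProj_of_invariant hb]
  exact Finset.sum_eq_zero fun k _ => h k _ (D.eigProj_mem _ _) _ (D.eigProj_mem _ _)

/-- The central extension defined by the universal cocycle is perfect. -/
theorem eq_zero_of_functional [FiniteDimensional ℂ g] (hd : ¬ Module.End.HasEigenvalue D.d 1)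
    {f : D.L →ₗ[ℂ] ℂ} {ν : D.Centre →ₗ[ℂ] ℂ}
    (h : ∀ u v, f (br u v) + ν (D.univForm u v) = 0) : f = 0 ∧ ν = 0 := by
  have hn := D.n_ne
  let q : D.QuotFixed →ₗ[ℂ] ℂ := ν ∘ₗ LinearMap.inl ℂ _ _
  -- By finite dimension, `ν` restricted to each dual space is the evaluation at a vector.
  obtain ⟨B, hB⟩ := (Module.evalEquiv ℂ D.InvFixed).surjective
    (ν ∘ₗ LinearMap.inr ℂ _ _ ∘ₗ LinearMap.inl ℂ _ _)
  obtain ⟨α, hα⟩ := (Module.evalEquiv ℂ D.Z2Fixed).surjective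
    (ν ∘ₗ LinearMap.inr ℂ _ _ ∘ₗ LinearMap.inr ℂ _ _)
  have hB' : ∀ φ, ν (0, φ, 0) = φ B := fun φ => (LinearMap.congr_fun hB φ).symm
  have hα' : ∀ φ, ν (0, 0, φ) = φ α := fun φ => (LinearMap.congr_fun hα φ).symm
  have hν : ∀ z : D.Centre, ν z = q z.1 + (z.2.1 B + z.2.2 α) := by
    rintro ⟨z, φ, ψ⟩
    dsimp only
    rw [← hB', ← hα']
    change _ = ν (z, 0, 0) + _
    rw [← map_add, ← map_add]
    simp
  have hνΩ : ∀ u v, ν (D.univForm u v) = q (D.univForm u v).1 +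
      (D.invFormCocycle B.1 u v + D.baseCocycle α.1 u v) := fun u v => hν _
  have hlx : ∀ (i : ℤ), ∀ x ∈ D.eigen 0, f (D.xl 0 ((i : ℂ) • (D.d x - x))) +
      (((i : ℂ) ^ 3 - i) / 12 * q (D.quotProj x) +
        ((i : ℂ) ^ 2 - i) * B.1 D.del (D.incl x)) = 0 := by
    intro i x hx
    have hx' : x ∈ D.eigen (-(D.n * i)) := by
      rwa [D.eigen_congr (l := 0) ⟨-i, by ring⟩]
    have e := h (D.lElt i) (D.xl (-(D.n * i)) x)
    have e1 : D.invFormCocycle B.1 (D.lElt i) (D.xl (-(D.n * i)) x) =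
        ((i : ℂ) ^ 2 - i) * B.1 D.del (D.incl x) := by
      change D.diagForm _ _ _ _ _ = _
      rw [D.diagForm_lElt_xl _ _ _ i hx', if_pos (add_neg_cancel _)]
      rfl
    have e2 : D.baseCocycle α.1 (D.lElt i) (D.xl (-(D.n * i)) x) = 0 := by
      change D.diagForm _ _ _ _ _ = _
      rw [D.diagForm_lElt_xl _ _ _ i hx', if_pos (add_neg_cancel _)]
      rfl
    rw [hνΩ, e1, e2, D.univForm_quot_lElt_xl i (add_neg_cancel _) hx', br_lElt_xl,
      neg_add_cancel, map_smul, smul_eq_mul, add_zero] at e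
    rw [← e]
    congr 3
    have : ((-(D.n * i) : ℤ) : ℂ) / D.n = -i := by push_cast; field_simp
    rw [this]
    module
  -- At `i = 1` both polynomials vanish, which leaves `f` on the image of `d - 1`, that is,
  -- everywhere in degree zero.
  have hf0 : ∀ x, f (D.xl 0 x) = 0 := by
    intro x
    obtain ⟨y, rfl⟩ := (D.bijective_d_sub_id hd).2 x
    have e := hlx 1 (D.eigProj 0 y) (D.eigProj_mem 0 y)
    rw [← eigProj_d, ← map_sub, Int.cast_one, one_smul, xl_eigProj] at e
    simpa using e
  -- The cubic vanishes at `i = -1` and isolates `B(∂, ·)`; afterwards `i = 2` isolates `q`.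
  have hp : ∀ x ∈ D.eigen 0, B.1 D.del (D.incl x) = 0 := by
    intro x hx
    have e := hlx (-1) x hx
    rw [hf0] at e
    push_cast at e
    linear_combination (1 / 2) * e
  have hq : q = 0 := by
    refine LinearMap.ext fun z => ?_
    obtain ⟨x, rfl⟩ := D.quotProj_surjective z
    have e := hlx 2 (D.eigProj 0 x) (D.eigProj_mem 0 x)
    rw [hf0, hp _ (D.eigProj_mem 0 x)] at e
    have e2 : D.quotProj (D.eigProj 0 x) = D.quotProj x :=
      Subtype.ext (congrArg D.relations.mkQ (D.eigProj_eigProj 0 x))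
    rw [e2] at e
    push_cast at e
    rw [LinearMap.zero_apply]
    linear_combination 2 * e
  have hxx : ∀ (k : ℤ), ∀ x ∈ D.eigen k, ∀ y ∈ D.eigen (-k),
      ((k : ℂ) / D.n) * B.1 (D.incl x) (D.incl y) + α.1 x y = 0 := by
    intro k x hx y hy
    have hxy : br x y ∈ D.eigen 0 := by
      rw [← add_neg_cancel k]
      exact D.br_mem_eigen hx hy
    have e := h (D.xl k x) (D.xl (-k) y)
    have e1 : D.invFormCocycle B.1 (D.xl k x) (D.xl (-k) y) =
        ((k : ℂ) / D.n) * B.1 (D.incl x) (D.incl y) + B.1 D.del (D.incl (br x y)) := by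
      change D.diagForm _ _ _ _ _ = _
      rw [D.diagForm_xl_xl _ _ _ hx hy, if_pos (add_neg_cancel _)]
      rfl
    have e2 : D.baseCocycle α.1 (D.xl k x) (D.xl (-k) y) = α.1 x y := by
      change D.diagForm _ _ _ _ _ = _
      rw [D.diagForm_xl_xl _ _ _ hx hy, if_pos (add_neg_cancel _)]
    rw [hνΩ, hq, e1, e2, hp _ hxy, br_xl_xl, add_neg_cancel, hf0, LinearMap.zero_apply] at e
    linear_combination e
  -- Replacing `k` by `k + n` keeps `x` and `y` and raises the coefficient `k/n` by one, which
  -- separates `B` from `α`.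
  have hBα : ∀ (k : ℤ), ∀ x ∈ D.eigen k, ∀ y ∈ D.eigen (-k),
      B.1 (D.incl x) (D.incl y) = 0 ∧ α.1 x y = 0 := by
    intro k x hx y hy
    have e := hxx k x hx y hy
    have e1 := hxx (k + D.n * 1) x (by rwa [eigen_add_mul]) y
      (by rwa [show -(k + (D.n : ℤ) * 1) = -k + D.n * (-1) by ring, eigen_add_mul])
    have e2 : ((k + D.n * 1 : ℤ) : ℂ) / D.n = k / D.n + 1 := by push_cast; field_simp
    rw [e2] at e1
    have e3 : B.1 (D.incl x) (D.incl y) = 0 := by linear_combination e1 - e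
    rw [e3] at e
    exact ⟨e3, by linear_combination e⟩
  have hα0 : α = 0 := Subtype.ext (D.form_eq_zero_of_eigen
    (LinearMap.congr_fun₂ α.2.2) fun k x hx y hy => (hBα k x hx y hy).2)
  -- Both `[𝔩_1, 𝔩_{-1}]` and `[𝔩_2, 𝔩_{-2}]` are multiples of `𝔩_0`, but only the second has a
  -- central term.
  have hdd : B.1 D.del D.del = 0 := by
    have e1 := h (D.lElt 1) (D.lElt (-1))
    have e2 := h (D.lElt 2) (D.lElt (-2))
    have e3 : ∀ i, D.invFormCocycle B.1 (D.lElt i) (D.lElt (-i)) =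
        ((i : ℂ) ^ 3 - i) / 12 * B.1 D.del D.del := by
      intro i
      change D.diagForm _ _ _ _ _ = _
      rw [D.diagForm_lElt_lElt, if_pos (add_neg_cancel _)]
    rw [hνΩ, hq, hα0, br_lElt_lElt, LinearMap.zero_apply, e3] at e1 e2
    simp only [add_neg_cancel, map_smul, smul_eq_mul, ZeroMemClass.coe_zero, map_zero,
      LinearMap.zero_apply] at e1 e2
    push_cast at e1 e2
    linear_combination 2 * e2 - 4 * e1
  have hσ := LinearMap.congr_fun₂ B.2.2
  have hdel : D.σDDot D.del = D.del := Prod.ext rfl (map_zero D.σ)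
  have hincl : ∀ x, D.σDDot (D.incl x) = D.incl (D.σ x) := fun x => rfl
  have hB0 : B = 0 := by
    refine Subtype.ext (D.DDot_form_ext B.2.1 (Submodule.zero_mem _) hdd (fun x => ?_)
      fun x y => ?_)
    · refine LinearMap.congr_fun (f := B.1 D.del ∘ₗ D.incl) (g := 0)
        (D.functional_eq_zero_of_eigen (fun x => ?_) hp) x
      have e := hσ D.del (D.incl x)
      rwa [pullForm_apply, hdel, hincl] at e
    · refine LinearMap.congr_fun₂ (f := B.1.compl₁₂ D.incl D.incl) (g := 0)
        (D.form_eq_zero_of_eigen (fun x y => ?_) fun k x hx y hy => (hBα k x hx y hy).1) x y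
      have e := hσ (D.incl x) (D.incl y)
      rwa [pullForm_apply, hincl, hincl] at e
  have hν0 : ν = 0 := LinearMap.ext fun z => by
    rw [hν, hq, hB0, hα0, map_zero, map_zero, LinearMap.zero_apply, LinearMap.zero_apply]
    simp
  -- Now `f` vanishes on brackets. Elements of nonzero degree are brackets with `𝔩_0`, and `𝔩_0` is
  -- a multiple of `[𝔩_1, 𝔩_{-1}]`.
  refine ⟨D.L_hom_ext (fun m => ?_) fun k x hx => ?_, hν0⟩
  · by_cases hm : m = 0
    · subst hm
      have e := h (D.lElt 1) (D.lElt (-1))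
      rw [hν0, br_lElt_lElt, map_smul, LinearMap.zero_apply, add_neg_cancel] at e
      rw [LinearMap.zero_apply]
      push_cast at e
      rw [smul_eq_mul] at e
      linear_combination (-1 / 2) * e
    · have e := h (D.lElt 0) (D.lElt m)
      rw [hν0, br_lElt_lElt, map_smul, LinearMap.zero_apply, zero_add, add_zero, smul_eq_zero,
        Int.cast_zero, sub_zero, Int.cast_eq_zero] at e
      exact e.resolve_left hm
  · by_cases hk : k = 0
    · subst hk; exact hf0 x
    · have e := h (D.lElt 0) (D.xl k x)
      rw [hν0, br_lElt_zero_xl, map_smul, LinearMap.zero_apply, add_zero, smul_eq_zero] at e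
      exact e.resolve_left (div_ne_zero (Int.cast_ne_zero.2 hk) hn)

end TwistDatum

/-! ### Parity and linear maps -/

section Parity

variable {V : Type*} [AddCommGroup V] [Module ℂ V] [SuperSpace V]
variable {W : Type*} [AddCommGroup W] [Module ℂ W] [SuperSpace W]

theorem parityMap_parityMap (v : V) : parityMap V (parityMap V v) = v := by
  obtain ⟨a, ha, b, hb, rfl⟩ := exists_decomp v
  rw [map_add, map_add, parityMap_even ha, parityMap_odd hb, map_neg, parityMap_even ha,
    parityMap_odd hb, neg_neg]

theorem mem_even_of_parityMap {v : V} (h : parityMap V v = v) : v ∈ part (V := V) 0 := by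
  have := half_add_parityMap_mem v
  rwa [h, ← two_smul ℂ, smul_smul, inv_mul_cancel₀ two_ne_zero, one_smul] at this

theorem mem_odd_of_parityMap {v : V} (h : parityMap V v = -v) : v ∈ part (V := V) 1 := by
  have := half_sub_parityMap_mem v
  rwa [h, sub_neg_eq_add, ← two_smul ℂ, smul_smul, inv_mul_cancel₀ two_ne_zero, one_smul] at this

/-- A linear map is even if and only if it commutes with the parity involutions. -/
theorem forall_map_mem_part_iff (f : V →ₗ[ℂ] W) :
    (∀ i, ∀ x ∈ part (V := V) i, f x ∈ part (V := W) i) ↔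
      ∀ x, f (parityMap V x) = parityMap W (f x) := by
  refine ⟨fun h x => ?_, fun h i x hx => ?_⟩
  · obtain ⟨a, ha, b, hb, rfl⟩ := exists_decomp x
    simp only [map_add, parityMap_even ha, parityMap_odd hb, map_neg, parityMap_even (h 0 a ha),
      parityMap_odd (h 1 b hb)]
  · have hx' := h x
    rcases zmod2_cases i with rfl | rfl
    · rw [parityMap_even hx] at hx'
      exact mem_even_of_parityMap hx'.symm
    · rw [parityMap_odd hx, map_neg] at hx'
      exact mem_odd_of_parityMap hx'.symm

theorem parityMap_apply_of_even {β : V →ₗ[ℂ] V →ₗ[ℂ] W}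
    (h : ∀ i j : ZMod 2, ∀ x ∈ part (V := V) i, ∀ y ∈ part (V := V) j,
      β x y ∈ part (V := W) (i + j)) (x y : V) :
    β (parityMap V x) (parityMap V y) = parityMap W (β x y) := by
  obtain ⟨a, ha, b, hb, rfl⟩ := exists_decomp x
  obtain ⟨a', ha', b', hb', rfl⟩ := exists_decomp y
  have h00 : β a a' ∈ part (V := W) 0 := h 0 0 a ha a' ha'
  have h01 : β a b' ∈ part (V := W) 1 := h 0 1 a ha b' hb'
  have h10 : β b a' ∈ part (V := W) 1 := h 1 0 b hb a' ha'
  have h11 : β b b' ∈ part (V := W) 0 := h 1 1 b hb b' hb'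
  simp only [map_add, LinearMap.add_apply, parityMap_even ha, parityMap_even ha',
    parityMap_odd hb, parityMap_odd hb', parityMap_even h00, parityMap_even h11,
    parityMap_odd h01, parityMap_odd h10, map_neg, LinearMap.neg_apply]
  abel

end Parity

section

variable {L : Type*} [AddCommGroup L] [Module ℂ L] [LieSuperalgebra L]
variable {M : Type*} [AddCommGroup M] [Module ℂ M]
variable {M' : Type*} [AddCommGroup M'] [Module ℂ M']

theorem IsSuperSkew.comp {β : L →ₗ[ℂ] L →ₗ[ℂ] M} (h : IsSuperSkew β) (f : M →ₗ[ℂ] M') :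
    IsSuperSkew (β.compr₂ f) := by
  intro i j x hx y hy
  rw [LinearMap.compr₂_apply, LinearMap.compr₂_apply, h i j x hx y hy, map_neg, map_smul]

theorem IsSuperClosed.comp {β : L →ₗ[ℂ] L →ₗ[ℂ] M} (h : IsSuperClosed β) (f : M →ₗ[ℂ] M') :
    IsSuperClosed (β.compr₂ f) := by
  intro i j x hx y hy z
  simp only [LinearMap.compr₂_apply]
  rw [h i j x hx y hy, map_add, map_smul]

end

theorem exists_comp_eq_of_ker_le {V W M : Type*} [AddCommGroup V] [Module ℂ V] [AddCommGroup W]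
    [Module ℂ W] [AddCommGroup M] [Module ℂ M] (T : V →ₗ[ℂ] W) (S : V →ₗ[ℂ] M)
    (h : LinearMap.ker T ≤ LinearMap.ker S) : ∃ F : W →ₗ[ℂ] M, F ∘ₗ T = S := by
  obtain ⟨R, hR⟩ := T.rangeRestrict.exists_rightInverse_of_surjective T.range_rangeRestrict
  obtain ⟨F, hF⟩ := LinearMap.exists_extend (S ∘ₗ R)
  refine ⟨F, LinearMap.ext fun t => ?_⟩
  have h1 : F (T t) = S (R (T.rangeRestrict t)) := LinearMap.congr_fun hF (T.rangeRestrict t)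
  have h2 : T (R (T.rangeRestrict t)) = T t :=
    congrArg Subtype.val (LinearMap.congr_fun hR (T.rangeRestrict t))
  have h3 : R (T.rangeRestrict t) - t ∈ LinearMap.ker T := by
    rw [LinearMap.mem_ker, map_sub, h2, sub_self]
  have h4 := h h3
  rw [LinearMap.mem_ker, map_sub, sub_eq_zero] at h4
  rw [LinearMap.comp_apply, h1, h4]

/-! ### A criterion for universality -/

theorem SuperHom.toLinearMap_injective {L L' : Type*} [AddCommGroup L] [Module ℂ L]
    [LieSuperalgebra L] [AddCommGroup L'] [Module ℂ L'] [LieSuperalgebra L'] {φ ψ : SuperHom L L'}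
    (h : φ.toLinearMap = ψ.toLinearMap) : φ = ψ := by
  cases φ; cases ψ
  simpa using h

/-- Brackets in a central extension depend on images only. Centrality is assumed in the left
argument; since `p` is even, its kernel is graded, and super skew-symmetry gives the right argument.
-/
theorem IsCentralExtension.br_eq {E L : Type*} [AddCommGroup E] [Module ℂ E] [LieSuperalgebra E]
    [AddCommGroup L] [Module ℂ L] [LieSuperalgebra L] {p : SuperHom E L}
    (hp : IsCentralExtension p) {a a' b b' : E} (ha : p.toLinearMap a = p.toLinearMap a')
    (hb : p.toLinearMap b = p.toLinearMap b') : br a b = br a' b' := by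
  have hr : ∀ e, p.toLinearMap e = 0 → ∀ e', br e' e = 0 := by
    intro e he e'
    have hpar := (forall_map_mem_part_iff p.toLinearMap).1 p.map_part e
    obtain ⟨x, hx, y, hy, rfl⟩ := exists_decomp e'
    obtain ⟨u, hu, v, hv, rfl⟩ := exists_decomp e
    rw [he, map_zero, map_add, parityMap_even hu, parityMap_odd hv, map_add, map_neg] at hpar
    rw [map_add] at he
    have hu0 : p.toLinearMap u = 0 := by
      linear_combination (norm := module) (1 / 2 : ℂ) • he + (1 / 2 : ℂ) • hpar
    have hv0 : p.toLinearMap v = 0 := by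
      linear_combination (norm := module) (1 / 2 : ℂ) • he - (1 / 2 : ℂ) • hpar
    have h1 := br_skew 0 0 x hx u hu
    have h2 := br_skew 0 1 x hx v hv
    have h3 := br_skew 1 0 y hy u hu
    have h4 := br_skew 1 1 y hy v hv
    rw [hp.2 u hu0, smul_zero, neg_zero] at h1 h3
    rw [hp.2 v hv0, smul_zero, neg_zero] at h2 h4
    simp only [map_add, LinearMap.add_apply, h1, h2, h3, h4, add_zero]
  have h1 := hp.2 (a - a') (by rw [map_sub, ha, sub_self]) b
  have h2 := hr (b - b') (by rw [map_sub, hb, sub_self]) a'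
  rw [map_sub, LinearMap.sub_apply, sub_eq_zero] at h1
  rw [map_sub, sub_eq_zero] at h2
  rw [h1, h2]

namespace CentralExt

variable {L : Type u} [AddCommGroup L] [Module ℂ L] [LieSuperalgebra L]
variable {Z : Type v} [AddCommGroup Z] [Module ℂ Z] [SuperSpace Z] {Ω : evenCocycles L Z}

theorem isCentralExtension_proj : IsCentralExtension (CentralExt.proj Ω) := by
  refine ⟨fun x => ⟨(x, 0), rfl⟩, ?_⟩
  rintro ⟨x, z⟩ hx ⟨y, z'⟩
  have hx' : x = 0 := hx
  subst hx'
  exact Prod.ext (LinearMap.map_zero₂ br y) (LinearMap.map_zero₂ Ω.1 y)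

variable {M : Type*} [AddCommGroup M] [Module ℂ M]

/-- The hypothesis says that no nonzero functional on `L ⊕ Z` kills all brackets, so brackets span.
Functionals on the target reduce the claim to this. -/
theorem hom_ext (hperf : ∀ (f : L →ₗ[ℂ] ℂ) (ν : Z →ₗ[ℂ] ℂ),
      (∀ u v, f (br u v) + ν (Ω.1 u v) = 0) → f = 0 ∧ ν = 0)
    {F F' : CentralExt Ω →ₗ[ℂ] M} (h : ∀ a b, F (br a b) = F' (br a b)) : F = F' := by
  refine LinearMap.ext fun a => ?_
  rw [← sub_eq_zero, ← Module.forall_dual_apply_eq_zero_iff ℂ]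
  intro φ
  let G : (L × Z) →ₗ[ℂ] ℂ := φ ∘ₗ (F - F')
  have hG : ∀ x z, G (x, z) = G (x, 0) + G (0, z) := fun x z => by
    rw [← map_add, Prod.mk_add_mk, add_zero, zero_add]
  obtain ⟨h1, h2⟩ := hperf (G ∘ₗ LinearMap.inl ℂ L Z) (G ∘ₗ LinearMap.inr ℂ L Z) fun u v => by
    refine (hG (br u v) (Ω.1 u v)).symm.trans ?_
    exact (congrArg φ (sub_eq_zero.2 (h ((u, 0) : L × Z) ((v, 0) : L × Z)))).trans (map_zero φ)
  change G (a.1, a.2) = 0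
  rw [hG]
  exact (congrArg₂ (· + ·) (LinearMap.congr_fun h1 a.1) (LinearMap.congr_fun h2 a.2)).trans
    (add_zero 0)

/-- The map exists as soon as every tensor killed by both the bracket and `Ω` is killed by `β`. This
can be tested after composition with each functional, where the scalar hypothesis applies, so no
choice of `f` and `ν` has to be made coherently. -/
theorem exists_factor (hfact : ∀ β : L →ₗ[ℂ] L →ₗ[ℂ] ℂ, IsSuperSkew β → IsSuperClosed β →
      ∃ (f : L →ₗ[ℂ] ℂ) (ν : Z →ₗ[ℂ] ℂ), ∀ u v, β u v = f (br u v) + ν (Ω.1 u v))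
    {β : L →ₗ[ℂ] L →ₗ[ℂ] M} (hs : IsSuperSkew β) (hc : IsSuperClosed β) :
    ∃ F : CentralExt Ω →ₗ[ℂ] M, ∀ a b, F (br a b) = β a.1 b.1 := by
  let T : TensorProduct ℂ L L →ₗ[ℂ] L × Z :=
    (TensorProduct.lift (br (L := L))).prod (TensorProduct.lift Ω.1)
  obtain ⟨F, hF⟩ := exists_comp_eq_of_ker_le T (TensorProduct.lift β) fun t ht => by
    rw [LinearMap.mem_ker, ← Module.forall_dual_apply_eq_zero_iff ℂ]
    intro φ
    obtain ⟨f, ν, h⟩ := hfact (β.compr₂ φ) (hs.comp φ) (hc.comp φ)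
    have e : φ ∘ₗ TensorProduct.lift β = (f.coprod ν) ∘ₗ T :=
      TensorProduct.ext' fun u v => by simpa [T] using h u v
    rw [← LinearMap.comp_apply, e, LinearMap.comp_apply, LinearMap.mem_ker.1 ht, map_zero]
  exact ⟨F, fun a b => (LinearMap.congr_fun hF (a.1 ⊗ₜ[ℂ] b.1)).trans (TensorProduct.lift.tmul _ _)⟩

theorem parityMap_fst (a : CentralExt Ω) : (parityMap (CentralExt Ω) a).1 = parityMap L a.1 :=
  (forall_map_mem_part_iff (CentralExt.proj Ω).toLinearMap).1 (CentralExt.proj Ω).map_part a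

/-- `F` is even if it commutes with parity, and by perfectness this has to be checked only on
brackets, where `F` is the even map `β`. -/
theorem map_mem_part [SuperSpace M] (hperf : ∀ (f : L →ₗ[ℂ] ℂ) (ν : Z →ₗ[ℂ] ℂ),
      (∀ u v, f (br u v) + ν (Ω.1 u v) = 0) → f = 0 ∧ ν = 0) {β : L →ₗ[ℂ] L →ₗ[ℂ] M}
    (hβ : ∀ i j : ZMod 2, ∀ x ∈ part (V := L) i, ∀ y ∈ part (V := L) j,
      β x y ∈ part (V := M) (i + j))
    {F : CentralExt Ω →ₗ[ℂ] M} (hF : ∀ a b, F (br a b) = β a.1 b.1) :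
    ∀ i, ∀ x ∈ part (V := CentralExt Ω) i, F x ∈ part (V := M) i := by
  refine (forall_map_mem_part_iff F).2 (LinearMap.congr_fun (f := F ∘ₗ parityMap _)
    (g := parityMap M ∘ₗ F) (hom_ext hperf fun a b => ?_))
  rw [LinearMap.comp_apply, LinearMap.comp_apply, parityMap_br, hF, hF, parityMap_fst,
    parityMap_fst, parityMap_apply_of_even hβ]

/-- A central extension is universal when it is perfect and every scalar cocycle factors through
its cocycle up to a coboundary. -/
theorem isUniversalCentralExtension_proj (hperf : ∀ (f : L →ₗ[ℂ] ℂ) (ν : Z →ₗ[ℂ] ℂ),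
      (∀ u v, f (br u v) + ν (Ω.1 u v) = 0) → f = 0 ∧ ν = 0)
    (hfact : ∀ β : L →ₗ[ℂ] L →ₗ[ℂ] ℂ, IsSuperSkew β → IsSuperClosed β →
      ∃ (f : L →ₗ[ℂ] ℂ) (ν : Z →ₗ[ℂ] ℂ), ∀ u v, β u v = f (br u v) + ν (Ω.1 u v)) :
    IsUniversalCentralExtension.{max u v, u, w} (CentralExt.proj Ω) := by
  refine ⟨isCentralExtension_proj, fun E _ _ _ q hq => ?_⟩
  have hqP := (forall_map_mem_part_iff q.toLinearMap).1 q.map_part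
  have hqbr : ∀ x y, q.toLinearMap (br x y) = br (q.toLinearMap x) (q.toLinearMap y) := q.map_br
  -- An arbitrary linear section is made even by averaging it with its parity conjugate.
  obtain ⟨s, hs, hsP⟩ : ∃ s : L →ₗ[ℂ] E, (∀ x, q.toLinearMap (s x) = x) ∧
      ∀ i, ∀ x ∈ part (V := L) i, s x ∈ part (V := E) i := by
    obtain ⟨s, hs⟩ :=
      q.toLinearMap.exists_rightInverse_of_surjective (LinearMap.range_eq_top.2 hq.1)
    have hs' : ∀ x, q.toLinearMap (s x) = x := LinearMap.congr_fun hs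
    refine ⟨(2⁻¹ : ℂ) • (s + parityMap E ∘ₗ s ∘ₗ parityMap L), fun x => ?_,
      (forall_map_mem_part_iff _).2 fun x => ?_⟩
    · simp only [LinearMap.smul_apply, LinearMap.add_apply, LinearMap.comp_apply, map_smul, map_add,
        hqP, hs', parityMap_parityMap]
      module
    · simp only [LinearMap.smul_apply, LinearMap.add_apply, LinearMap.comp_apply, map_smul, map_add,
        parityMap_parityMap]
      rw [add_comm]
  -- The failure of `s` to preserve brackets. It takes values in the kernel of `q` and is a cocycle,
  -- so `F` can correct `s` to a homomorphism.
  let α : L →ₗ[ℂ] L →ₗ[ℂ] E := (br (L := E)).compl₁₂ s s - (br (L := L)).compr₂ s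
  have hα : ∀ x y, α x y = br (s x) (s y) - s (br x y) := fun _ _ => rfl
  have hqα : ∀ x y, q.toLinearMap (α x y) = 0 := fun x y => by
    rw [hα, map_sub, hqbr, hs, hs, hs, sub_self]
  have hqs : ∀ x y, q.toLinearMap (s (br x y)) = q.toLinearMap (br (s x) (s y)) := fun x y => by
    rw [hqbr, hs, hs, hs]
  have hskew : IsSuperSkew α := by
    intro i j x hx y hy
    rw [hα, hα, br_skew i j x hx y hy, br_skew i j _ (hsP i x hx) _ (hsP j y hy), map_neg, map_smul]
    module
  have hclosed : IsSuperClosed α := by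
    intro i j x hx y hy z
    rw [hα, hα, hα, hq.br_eq rfl (hqs y z), hq.br_eq (hqs x y) rfl, hq.br_eq rfl (hqs x z),
      br_jacobi i j x hx y hy z, br_jacobi i j _ (hsP i x hx) _ (hsP j y hy), map_add, map_smul]
    module
  have heven : ∀ i j : ZMod 2, ∀ x ∈ part (V := L) i, ∀ y ∈ part (V := L) j,
      α x y ∈ part (V := E) (i + j) := fun i j x hx y hy =>
    Submodule.sub_mem _ (br_mem i j _ (hsP i x hx) _ (hsP j y hy))
      (hsP _ _ (br_mem i j x hx y hy))
  obtain ⟨F, hF⟩ := exists_factor (Ω := Ω) hfact hskew hclosed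
  have hqF : ∀ a, q.toLinearMap (F a) = 0 :=
    LinearMap.congr_fun (f := q.toLinearMap ∘ₗ F) (g := 0) (hom_ext hperf fun a b => by
      rw [LinearMap.comp_apply, hF, hqα, LinearMap.zero_apply])
  have hqφ : ∀ a : CentralExt Ω, q.toLinearMap (s a.1 + F a) = a.1 := fun a => by
    rw [map_add, hs, hqF, add_zero]
  refine ⟨⟨s ∘ₗ (CentralExt.proj Ω).toLinearMap + F, fun i a ha => Submodule.add_mem _
      (hsP i _ ha.1) (map_mem_part hperf heven hF i a ha), fun a b => ?_⟩, hqφ, fun ψ hψ => ?_⟩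
  · change s (br a.1 b.1) + F (br a b) = br (s a.1 + F a) (s b.1 + F b)
    rw [hF, hα, add_sub_cancel]
    exact hq.br_eq (by rw [hs, hqφ]) (by rw [hs, hqφ])
  -- Any two lifts agree on brackets, since these depend only on images in `L`, and brackets span.
  · refine SuperHom.toLinearMap_injective (hom_ext hperf fun a b => ?_)
    refine (ψ.map_br a b).trans ?_
    change _ = s (br a.1 b.1) + F (br a b)
    rw [hF, hα, add_sub_cancel]
    exact hq.br_eq ((hψ a).trans (hs a.1).symm) ((hψ b).trans (hs b.1).symm)

end CentralExt

/-! ### Even `ℂ^{1|1}`-valued cocycles and scalar cocycles -/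

theorem parityMap_C11 (z : ℂ × ℂ) : parityMap (ℂ × ℂ) z = (z.1, -z.2) := by
  have h0 : ((z.1, 0) : ℂ × ℂ) ∈ part (V := ℂ × ℂ) 0 := by
    simp [part]
  have h1 : ((0, z.2) : ℂ × ℂ) ∈ part (V := ℂ × ℂ) 1 := by
    simp [part]
  have e : z = (z.1, 0) + (0, z.2) := by simp
  conv_lhs => rw [e]
  rw [map_add, parityMap_even h0, parityMap_odd h1]
  simp

/-- The sum of the coordinates on `ℂ^{1|1}`. -/
def coordSum : (ℂ × ℂ) →ₗ[ℂ] ℂ := LinearMap.fst ℂ ℂ ℂ + LinearMap.snd ℂ ℂ ℂ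

theorem coordSum_apply (z : ℂ × ℂ) : coordSum z = z.1 + z.2 := rfl

theorem C11_ext {z z' : ℂ × ℂ} (h : coordSum z = coordSum z')
    (h' : coordSum (parityMap _ z) = coordSum (parityMap _ z')) : z = z' := by
  rw [parityMap_C11, parityMap_C11] at h'
  simp only [coordSum_apply] at h h'
  refine Prod.ext ?_ ?_
  · linear_combination (1 / 2) * h + (1 / 2) * h'
  · linear_combination (1 / 2) * h - (1 / 2) * h'

/-- The vector of `ℂ^{1|1}` with coordinate sum `a`, whose parity conjugate has coordinate
sum `b`. -/
def splitC11 (a b : ℂ) : ℂ × ℂ := ((a + b) / 2, (a - b) / 2)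

theorem coordSum_splitC11 (a b : ℂ) : coordSum (splitC11 a b) = a := by
  rw [coordSum_apply, splitC11]; ring

theorem parityMap_splitC11 (a b : ℂ) : parityMap (ℂ × ℂ) (splitC11 a b) = splitC11 b a := by
  rw [parityMap_C11, splitC11, splitC11]
  refine Prod.ext ?_ ?_ <;> dsimp only <;> ring

section

variable {V : Type*} [AddCommGroup V] [Module ℂ V] [SuperSpace V]

theorem exists_even_map (f : V →ₗ[ℂ] ℂ) : ∃ F : V →ₗ[ℂ] ℂ × ℂ,
    (∀ i, ∀ x ∈ part (V := V) i, F x ∈ part (V := ℂ × ℂ) i) ∧ ∀ x, coordSum (F x) = f x := by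
  let F : V →ₗ[ℂ] ℂ × ℂ := ((2⁻¹ : ℂ) • (f + f ∘ₗ parityMap V)).prod
    ((2⁻¹ : ℂ) • (f - f ∘ₗ parityMap V))
  have hF : ∀ x, F x = splitC11 (f x) (f (parityMap V x)) := fun x => by
    refine Prod.ext ?_ ?_ <;> simp [F, splitC11] <;> ring
  refine ⟨F, (forall_map_mem_part_iff F).2 fun x => ?_, fun x => ?_⟩
  · rw [hF, hF, parityMap_parityMap, parityMap_splitC11]
  · rw [hF, coordSum_splitC11]

theorem mem_part_of_parityMap_apply {β : V →ₗ[ℂ] V →ₗ[ℂ] ℂ × ℂ}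
    (h : ∀ x y, β (parityMap V x) (parityMap V y) = parityMap _ (β x y)) (i j : ZMod 2) (x : V)
    (hx : x ∈ part (V := V) i) (y : V) (hy : y ∈ part (V := V) j) :
    β x y ∈ part (V := ℂ × ℂ) (i + j) := by
  have e := h x y
  rcases zmod2_cases i with rfl | rfl <;> rcases zmod2_cases j with rfl | rfl
  · rw [parityMap_even hx, parityMap_even hy] at e
    exact mem_even_of_parityMap e.symm
  · rw [parityMap_even hx, parityMap_odd hy, map_neg] at e
    exact mem_odd_of_parityMap e.symm
  · rw [parityMap_odd hx, parityMap_even hy, map_neg, LinearMap.neg_apply] at e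
    exact mem_odd_of_parityMap e.symm
  · rw [parityMap_odd hx, parityMap_odd hy, map_neg, map_neg, LinearMap.neg_apply, neg_neg] at e
    exact mem_even_of_parityMap e.symm

end

section

variable (L : Type*) [AddCommGroup L] [Module ℂ L] [LieSuperalgebra L]

/-- The scalar cocycle `(x, y) ↦ α₁(x, y) + α₂(x, y)` of an even `ℂ^{1|1}`-valued cocycle. -/
def toScalarCocycle : evenCocycles L (ℂ × ℂ) →ₗ[ℂ] scalarCocycles L where
  toFun α := ⟨α.1.compr₂ coordSum,
    IsSuperSkew.comp (β := α.1) α.2.2.1 coordSum, IsSuperClosed.comp (β := α.1) α.2.2.2 coordSum⟩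
  map_add' _ _ := Subtype.ext (LinearMap.ext₂ fun _ _ => map_add coordSum _ _)
  map_smul' c _ := Subtype.ext (LinearMap.ext₂ fun _ _ => map_smul coordSum c _)

variable {L}

theorem evenCocycles_ext {α α' : evenCocycles L (ℂ × ℂ)}
    (h : ∀ x y, coordSum (α.1 x y) = coordSum (α'.1 x y)) : α = α' := by
  refine Subtype.ext (LinearMap.ext₂ fun x y => C11_ext (h x y) ?_)
  rw [← parityMap_apply_of_even α.2.1, ← parityMap_apply_of_even α'.2.1, h]

/-- The coordinates of an even `ℂ^{1|1}`-valued form are the even and the odd part of their sum.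
Conversely, a scalar form and its parity conjugate recover both coordinates through `splitC11`. -/
theorem toScalarCocycle_bijective : Function.Bijective (toScalarCocycle L) := by
  refine ⟨fun α α' h => evenCocycles_ext fun x y =>
    LinearMap.congr_fun₂ (congrArg Subtype.val h) x y, ?_⟩
  rintro ⟨γ, hs, hc⟩
  have hγ : ∀ x y, pullForm (parityMap L) γ x y = γ (parityMap L x) (parityMap L y) :=
    fun _ _ => rfl
  have hs' : IsSuperSkew (pullForm (parityMap L) γ) := fun i j x hx y hy =>
    hs i j _ (parityMap_mem i hx) _ (parityMap_mem j hy)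
  have hc' : IsSuperClosed (pullForm (parityMap L) γ) := fun i j x hx y hy z => by
    rw [hγ, hγ, hγ, parityMap_br, parityMap_br, parityMap_br]
    exact hc i j _ (parityMap_mem i hx) _ (parityMap_mem j hy) _
  let β : L →ₗ[ℂ] L →ₗ[ℂ] ℂ × ℂ := LinearMap.mk₂ ℂ
    (fun x y => splitC11 (γ x y) (pullForm (parityMap L) γ x y))
    (fun _ _ _ => by refine Prod.ext ?_ ?_ <;> simp [splitC11] <;> ring)
    (fun _ _ _ => by refine Prod.ext ?_ ?_ <;> simp [splitC11] <;> ring)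
    (fun _ _ _ => by refine Prod.ext ?_ ?_ <;> simp [splitC11] <;> ring)
    (fun _ _ _ => by refine Prod.ext ?_ ?_ <;> simp [splitC11] <;> ring)
  have hβ : ∀ x y, β x y = splitC11 (γ x y) (pullForm (parityMap L) γ x y) := fun _ _ => rfl
  refine ⟨⟨β, mem_part_of_parityMap_apply fun x y => ?_, fun i j x hx y hy => ?_,
    fun i j x hx y hy z => ?_⟩, Subtype.ext (LinearMap.ext₂ fun x y => coordSum_splitC11 _ _)⟩
  · rw [hβ, hβ, parityMap_splitC11, hγ, hγ, parityMap_parityMap, parityMap_parityMap]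
  · rw [hβ, hβ, hs i j x hx y hy, hs' i j x hx y hy]
    refine Prod.ext ?_ ?_ <;> simp [splitC11] <;> ring
  · rw [hβ, hβ, hβ, hc i j x hx y hy z, hc' i j x hx y hy z]
    refine Prod.ext ?_ ?_ <;> simp [splitC11] <;> ring

/-- A scalar functional of mixed parity is the coordinate sum of an even map to `ℂ^{1|1}`. -/
theorem mem_evenCoboundaries_iff (α : evenCocycles L (ℂ × ℂ)) :
    α ∈ evenCoboundaries L (ℂ × ℂ) ↔
      ∃ f : L →ₗ[ℂ] ℂ, ∀ x y, (toScalarCocycle L α).1 x y = f (br x y) := by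
  constructor
  · rintro ⟨f, -, h⟩
    exact ⟨coordSum ∘ₗ f, fun x y => congrArg coordSum (h x y)⟩
  · rintro ⟨f, h⟩
    obtain ⟨F, hF, hFs⟩ := exists_even_map f
    refine ⟨F, hF, fun x y => C11_ext ((h x y).trans (hFs _).symm) ?_⟩
    rw [← parityMap_apply_of_even α.2.1, ← (forall_map_mem_part_iff F).1 hF, parityMap_br, hFs]
    exact h _ _

/-- The class in `H²(L, ℂ^{1|1})₀` of a scalar cocycle. -/
def scalarClass : scalarCocycles L →ₗ[ℂ] EvenH2 L (ℂ × ℂ) :=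
  (evenCoboundaries L (ℂ × ℂ)).mkQ ∘ₗ
    (LinearEquiv.ofBijective _ (toScalarCocycle_bijective (L := L))).symm.toLinearMap

theorem scalarClass_toScalarCocycle (α : evenCocycles L (ℂ × ℂ)) :
    scalarClass (toScalarCocycle L α) = (evenCoboundaries L (ℂ × ℂ)).mkQ α :=
  congrArg (evenCoboundaries L (ℂ × ℂ)).mkQ
    ((LinearEquiv.ofBijective _ (toScalarCocycle_bijective (L := L))).symm_apply_apply α)

theorem scalarClass_surjective : Function.Surjective (scalarClass (L := L)) := by
  intro c
  obtain ⟨α, rfl⟩ := (evenCoboundaries L (ℂ × ℂ)).mkQ_surjective c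
  exact ⟨_, scalarClass_toScalarCocycle α⟩

theorem scalarClass_eq_zero_iff (γ : scalarCocycles L) :
    scalarClass γ = 0 ↔ ∃ f : L →ₗ[ℂ] ℂ, ∀ x y, γ.1 x y = f (br x y) := by
  obtain ⟨α, rfl⟩ := toScalarCocycle_bijective.2 γ
  rw [scalarClass_toScalarCocycle, Submodule.mkQ_apply, Submodule.Quotient.mk_eq_zero,
    mem_evenCoboundaries_iff]

theorem scalarClass_eq_iff (γ γ' : scalarCocycles L) :
    scalarClass γ = scalarClass γ' ↔ ∃ f : L →ₗ[ℂ] ℂ, ∀ x y, γ.1 x y - γ'.1 x y = f (br x y) := by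
  rw [← sub_eq_zero, ← map_sub, scalarClass_eq_zero_iff]
  rfl

/-- If a central extension is perfect and every scalar cocycle factors through its cocycle `Ω` up
to a coboundary, then the second cohomology is dual to the centre. -/
theorem nonempty_dual_equiv_EvenH2 {Z : Type*} [AddCommGroup Z] [Module ℂ Z] [SuperSpace Z]
    {Ω : evenCocycles L Z} (hperf : ∀ (f : L →ₗ[ℂ] ℂ) (ν : Z →ₗ[ℂ] ℂ),
      (∀ u v, f (br u v) + ν (Ω.1 u v) = 0) → f = 0 ∧ ν = 0)
    (hfact : ∀ β : L →ₗ[ℂ] L →ₗ[ℂ] ℂ, IsSuperSkew β → IsSuperClosed β →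
      ∃ (f : L →ₗ[ℂ] ℂ) (ν : Z →ₗ[ℂ] ℂ), ∀ u v, β u v = f (br u v) + ν (Ω.1 u v)) :
    Nonempty (Module.Dual ℂ Z ≃ₗ[ℂ] EvenH2 L (ℂ × ℂ)) := by
  let T : Module.Dual ℂ Z →ₗ[ℂ] scalarCocycles L :=
    { toFun := fun ν => ⟨Ω.1.compr₂ ν, IsSuperSkew.comp (β := Ω.1) Ω.2.2.1 ν,
        IsSuperClosed.comp (β := Ω.1) Ω.2.2.2 ν⟩
      map_add' := fun _ _ => rfl
      map_smul' := fun _ _ => rfl }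
  have hT : ∀ ν u v, (T ν).1 u v = ν (Ω.1 u v) := fun _ _ _ => rfl
  refine ⟨LinearEquiv.ofBijective (scalarClass ∘ₗ T) ⟨?_, fun c => ?_⟩⟩
  · refine (injective_iff_map_eq_zero _).2 fun ν hν => ?_
    obtain ⟨f, hf⟩ := (scalarClass_eq_zero_iff (T ν)).1 hν
    refine (hperf (-f) ν fun u v => ?_).2
    rw [← hT, hf, LinearMap.neg_apply, neg_add_cancel]
  · obtain ⟨γ, rfl⟩ := scalarClass_surjective c
    obtain ⟨f, ν, h⟩ := hfact γ.1 γ.2.1 γ.2.2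
    refine ⟨ν, (scalarClass_eq_iff _ _).2 ⟨-f, fun u v => ?_⟩⟩
    rw [h, hT, LinearMap.neg_apply]
    ring

end

/-! ### Fixed cohomology classes and fixed cocycles of `g` -/

namespace TwistDatum

variable {g : Type u} [AddCommGroup g] [Module ℂ g] [LieSuperalgebra g] (D : TwistDatum g)

theorem derForm_mem_scalar {γ : g →ₗ[ℂ] g →ₗ[ℂ] ℂ} (h : γ ∈ scalarCocycles g) :
    derForm D.d γ ∈ scalarCocycles g := by
  obtain ⟨α, hα⟩ := toScalarCocycle_bijective.2 ⟨γ, h⟩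
  have := (toScalarCocycle g ⟨_, D.derForm_mem α.1 α.2⟩).2
  convert this using 1
  refine LinearMap.ext₂ fun x y => ?_
  have e : ∀ x y, γ x y = coordSum (α.1 x y) := fun x y =>
    (LinearMap.congr_fun₂ (congrArg Subtype.val hα) x y).symm
  rw [derForm_apply, e, e, ← map_add]
  rfl

theorem pullForm_mem_scalar {γ : g →ₗ[ℂ] g →ₗ[ℂ] ℂ} (h : γ ∈ scalarCocycles g) :
    pullForm D.σ.toLinearMap γ ∈ scalarCocycles g := by
  obtain ⟨α, hα⟩ := toScalarCocycle_bijective.2 ⟨γ, h⟩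
  have := (toScalarCocycle g ⟨_, D.pullForm_mem α.1 α.2⟩).2
  convert this using 1
  refine LinearMap.ext₂ fun x y => ?_
  exact (LinearMap.congr_fun₂ (congrArg Subtype.val hα) (D.σ x) (D.σ y)).symm

theorem dH2_scalarClass (γ : scalarCocycles g) :
    D.dH2 (scalarClass γ) = scalarClass ⟨_, D.derForm_mem_scalar γ.2⟩ := by
  obtain ⟨α, rfl⟩ := toScalarCocycle_bijective.2 γ
  have e : (⟨_, D.derForm_mem_scalar (toScalarCocycle g α).2⟩ : scalarCocycles g) =
      toScalarCocycle g ⟨_, D.derForm_mem α.1 α.2⟩ :=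
    Subtype.ext (LinearMap.ext₂ fun x y => (map_add coordSum _ _).symm)
  rw [e, scalarClass_toScalarCocycle, scalarClass_toScalarCocycle]
  rfl

theorem σH2_scalarClass (γ : scalarCocycles g) :
    D.σH2 (scalarClass γ) = scalarClass ⟨_, D.pullForm_mem_scalar γ.2⟩ := by
  obtain ⟨α, rfl⟩ := toScalarCocycle_bijective.2 γ
  have e : (⟨_, D.pullForm_mem_scalar (toScalarCocycle g α).2⟩ : scalarCocycles g) =
      toScalarCocycle g ⟨_, D.pullForm_mem α.1 α.2⟩ := rfl
  rw [e, scalarClass_toScalarCocycle, scalarClass_toScalarCocycle]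
  rfl

/-- The functional `f` vanishes on `(d - 1)[g, g]`. As `d - 1` preserves the finite-dimensional
space `[g, g]` and is injective, this is all of `[g, g]`. -/
theorem coboundary_eq_zero [FiniteDimensional ℂ g] (hd : ¬ Module.End.HasEigenvalue D.d 1)
    {f : g →ₗ[ℂ] ℂ} (h : ∀ x y, f (D.d (br x y)) = f (br x y)) (x y : g) : f (br x y) = 0 := by
  let N : Submodule ℂ g := Submodule.span ℂ {z | ∃ x y : g, z = br x y}
  let T : g →ₗ[ℂ] g := D.d - LinearMap.id
  have hN : ∀ z ∈ N, T z ∈ N := by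
    intro z hz
    refine Submodule.span_induction (p := fun z _ => T z ∈ N) ?_ (by simp) ?_ ?_ hz
    · rintro _ ⟨a, b, rfl⟩
      change D.d (br a b) - br a b ∈ N
      rw [D.d_br]
      exact Submodule.sub_mem _ (Submodule.add_mem _ (Submodule.subset_span ⟨_, _, rfl⟩)
        (Submodule.subset_span ⟨_, _, rfl⟩)) (Submodule.subset_span ⟨_, _, rfl⟩)
    · intro a b _ _ ha hb
      rw [map_add]; exact Submodule.add_mem _ ha hb
    · intro c a _ ha
      rw [map_smul]; exact Submodule.smul_mem _ _ ha
  have hf : ∀ z ∈ N, f (T z) = 0 := by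
    intro z hz
    refine Submodule.span_induction (p := fun z _ => f (T z) = 0) ?_ (by simp) ?_ ?_ hz
    · rintro _ ⟨a, b, rfl⟩
      change f (D.d (br a b) - br a b) = 0
      rw [map_sub, h, sub_self]
    · intro a b _ _ ha hb
      rw [map_add, map_add, ha, hb, add_zero]
    · intro c a _ ha
      rw [map_smul, map_smul, ha, smul_zero]
  have hinj : Function.Injective (T.restrict hN) := fun a b hab =>
    Subtype.ext ((D.bijective_d_sub_id hd).1 (congrArg Subtype.val hab))
  obtain ⟨w, hw⟩ := LinearMap.surjective_of_injective hinj
    ⟨br x y, Submodule.subset_span ⟨x, y, rfl⟩⟩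
  rw [← hf w.1 w.2]
  exact congrArg f (congrArg Subtype.val hw).symm

/-- By `coboundary_eq_zero` a coboundary fixed by `d` is zero, so a fixed class has at most one
fixed representative. One exists because `d - 1` can be inverted on functionals. -/
theorem nonempty_Z2Fixed_equiv_H2Fixed [FiniteDimensional ℂ g]
    (hd : ¬ Module.End.HasEigenvalue D.d 1) : Nonempty (D.Z2Fixed ≃ₗ[ℂ] D.H2Fixed) := by
  let ι : D.Z2Fixed →ₗ[ℂ] scalarCocycles g :=
    Submodule.inclusion (inf_le_left.trans inf_le_left)
  let S : D.Z2Fixed →ₗ[ℂ] D.H2Fixed := (scalarClass ∘ₗ ι).codRestrict D.H2Fixed fun γ => by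
    refine ⟨(D.dH2_scalarClass (ι γ)).trans ?_, (D.σH2_scalarClass (ι γ)).trans ?_⟩
    · exact congrArg scalarClass (Subtype.ext γ.2.1.2)
    · exact congrArg scalarClass (Subtype.ext γ.2.2)
  refine ⟨LinearEquiv.ofBijective S ⟨?_, ?_⟩⟩
  · refine (injective_iff_map_eq_zero _).2 fun γ hγ => ?_
    obtain ⟨f, hf⟩ := (scalarClass_eq_zero_iff (ι γ)).1 (congrArg Subtype.val hγ)
    have hf' : ∀ x y, γ.1 x y = f (br x y) := hf
    refine Subtype.ext (LinearMap.ext₂ fun x y => (hf' x y).trans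
      (D.coboundary_eq_zero hd (fun x y => ?_) x y))
    rw [D.d_br, map_add, ← hf', ← hf', ← hf', D.Z2Fixed_d γ.2]
  · rintro ⟨c, hc1, hc2⟩
    obtain ⟨γ, rfl⟩ := scalarClass_surjective c
    obtain ⟨f, hf⟩ := (scalarClass_eq_iff _ _).1 ((D.dH2_scalarClass γ).symm.trans hc1)
    obtain ⟨h, hh⟩ := (scalarClass_eq_iff _ _).1 ((D.σH2_scalarClass γ).symm.trans hc2)
    simp only [derForm_apply] at hf
    simp only [pullForm_apply, LinearEquiv.coe_coe] at hh
    -- With `dγ - γ = f([·,·])` and `f' ∘ (d - 1) = f`, subtracting `f'([·,·])` from `γ` gives a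
    -- form fixed by `d`.
    let T : g ≃ₗ[ℂ] g := LinearEquiv.ofBijective _ (D.bijective_d_sub_id hd)
    let f' : g →ₗ[ℂ] ℂ := f ∘ₗ T.symm.toLinearMap
    have hf' : ∀ x, f' (D.d x) = f' x + f x := fun x => by
      have : f' (T x) = f x := congrArg f (T.symm_apply_apply x)
      change f' (D.d x - x) = f x at this
      rw [map_sub] at this
      linear_combination this
    let δ : g →ₗ[ℂ] g →ₗ[ℂ] ℂ := γ.1 - (br (L := g)).compr₂ f'
    have hδ : ∀ x y, δ x y = γ.1 x y - f' (br x y) := fun _ _ => rfl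
    have hδd : ∀ x y, δ (D.d x) y + δ x (D.d y) = δ x y := fun x y => by
      have e := hf' (br x y)
      rw [D.d_br, map_add] at e
      rw [hδ, hδ, hδ]
      linear_combination hf x y - e
    -- The form `σδ - δ` is a coboundary fixed by `d`, hence zero.
    have hδσ : ∀ x y, δ (D.σ x) (D.σ y) = δ x y := fun x y => by
      let k : g →ₗ[ℂ] ℂ := h - f' ∘ₗ D.σ.toLinearMap + f'
      have hk : ∀ x y, δ (D.σ x) (D.σ y) - δ x y = k (br x y) := fun x y => by
        change _ = h (br x y) - f' (D.σ (br x y)) + f' (br x y)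
        rw [hδ, hδ, D.σ_br, ← hh]
        ring
      rw [← sub_eq_zero, hk]
      refine D.coboundary_eq_zero hd (fun x y => ?_) x y
      rw [D.d_br, map_add, ← hk, ← hk, ← hk, D.σ_d, D.σ_d, ← hδd (D.σ x) (D.σ y), ← hδd x y]
      ring
    refine ⟨⟨δ, ⟨⟨IsSuperSkew.sub (β := γ.1) γ.2.1 (isSuperSkew_coboundary f'),
      IsSuperClosed.sub (β := γ.1) γ.2.2 (isSuperClosed_coboundary f')⟩,
      LinearMap.ext₂ hδd⟩, LinearMap.ext₂ hδσ⟩, Subtype.ext ?_⟩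
    refine (scalarClass_eq_iff _ _).2 ⟨-f', fun x y => ?_⟩
    change δ x y - γ.1 x y = -f' (br x y)
    rw [hδ]
    ring

end TwistDatum

end

/-! ### The theorem -/

theorem theorem1 {g : Type u} [AddCommGroup g] [Module ℂ g] [FiniteDimensional ℂ g]
    [LieSuperalgebra g] (D : TwistDatum g) (hd : ¬ Module.End.HasEigenvalue D.d 1) :
    Nonempty (EvenH2 D.L (ℂ × ℂ) ≃ₗ[ℂ] D.H2Fixed × D.InvFixed × D.QuotFixed) ∧
    ∃ Ω : evenCocycles D.L D.Centre, D.IsExplicit Ω ∧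
      IsUniversalCentralExtension.{u, u, w} (CentralExt.proj Ω) := by
  have hperf : ∀ (f : D.L →ₗ[ℂ] ℂ) (ν : D.Centre →ₗ[ℂ] ℂ),
      (∀ u v, f (LieSuperalgebra.br u v) + ν (D.univCocycle.1 u v) = 0) → f = 0 ∧ ν = 0 :=
    fun _ _ => D.eq_zero_of_functional hd
  have hfact : ∀ β : D.L →ₗ[ℂ] D.L →ₗ[ℂ] ℂ, IsSuperSkew β → IsSuperClosed β →
      ∃ (f : D.L →ₗ[ℂ] ℂ) (ν : D.Centre →ₗ[ℂ] ℂ),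
        ∀ u v, β u v = f (LieSuperalgebra.br u v) + ν (D.univCocycle.1 u v) :=
    fun _ => D.exists_factor_add_coboundary hd
  refine ⟨?_, D.univCocycle, D.univCocycle_isExplicit,
    CentralExt.isUniversalCentralExtension_proj hperf hfact⟩
  obtain ⟨e⟩ := nonempty_dual_equiv_EvenH2 hperf hfact
  obtain ⟨e'⟩ := D.nonempty_Z2Fixed_equiv_H2Fixed hd
  -- The cohomology is the dual of the centre. It involves the dual of `Q^σ` and double duals, and
  -- these are matched with the spaces themselves by dimension only.
  have h : Module.finrank ℂ (Module.Dual ℂ D.Centre) =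
      Module.finrank ℂ (D.Z2Fixed × D.InvFixed × D.QuotFixed) := by
    rw [Subspace.dual_finrank_eq, Module.finrank_prod, Module.finrank_prod,
      Subspace.dual_finrank_eq, Subspace.dual_finrank_eq, Module.finrank_prod, Module.finrank_prod]
    ring
  exact ⟨e.symm.trans ((LinearEquiv.ofFinrankEq _ _ h).trans
    (e'.prodCongr (LinearEquiv.refl ℂ _)))⟩
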